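/- Notation. Let $\langle x\rangle = 1+|x|$. Let $\varphi=(\varphi_-,\varphi_+)\in L^2(\mathbb{R}/\mathbb{Z},\mathbb{C})\times L^2(\mathbb{R}/\mathbb{Z},\mathbb{C})$ have the Fourier series $\sum_{n\in\mathbb{Z}}(\varphi^-_{2n}e^{-2\pi i n x},\varphi^+_{2n}e^{2\pi i n x})$, and put $$\|\varphi\|_1^2=\sum_{n\in\mathbb{Z}}\langle 2n\pi\rangle^{2}\bigl(|\varphi^-_{2n}|^2+|\varphi^+_{2n}|^2\bigr).$$ Let $H^1_c$ be the space of all such $\varphi$ with $\|\varphi\|_1<\infty$. Consider the Zakharov–Shabat operator $$L(\varphi)=\begin{pmatrix} i & \\ & -i\end{pmatrix}\frac{d}{dx}+\begin{pmatrix} & \varphi_-\\ \varphi_+ & \end{pmatrix}$$ in $L^2([0,2],\mathbb{C}^2)$ with periodic boundary conditions on $[0,2]$, that is, with domain all absolutely continuous $f$ with $f'\in L^2$ and $f(0)=f(2)$. Let $\preccurlyeq$ be the lexicographic order on $\mathbb{C}$ (first by real part, then by imaginary part). Theorem. Suppose $\varphi\in H^1_c$. The eigenvalues of $L(\varphi)$,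 listed with their algebraic multiplicities, can be written in exactly one way as a bi-infinite sequence $$\cdots\preccurlyeq\lambda_{n-1}^+\preccurlyeq\lambda_n^-\preccurlyeq\lambda_n^+\preccurlyeq\lambda_{n+1}^-\preccurlyeq\cdots,\qquad \sum_{n\in\mathbb{Z}}|\lambda_n^\pm-n\pi|^2<\infty .$$ For each $n\in\mathbb{Z}$ with $\langle n\rangle\ge 8\|\varphi\|_1^2$, $$|\lambda_n^\pm-n\pi|\le\frac{\|\varphi\|_1^2}{\langle n\rangle}+\frac{\sqrt2\,\|\varphi\|_1}{\langle 2n\rangle}\le\frac{\pi}{5},$$ while the remaining eigenvalues, that is, all $\lambda_n^\pm$ with $\langle n\rangle<8\|\varphi\|_1^2$, are contained in the box $$\bigl\{\lambda\in\mathbb{C}:\ |\operatorname{Re}\lambda|\le(8\|\varphi\|_1^2-\tfrac12)\pi,\quad|\operatorname{Im}\lambda|\le\|\varphi\|_1\bigr\}.$$ -/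

import Mathlib

open MeasureTheory

noncomputable section

namespace ZakharovShabat

/-! ### Potentials and the Sobolev norm -/

/-- `L²(𝕋, ℂ)` on the circle `𝕋 = ℝ/ℤ` of length one. -/
abbrev L2Circle : Type := Lp ℂ 2 (AddCircle.haarAddCircle : Measure UnitAddCircle)

/-- The space `L²_c = L²(𝕋, ℂ) × L²(𝕋, ℂ)` of potentials `φ = (φ₋, φ₊)`. -/
abbrev Potential : Type := L2Circle × L2Circle

/-- The bracket `⟨x⟩ = 1 + |x|`. -/
def bracket (x : ℝ) : ℝ := 1 + |x|

/-- `φ⁻_{2n}`, the coefficient of `e^{-2πinx}` in the Fourier series of `φ₋`. -/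
def coeffMinus (φ : Potential) (n : ℤ) : ℂ := fourierCoeff (⇑φ.1) (-n)

/-- `φ⁺_{2n}`, the coefficient of `e^{2πinx}` in the Fourier series of `φ₊`. -/
def coeffPlus (φ : Potential) (n : ℤ) : ℂ := fourierCoeff (⇑φ.2) n

/-- The summand `⟨2nπ⟩² (|φ⁻_{2n}|² + |φ⁺_{2n}|²)` of the squared `H¹` norm. -/
def h1Term (φ : Potential) (n : ℤ) : ℝ :=
  bracket (2 * n * Real.pi) ^ 2 * (‖coeffMinus φ n‖ ^ 2 + ‖coeffPlus φ n‖ ^ 2)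

/-- `φ ∈ H¹_c`: the series defining the squared `H¹` norm of `φ` converges. -/
def MemH1 (φ : Potential) : Prop := Summable (h1Term φ)

/-- The norm `‖φ‖₁` of `φ ∈ H¹_c`. -/
def h1Norm (φ : Potential) : ℝ := Real.sqrt (∑' n : ℤ, h1Term φ n)

/-! ### The Zakharov–Shabat operator on `[0, 2]` with periodic boundary conditions -/

/-- `L²([0, 2], ℂ)`. -/
abbrev L2Interval : Type := Lp ℂ 2 (volume.restrict (Set.Ioc (0 : ℝ) 2))

/-- `f` has an absolutely continuous representative `F` on `[0, 2]` with `F(0) = F(2)`, and `d ∈ L²`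
is its derivative: `F(x) = c + ∫₀ˣ d`. -/
def IsPeriodicDeriv (f d : L2Interval) : Prop :=
  (∃ c : ℂ, ∀ᵐ x ∂(volume.restrict (Set.Ioc (0 : ℝ) 2)), f x = c + ∫ t in (0 : ℝ)..x, d t) ∧
    ∫ t in (0 : ℝ)..2, d t = 0

theorem intervalIntegrable_coe (d : L2Interval) {x : ℝ} (hx : x ∈ Set.Icc (0 : ℝ) 2) :
    IntervalIntegrable (⇑d) volume 0 x := by
  have h : IntegrableOn (⇑d) (Set.Ioc (0 : ℝ) 2) volume :=
    (Lp.memLp d).integrable (by norm_num)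
  rw [intervalIntegrable_iff_integrableOn_Ioc_of_le hx.1]
  exact h.mono_set (Set.Ioc_subset_Ioc_right hx.2)

theorem integral_congr_coe {u v : ℝ → ℂ} (h : u =ᵐ[volume.restrict (Set.Ioc (0 : ℝ) 2)] v)
    {x : ℝ} (hx : x ∈ Set.Icc (0 : ℝ) 2) :
    ∫ t in (0 : ℝ)..x, u t = ∫ t in (0 : ℝ)..x, v t := by
  rw [intervalIntegral.integral_of_le hx.1, intervalIntegral.integral_of_le hx.1]
  exact integral_congr_ae
    (ae_restrict_of_ae_restrict_of_subset (Set.Ioc_subset_Ioc_right hx.2) h)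

theorem integral_add_coe (d e : L2Interval) {x : ℝ} (hx : x ∈ Set.Icc (0 : ℝ) 2) :
    ∫ t in (0 : ℝ)..x, (d + e) t = (∫ t in (0 : ℝ)..x, d t) + ∫ t in (0 : ℝ)..x, e t := by
  rw [← intervalIntegral.integral_add (intervalIntegrable_coe d hx) (intervalIntegrable_coe e hx)]
  exact integral_congr_coe (Lp.coeFn_add d e) hx

theorem integral_smul_coe (a : ℂ) (d : L2Interval) {x : ℝ} (hx : x ∈ Set.Icc (0 : ℝ) 2) :
    ∫ t in (0 : ℝ)..x, (a • d) t = a * ∫ t in (0 : ℝ)..x, d t := by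
  rw [← smul_eq_mul, ← intervalIntegral.integral_smul]
  exact integral_congr_coe (Lp.coeFn_smul a d) hx

theorem IsPeriodicDeriv.add {f d g e : L2Interval} (h : IsPeriodicDeriv f d)
    (k : IsPeriodicDeriv g e) : IsPeriodicDeriv (f + g) (d + e) := by
  obtain ⟨⟨c, hc⟩, h0⟩ := h
  obtain ⟨⟨b, hb⟩, k0⟩ := k
  refine ⟨⟨c + b, ?_⟩, ?_⟩
  · filter_upwards [hc, hb, Lp.coeFn_add f g, ae_restrict_mem measurableSet_Ioc]
      with x h1 h2 h3 hx
    rw [h3, Pi.add_apply, h1, h2, integral_add_coe d e ⟨hx.1.le, hx.2⟩]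
    ring
  · rw [integral_add_coe d e (by norm_num), h0, k0, add_zero]

theorem IsPeriodicDeriv.smul {f d : L2Interval} (a : ℂ) (h : IsPeriodicDeriv f d) :
    IsPeriodicDeriv (a • f) (a • d) := by
  obtain ⟨⟨c, hc⟩, h0⟩ := h
  refine ⟨⟨a * c, ?_⟩, ?_⟩
  · filter_upwards [hc, Lp.coeFn_smul a f, ae_restrict_mem measurableSet_Ioc] with x h1 h3 hx
    rw [h3, Pi.smul_apply, h1, integral_smul_coe a d ⟨hx.1.le, hx.2⟩, smul_eq_mul]
    ring
  · rw [integral_smul_coe a d (by norm_num), h0, mul_zero]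

theorem IsPeriodicDeriv.zero : IsPeriodicDeriv 0 0 := by
  have h : ∀ x ∈ Set.Icc (0 : ℝ) 2, ∫ t in (0 : ℝ)..x, (0 : L2Interval) t = 0 := by
    intro x hx
    rw [integral_congr_coe (Lp.coeFn_zero ℂ 2 (volume.restrict (Set.Ioc (0 : ℝ) 2))) hx]
    simp
  refine ⟨⟨0, ?_⟩, h 2 (by norm_num)⟩
  filter_upwards [Lp.coeFn_zero ℂ 2 (volume.restrict (Set.Ioc (0 : ℝ) 2)),
    ae_restrict_mem measurableSet_Ioc] with x h1 hx
  rw [h1, h x ⟨hx.1.le, hx.2⟩]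
  simp

theorem IsPeriodicDeriv.eq_zero {d : L2Interval} (h : IsPeriodicDeriv 0 d) : d = 0 := by
  obtain ⟨⟨c, hc⟩, -⟩ := h
  have hi : IntervalIntegrable (⇑d) volume 0 2 := intervalIntegrable_coe d (by norm_num)
  have hcont : ContinuousOn (fun x : ℝ => c + ∫ t in (0 : ℝ)..x, d t) (Set.Ioc 0 2) := by
    have h1 := intervalIntegral.continuousOn_primitive_interval
      ((intervalIntegrable_iff' (f := ⇑d)).1 hi)
    rw [Set.uIcc_of_le (by norm_num : (0 : ℝ) ≤ 2)] at h1
    exact continuousOn_const.add (h1.mono Set.Ioc_subset_Icc_self)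
  have hz : ∀ x ∈ Set.Ioc (0 : ℝ) 2, c + ∫ t in (0 : ℝ)..x, d t = 0 := by
    refine Measure.eqOn_Ioc_of_ae_eq (μ := volume) (g := fun _ => (0 : ℂ)) ?_ hcont
      continuousOn_const
    filter_upwards [hc, Lp.coeFn_zero ℂ 2 (volume.restrict (Set.Ioc (0 : ℝ) 2))] with x h1 h2
    rw [← h1, h2]
    rfl
  have hd := hi.ae_hasDerivAt_integral
  have hne : ∀ᵐ x : ℝ, x ≠ 2 := by simp [ae_iff, measure_singleton]
  refine Lp.ext ?_
  filter_upwards [ae_restrict_of_ae hd, ae_restrict_of_ae hne, ae_restrict_mem measurableSet_Ioc,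
    Lp.coeFn_zero ℂ 2 (volume.restrict (Set.Ioc (0 : ℝ) 2))] with x h1 h2 hx h3
  have hx' : x ∈ Set.uIcc (0 : ℝ) 2 := by
    rw [Set.uIcc_of_le (by norm_num)]
    exact ⟨hx.1.le, hx.2⟩
  have h4 := h1 hx' 0 Set.left_mem_uIcc
  have h5 : (fun y : ℝ => ∫ t in (0 : ℝ)..y, d t) =ᶠ[nhds x] fun _ => -c := by
    filter_upwards [Ioo_mem_nhds hx.1 (lt_of_le_of_ne hx.2 h2)] with y hy
    have := hz y ⟨hy.1, hy.2.le⟩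
    linear_combination this
  rw [h3]
  exact h4.unique ((hasDerivAt_const x (-c)).congr_of_eventuallyEq h5)

/-- The Hilbert space (as a vector space) `L²([0, 2], ℂ²)`, with elements `f = (f₋, f₊)`. -/
abbrev StateSpace : Type := L2Interval × L2Interval

/-- The graph of the Zakharov–Shabat operator `L(φ)`: the pairs `(f, g)` with
`g₋ = i f₋' + φ₋ f₊` and `g₊ = -i f₊' + φ₊ f₋`, where the potential is extended to `ℝ` with period
one, and `f` has an absolutely continuous representative with `f(0) = f(2)` and `f' ∈ L²`. -/
def zsGraph (φ : Potential) : Submodule ℂ (StateSpace × StateSpace) where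
  carrier := {p | ∃ d : StateSpace, IsPeriodicDeriv p.1.1 d.1 ∧ IsPeriodicDeriv p.1.2 d.2 ∧
    (∀ᵐ x ∂(volume.restrict (Set.Ioc (0 : ℝ) 2)),
      p.2.1 x = Complex.I * d.1 x + φ.1 (x : UnitAddCircle) * p.1.2 x) ∧
    (∀ᵐ x ∂(volume.restrict (Set.Ioc (0 : ℝ) 2)),
      p.2.2 x = -Complex.I * d.2 x + φ.2 (x : UnitAddCircle) * p.1.1 x)}
  add_mem' := by
    rintro p q ⟨d, h1, h2, h3, h4⟩ ⟨e, k1, k2, k3, k4⟩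
    refine ⟨d + e, h1.add k1, h2.add k2, ?_, ?_⟩
    · filter_upwards [h3, k3, Lp.coeFn_add p.2.1 q.2.1, Lp.coeFn_add d.1 e.1,
        Lp.coeFn_add p.1.2 q.1.2] with x a1 a2 a3 a4 a5
      simp only [Prod.fst_add, Prod.snd_add, a3, a4, a5, Pi.add_apply, a1, a2]
      ring
    · filter_upwards [h4, k4, Lp.coeFn_add p.2.2 q.2.2, Lp.coeFn_add d.2 e.2,
        Lp.coeFn_add p.1.1 q.1.1] with x a1 a2 a3 a4 a5
      simp only [Prod.fst_add, Prod.snd_add, a3, a4, a5, Pi.add_apply, a1, a2]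
      ring
  zero_mem' := by
    have z := Lp.coeFn_zero ℂ 2 (volume.restrict (Set.Ioc (0 : ℝ) 2))
    refine ⟨0, IsPeriodicDeriv.zero, IsPeriodicDeriv.zero, ?_, ?_⟩ <;>
    · filter_upwards [z] with x hx
      simp only [Prod.fst_zero, Prod.snd_zero, hx, Pi.zero_apply, mul_zero, add_zero]
  smul_mem' := by
    rintro a p ⟨d, h1, h2, h3, h4⟩
    refine ⟨a • d, h1.smul a, h2.smul a, ?_, ?_⟩
    · filter_upwards [h3, Lp.coeFn_smul a p.2.1, Lp.coeFn_smul a d.1, Lp.coeFn_smul a p.1.2]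
        with x a1 a3 a4 a5
      simp only [Prod.smul_fst, Prod.smul_snd, a3, a4, a5, Pi.smul_apply, a1, smul_eq_mul]
      ring
    · filter_upwards [h4, Lp.coeFn_smul a p.2.2, Lp.coeFn_smul a d.2, Lp.coeFn_smul a p.1.1]
        with x a1 a3 a4 a5
      simp only [Prod.smul_fst, Prod.smul_snd, a3, a4, a5, Pi.smul_apply, a1, smul_eq_mul]
      ring

/-- The Zakharov–Shabat operator
`L(φ) = diag(i, -i) d/dx + [[0, φ₋], [φ₊, 0]]` on `[0, 2]` with periodic boundary conditions, an
unbounded operator in `L²([0, 2], ℂ²)`. -/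
def zsOperator (φ : Potential) : StateSpace →ₗ.[ℂ] StateSpace := (zsGraph φ).toLinearPMap

theorem zsGraph_functional (φ : Potential) (p : StateSpace × StateSpace) (hp : p ∈ zsGraph φ)
    (h0 : p.1 = 0) : p.2 = 0 := by
  obtain ⟨d, h1, h2, h3, h4⟩ := hp
  have z := Lp.coeFn_zero ℂ 2 (volume.restrict (Set.Ioc (0 : ℝ) 2))
  rw [h0] at h1 h2 h3 h4
  rw [h1.eq_zero] at h3
  rw [h2.eq_zero] at h4
  refine Prod.ext (Lp.ext ?_) (Lp.ext ?_)
  · filter_upwards [h3, z] with x hx hz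
    simp only [hx, Prod.fst_zero, Prod.snd_zero, hz, Pi.zero_apply, mul_zero, add_zero]
  · filter_upwards [h4, z] with x hx hz
    simp only [hx, Prod.fst_zero, Prod.snd_zero, hz, Pi.zero_apply, mul_zero, add_zero]

theorem zsOperator_graph (φ : Potential) : (zsOperator φ).graph = zsGraph φ :=
  Submodule.toLinearPMap_graph_eq _ (zsGraph_functional φ)

/-! ### Eigenvalues with algebraic multiplicity -/

/-- `ker (T - z)^k` for an unbounded operator `T`: zero for `k = 0`, and `f ∈ ker (T - z)^(k+1)` if
and only if `f` is in the domain of `T` and `T f - z f ∈ ker (T - z)^k`. -/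
def kerPow {H : Type*} [AddCommGroup H] [Module ℂ H] (T : H →ₗ.[ℂ] H) (z : ℂ) : ℕ → Submodule ℂ H
  | 0 => ⊥
  | k + 1 => ((kerPow T z k).comap (T.toFun - z • T.domain.subtype)).map T.domain.subtype

/-- The algebraic multiplicity of `z` as an eigenvalue of `T`, that is, the dimension of the root
space `⋃ₖ ker (T - z)^k`. It is positive if and only if `z` is an eigenvalue of `T`. -/
def algMult {H : Type*} [AddCommGroup H] [Module ℂ H] (T : H →ₗ.[ℂ] H) (z : ℂ) : ℕ∞ :=
  Cardinal.toENat (Module.rank ℂ (⨆ k : ℕ, kerPow T z k : Submodule ℂ H))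

/-- The lexicographic order on `ℂ`: first by the real part, second by the imaginary part. -/
def LexLE (z w : ℂ) : Prop := z.re < w.re ∨ (z.re = w.re ∧ z.im ≤ w.im)

/-- `lam n = (λₙ⁻, λₙ⁺)`, `n ∈ ℤ`, is the periodic spectrum of `φ`: the sequence of all eigenvalues
of `L(φ)`, listed with their algebraic multiplicities, in the lexicographic order
`⋯ ≼ λₙ₋₁⁺ ≼ λₙ⁻ ≼ λₙ⁺ ≼ λₙ₊₁⁻ ≼ ⋯`, with the labels normalised by `λₙ^± = nπ + ℓ²ₙ`. -/
structure IsPeriodicSpectrum (φ : Potential) (lam : ℤ → ℂ × ℂ) : Prop where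
  multiplicity : ∀ z : ℂ,
    {n : ℤ | (lam n).1 = z}.encard + {n : ℤ | (lam n).2 = z}.encard = algMult (zsOperator φ) z
  lex_pair : ∀ n : ℤ, LexLE (lam n).1 (lam n).2
  lex_succ : ∀ n : ℤ, LexLE (lam n).2 (lam (n + 1)).1
  asymp_minus : Summable fun n : ℤ => ‖(lam n).1 - (n : ℂ) * Real.pi‖ ^ 2
  asymp_plus : Summable fun n : ℤ => ‖(lam n).2 - (n : ℂ) * Real.pi‖ ^ 2

end ZakharovShabat

end

namespace ZakharovShabat

open Complex Metric Set

/-! ### Contour integrals over circles -/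

section CircleIntegral

variable {E F : Type*} [NormedAddCommGroup E] [NormedSpace ℂ E]
  [NormedAddCommGroup F] [NormedSpace ℂ F] [CompleteSpace F]

/-! Expand f₋ in e^{-iπmx} and f₊ in e^{iπmx}. Then `L(φ)` becomes D + Φ on ℓ²(ℤ) × ℓ²(ℤ), where D
is diag(mπ) on each component and Φ consists of two Hankel operators with entries p_{m+k} and
q_{m+k}. Since φ is in H¹, the sequences p and q are absolutely summable, so Φ is bounded. With the
compact operator B = (i - D)⁻¹ one has z - L = (i - D) J(z) for the bounded pencil J(z) = 1 + (z -
i)B - BΦ, and everything about the unbounded operator is read off from J: the root spaces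
(`mem_kerPow_iff`), the resolvent J(z)⁻¹B, and, by the Fredholm alternative, the existence of an
eigenvector wherever J(z) is not invertible.

Where eigenvalues can lie. Let α, β be the weighted norms of p and q, so that α² + β² = ‖φ‖₁². If z
is an eigenvalue in the strip |Re z - nπ| ≤ π/2 with ⟨n⟩ ≥ 8‖φ‖₁², Lyapunov–Schmidt reduction to the
n-th coordinates (a_n, b_n) applies. With R the free resolvent without its n-th entry, R H_p R has
norm of order α/⟨n⟩ (`WeightedBound.norm_reducedOp_hankelOp_reducedOp_le`), because 2n = (k+l) -
(k-n) - (l-n): for large n either the Hankel index or one of the two distances is large. What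
remains is a pair of inequalities linking |a_n| and |b_n|, whose product yields the stated radius
(`norm_sub_le_of_eigenvector`); this is at most 5/8 < π/5. Everywhere |Im z| ≤ ‖φ‖₁, as the Hankel
operators are bounded.

How many there are. The same bounds hold for tφ with 0 ≤ t ≤ 1, so the unit circles about nπ for ⟨n⟩
≥ 8‖φ‖₁², and large enough circles of radius (k + 1/2)π + 1/4 about 0, never meet the spectrum of
L(tφ). The Riesz projection of such a circle varies continuously with t, hence has constant rank,
namely twice the number of mπ inside (`exists_multiset_of_isUnit`). So each unit disc holds two
eigenvalues and the large disc 2(2k + 1).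

Labelling. The large discs grow by one pair on each side, so sorted finite lists glue to a monotone
sequence (`exists_enumeration`). The localization makes it nπ + O(1/⟨n⟩), hence square summable. Any
two admissible labellings have the same cut at Re z = (k + 1/2)π for large k, and counting
multiplicities to the left of that cut shows they agree (`eq_of_encard_fiber_eq`). -/

theorem clm_circleIntegral [CompleteSpace E] (L : E →L[ℂ] F) {f : ℂ → E} {c : ℂ} {r : ℝ}
    (hf : CircleIntegrable f c r) : L (∮ z in C(c, r), f z) = ∮ z in C(c, r), L (f z) := by
  unfold circleIntegral
  have h := L.intervalIntegral_comp_comm (μ := volume) hf.out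
  rw [← h]
  simp only [map_smul]

theorem circleIntegral_swap {c d : ℂ} {r s : ℝ} {f : ℂ → ℂ → E}
    (hf : ContinuousOn (fun x : ℂ × ℂ => f x.1 x.2) (sphere c |r| ×ˢ sphere d |s|)) :
    (∮ z in C(c, r), ∮ w in C(d, s), f z w) = ∮ w in C(d, s), ∮ z in C(c, r), f z w := by
  unfold circleIntegral
  have e1 : ∀ θ : ℝ, deriv (circleMap c r) θ • (∫ η in (0 : ℝ)..2 * Real.pi,
      deriv (circleMap d s) η • f (circleMap c r θ) (circleMap d s η)) =
      ∫ η in (0 : ℝ)..2 * Real.pi, deriv (circleMap c r) θ •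
        deriv (circleMap d s) η • f (circleMap c r θ) (circleMap d s η) := fun θ => by
    rw [← intervalIntegral.integral_smul]
  have e2 : ∀ η : ℝ, deriv (circleMap d s) η • (∫ θ in (0 : ℝ)..2 * Real.pi,
      deriv (circleMap c r) θ • f (circleMap c r θ) (circleMap d s η)) =
      ∫ θ in (0 : ℝ)..2 * Real.pi, deriv (circleMap c r) θ •
        deriv (circleMap d s) η • f (circleMap c r θ) (circleMap d s η) := fun η => by
    rw [← intervalIntegral.integral_smul]
    congr 1
    ext θ
    rw [smul_comm]
  simp only [e1, e2]
  refine intervalIntegral_intervalIntegral_swap ?_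
  have hc : Continuous (fun x : ℝ × ℝ => deriv (circleMap c r) x.1 •
        deriv (circleMap d s) x.2 • f (circleMap c r x.1) (circleMap d s x.2)) := by
    have h1 : Continuous (fun x : ℝ × ℝ => f (circleMap c r x.1) (circleMap d s x.2)) := by
      refine hf.comp_continuous (f := fun x : ℝ × ℝ => (circleMap c r x.1, circleMap d s x.2))
        ?_ ?_
      · exact ((continuous_circleMap c r).comp continuous_fst).prodMk
          ((continuous_circleMap d s).comp continuous_snd)
      · intro x
        exact ⟨circleMap_mem_sphere' c r x.1, circleMap_mem_sphere' d s x.2⟩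
    simp only [deriv_circleMap]
    have h2 : Continuous fun x : ℝ × ℝ => circleMap 0 r x.1 * I :=
      ((continuous_circleMap 0 r).comp continuous_fst).mul continuous_const
    have h3 : Continuous fun x : ℝ × ℝ => circleMap 0 s x.2 * I :=
      ((continuous_circleMap 0 s).comp continuous_snd).mul continuous_const
    exact h2.smul (h3.smul h1)
  have h4 := (hc.continuousOn
    (s := Icc 0 (2 * Real.pi) ×ˢ Icc 0 (2 * Real.pi))).integrableOn_compact
    (μ := volume.prod volume) (isCompact_Icc.prod isCompact_Icc)
  have hp : (0 : ℝ) ≤ 2 * Real.pi := by positivity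
  rw [uIoc_of_le hp]
  exact h4.mono_set (prod_mono Ioc_subset_Icc_self Ioc_subset_Icc_self)

end CircleIntegral

theorem circleIntegral_sub_inv_eq_zero {c w : ℂ} {r : ℝ} (hr : 0 ≤ r) (hw : w ∉ closedBall c r) :
    (∮ z in C(c, r), (z - w)⁻¹) = 0 := by
  have h : DifferentiableOn ℂ (fun z : ℂ => (z - w)⁻¹) (closedBall c r) := by
    intro z hz
    refine (DifferentiableAt.inv (by fun_prop) ?_).differentiableWithinAt
    rw [sub_ne_zero]
    rintro rfl
    exact hw hz
  exact h.diffContOnCl_ball (subset_refl _) |>.circleIntegral_eq_zero hr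

/-! ### The operator pencil, its resolvent and the Riesz projections -/

noncomputable section Pencil

variable {V : Type*} [NormedAddCommGroup V] [NormedSpace ℂ V]

/-- For an unbounded operator `L = D + Φ` with `B = (i - D)⁻¹` and `Φ` bounded, the operator pencil
`J(z) = 1 + (z - i) B - B Φ`, so that `z - L = (i - D) J(z)`. -/
def pencil (B Φ : V →L[ℂ] V) (z : ℂ) : V →L[ℂ] V := 1 + (z - I) • B - B * Φ

/-- The resolvent `(z - L)⁻¹ = J(z)⁻¹ B`. -/
def pencilResolvent (B Φ : V →L[ℂ] V) (z : ℂ) : V →L[ℂ] V := Ring.inverse (pencil B Φ z) * B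

/-- The root spaces `ker (L - z)^k`, expressed through the pencil. -/
def rootChain (B Φ : V →L[ℂ] V) (z : ℂ) : ℕ → Submodule ℂ V
  | 0 => ⊥
  | k + 1 => ((rootChain B Φ z k).map (B : V →ₗ[ℂ] V)).comap (pencil B Φ z : V →ₗ[ℂ] V)

/-- The Riesz projection `(2πi)⁻¹ ∮ (z - L)⁻¹ dz`. -/
def rieszProj (B Φ : V →L[ℂ] V) (c : ℂ) (r : ℝ) : V →L[ℂ] V :=
  (2 * Real.pi * I : ℂ)⁻¹ • ∮ z in C(c, r), pencilResolvent B Φ z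

/-- The compressed operator `(2πi)⁻¹ ∮ z (z - L)⁻¹ dz`. -/
def rieszPart (B Φ : V →L[ℂ] V) (c : ℂ) (r : ℝ) : V →L[ℂ] V :=
  (2 * Real.pi * I : ℂ)⁻¹ • ∮ z in C(c, r), z • pencilResolvent B Φ z

variable {B Φ : V →L[ℂ] V} {c : ℂ} {r : ℝ}

theorem pencil_eq_add (z w : ℂ) : pencil B Φ w = pencil B Φ z + (w - z) • B := by
  unfold pencil
  module

theorem pencil_mul_pencilResolvent {z : ℂ} (hz : IsUnit (pencil B Φ z)) :
    pencil B Φ z * pencilResolvent B Φ z = B := by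
  rw [pencilResolvent, ← mul_assoc, Ring.mul_inverse_cancel _ hz, one_mul]

/-- The first resolvent identity: J(w) - J(z) = (w - z)B, placed between J(z)⁻¹ and J(w)⁻¹B. -/
theorem pencilResolvent_mul_sub {z w : ℂ} (hz : IsUnit (pencil B Φ z))
    (hw : IsUnit (pencil B Φ w)) :
    (w - z) • (pencilResolvent B Φ z * pencilResolvent B Φ w) =
      pencilResolvent B Φ z - pencilResolvent B Φ w := by
  have h1 : pencilResolvent B Φ z * pencilResolvent B Φ w = Ring.inverse (pencil B Φ z) *
      (B * Ring.inverse (pencil B Φ w)) * B := by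
    simp only [pencilResolvent, mul_assoc]
  rw [h1, ← smul_mul_assoc, ← mul_smul_comm, ← smul_mul_assoc,
    show (w - z) • B = pencil B Φ w - pencil B Φ z by rw [pencil_eq_add z w]; abel, sub_mul,
    mul_sub, Ring.mul_inverse_cancel _ hw, ← mul_assoc, Ring.inverse_mul_cancel _ hz, one_mul,
    mul_one, sub_mul]
  rfl

theorem pencilResolvent_comm {z w : ℂ} (hz : IsUnit (pencil B Φ z))
    (hw : IsUnit (pencil B Φ w)) :
    pencilResolvent B Φ z * pencilResolvent B Φ w =
      pencilResolvent B Φ w * pencilResolvent B Φ z := by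
  rcases eq_or_ne z w with rfl | h
  · rfl
  have h1 := pencilResolvent_mul_sub hz hw
  have h2 := pencilResolvent_mul_sub hw hz
  have h3 : w - z ≠ 0 := sub_ne_zero.2 h.symm
  refine smul_right_injective _ h3 ?_
  simp only
  rw [h1, ← neg_sub z w, neg_smul, h2, neg_sub]

theorem continuous_pencil : Continuous (pencil B Φ) := by
  unfold pencil
  fun_prop

theorem mem_rootChain_succ {z : ℂ} {k : ℕ} {x : V} : x ∈ rootChain B Φ z (k + 1) ↔
    ∃ y ∈ rootChain B Φ z k, B y = pencil B Φ z x := by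
  rw [rootChain, Submodule.mem_comap, Submodule.mem_map]
  rfl

/-- The hypothesis B y = J(z)x encodes y = (z - L)x. Then J(w)x = B y + (w - z)B x, and applying
J(w)⁻¹ gives x = R(w)y + (w - z)R(w)x. -/
theorem pencilResolvent_rootChain {z w : ℂ} (hw : IsUnit (pencil B Φ w)) (hzw : w ≠ z) {x y : V}
    (h : B y = pencil B Φ z x) :
    pencilResolvent B Φ w x = (w - z)⁻¹ • x - (w - z)⁻¹ • pencilResolvent B Φ w y := by
  have h1 : pencil B Φ w x = B y + (w - z) • B x := by
    rw [pencil_eq_add z w, h]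
    rfl
  have h2 : Ring.inverse (pencil B Φ w) (pencil B Φ w x) = x := by
    change (Ring.inverse (pencil B Φ w) * pencil B Φ w) x = x
    rw [Ring.inverse_mul_cancel _ hw]
    rfl
  rw [h1, map_add, map_smul] at h2
  have h3 : x - pencilResolvent B Φ w y = (w - z) • pencilResolvent B Φ w x := by
    change x - Ring.inverse (pencil B Φ w) (B y) = (w - z) • Ring.inverse (pencil B Φ w) (B x)
    nth_rewrite 1 [← h2]
    abel
  rw [← smul_sub, h3, smul_smul, inv_mul_cancel₀ (sub_ne_zero.2 hzw), one_smul]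

theorem rootChain_eq_bot {z : ℂ} (hz : Function.Injective (pencil B Φ z)) (k : ℕ) :
    rootChain B Φ z k = ⊥ := by
  induction k with
  | zero => rfl
  | succ k ih =>
    rw [eq_bot_iff]
    intro x hx
    obtain ⟨y, hy, h⟩ := mem_rootChain_succ.1 hx
    rw [ih, Submodule.mem_bot] at hy
    rw [hy, map_zero] at h
    rw [Submodule.mem_bot]
    exact hz (by rw [← h, map_zero])

variable [CompleteSpace V]

theorem isOpen_isUnit_pencil : IsOpen {z | IsUnit (pencil B Φ z)} :=
  Units.isOpen.preimage continuous_pencil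

theorem differentiableAt_pencilResolvent {z : ℂ} (hz : IsUnit (pencil B Φ z)) :
    DifferentiableAt ℂ (pencilResolvent B Φ) z := by
  have h1 : DifferentiableAt ℂ (pencil B Φ) z := by
    unfold pencil
    fun_prop
  have h2 := (differentiableAt_inverse (𝕜 := ℂ) hz).comp z h1
  exact h2.mul_const B

theorem continuousOn_pencilResolvent {s : Set ℂ} (hs : ∀ z ∈ s, IsUnit (pencil B Φ z)) :
    ContinuousOn (pencilResolvent B Φ) s := fun z hz =>
  (differentiableAt_pencilResolvent (hs z hz)).continuousAt.continuousWithinAt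

theorem circleIntegrable_smul_pencilResolvent (hr : 0 < r)
    (hS : ∀ z ∈ sphere c r, IsUnit (pencil B Φ z)) {f : ℂ → ℂ} (hf : ContinuousOn f (sphere c r)) :
    CircleIntegrable (fun z => f z • pencilResolvent B Φ z) c r :=
  (hf.smul (continuousOn_pencilResolvent hS)).circleIntegrable hr.le

theorem circleIntegrable_pencilResolvent (hr : 0 < r)
    (hS : ∀ z ∈ sphere c r, IsUnit (pencil B Φ z)) :
    CircleIntegrable (pencilResolvent B Φ) c r :=
  (continuousOn_pencilResolvent hS).circleIntegrable hr.le

theorem circleIntegral_smul_pencilResolvent_mul (hr : 0 < r)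
    (hS : ∀ z ∈ sphere c r, IsUnit (pencil B Φ z)) {f : ℂ → ℂ} (hf : ContinuousOn f (sphere c r))
    (T : V →L[ℂ] V) :
    (∮ z in C(c, r), f z • pencilResolvent B Φ z) * T =
      ∮ z in C(c, r), f z • (pencilResolvent B Φ z * T) := by
  have h := clm_circleIntegral ((ContinuousLinearMap.mul ℂ (V →L[ℂ] V)).flip T)
    (circleIntegrable_smul_pencilResolvent hr hS hf)
  simpa using! h

theorem mul_circleIntegral_smul_pencilResolvent (hr : 0 < r)
    (hS : ∀ z ∈ sphere c r, IsUnit (pencil B Φ z)) {f : ℂ → ℂ} (hf : ContinuousOn f (sphere c r))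
    (T : V →L[ℂ] V) :
    T * (∮ z in C(c, r), f z • pencilResolvent B Φ z) =
      ∮ z in C(c, r), f z • (T * pencilResolvent B Φ z) := by
  have h := clm_circleIntegral (ContinuousLinearMap.mul ℂ (V →L[ℂ] V) T)
    (circleIntegrable_smul_pencilResolvent hr hS hf)
  simpa using! h

/-- The circle can be enlarged a little without leaving the resolvent set. -/
theorem exists_annulus_isUnit (hr : 0 < r) (hS : ∀ z ∈ sphere c r, IsUnit (pencil B Φ z)) :
    ∃ r' > r, ∀ z ∈ closedBall c r' \ ball c r, IsUnit (pencil B Φ z) := by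
  obtain ⟨δ, hδ, h⟩ := (isCompact_sphere c r).exists_thickening_subset_open
    (isOpen_isUnit_pencil (B := B) (Φ := Φ)) hS
  refine ⟨r + δ / 2, by linarith, fun z hz => h ?_⟩
  have h1 : dist z c ≤ r + δ / 2 := hz.1
  have h2 : r ≤ dist z c := by simpa using hz.2
  rw [mem_thickening_iff]
  have hn : (‖z - c‖ : ℂ) ≠ 0 := by
    rw [← dist_eq_norm]
    exact_mod_cast (hr.trans_le h2).ne'
  refine ⟨c + (r / ‖z - c‖ : ℂ) * (z - c), ?_, ?_⟩
  · rw [mem_sphere_iff_norm, add_sub_cancel_left, norm_mul, norm_div, Complex.norm_real,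
      Complex.norm_real, norm_norm, Real.norm_of_nonneg hr.le, div_mul_cancel₀]
    exact_mod_cast hn
  · rw [dist_eq_norm]
    have e : z - (c + (r / ‖z - c‖ : ℂ) * (z - c)) =
        ((‖z - c‖ - r) / ‖z - c‖ : ℂ) * (z - c) := by
      field_simp
      ring
    rw [dist_eq_norm] at h1 h2
    rw [e, norm_mul, norm_div, ← Complex.ofReal_sub, Complex.norm_real, Complex.norm_real,
      norm_norm, Real.norm_of_nonneg (by linarith), div_mul_cancel₀ _ (by exact_mod_cast hn)]
    linarith

/-- Idempotence by the two-circle argument: enlarging one circle leaves the projection unchanged;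
the resolvent identity splits the product, the term with the outer resolvent integrates to zero over
the inner circle, and Fubini with Cauchy's formula gives the other. -/
theorem rieszProj_mul_self (hr : 0 < r) (hS : ∀ z ∈ sphere c r, IsUnit (pencil B Φ z)) :
    rieszProj B Φ c r * rieszProj B Φ c r = rieszProj B Φ c r := by
  obtain ⟨r', hrr, hA⟩ := exists_annulus_isUnit hr hS
  have hr' : 0 < r' := hr.trans hrr
  have hS' : ∀ z ∈ sphere c r', IsUnit (pencil B Φ z) := fun z hz => hA z
    ⟨sphere_subset_closedBall hz, by
      simp only [mem_ball, not_lt]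
      rw [mem_sphere.1 hz]
      exact hrr.le⟩
  have hP : rieszProj B Φ c r' = rieszProj B Φ c r := by
    unfold rieszProj
    rw [Complex.circleIntegral_eq_of_differentiable_on_annulus_off_countable hr hrr.le
      countable_empty (continuousOn_pencilResolvent hA)]
    intro z hz
    refine differentiableAt_pencilResolvent (hA z ⟨ball_subset_closedBall hz.1.1, fun h => hz.1.2
      (ball_subset_closedBall h)⟩)
  set κ : ℂ := (2 * Real.pi * I : ℂ)⁻¹ with hκ
  have hκ1 : κ * (2 * Real.pi * I) = 1 := inv_mul_cancel₀ Complex.two_pi_I_ne_zero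
  -- the product with a resolvent outside the circle
  have h1 : ∀ w ∈ sphere c r', (∮ z in C(c, r), pencilResolvent B Φ z) * pencilResolvent B Φ w =
      ∮ z in C(c, r), (w - z)⁻¹ • pencilResolvent B Φ z := by
    intro w hw
    have hne : ∀ z ∈ sphere c r, w - z ≠ 0 := by
      intro z hz h
      rw [sub_eq_zero] at h
      subst h
      rw [mem_sphere] at hz hw
      linarith
    have hcont : ContinuousOn (fun z => (w - z)⁻¹) (sphere c r) :=
      (continuousOn_const.sub continuousOn_id).inv₀ hne
    have h2 := circleIntegral_smul_pencilResolvent_mul hr hS (f := fun _ => 1)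
      continuousOn_const (pencilResolvent B Φ w)
    simp only [one_smul] at h2
    rw [h2]
    have h3 : ∀ z ∈ sphere c r, pencilResolvent B Φ z * pencilResolvent B Φ w =
        (w - z)⁻¹ • pencilResolvent B Φ z - (w - z)⁻¹ • pencilResolvent B Φ w := by
      intro z hz
      rw [← smul_sub, ← pencilResolvent_mul_sub (hS z hz) (hS' w hw), smul_smul,
        inv_mul_cancel₀ (hne z hz), one_smul]
    have h3' : CircleIntegrable (fun z => (w - z)⁻¹ • pencilResolvent B Φ w) c r :=
      ContinuousOn.circleIntegrable hr.le (hcont.smul continuousOn_const)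
    rw [circleIntegral.integral_congr hr.le h3, circleIntegral.integral_sub
      (circleIntegrable_smul_pencilResolvent hr hS hcont) h3',
      circleIntegral.integral_smul_const]
    have h4 : (∮ z in C(c, r), (w - z)⁻¹) = 0 := by
      have h5 := circleIntegral_sub_inv_eq_zero (c := c) (w := w) hr.le (by
        rw [mem_closedBall, not_le]
        rw [mem_sphere] at hw
        linarith)
      have h6 : (fun z : ℂ => (w - z)⁻¹) = fun z => (-1 : ℂ) • (z - w)⁻¹ := by
        ext z
        rw [← neg_sub z w, inv_neg]
        simp
      rw [h6, circleIntegral.integral_smul, h5, smul_zero]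
    rw [h4, zero_smul, sub_zero]
  have h2 : rieszProj B Φ c r * rieszProj B Φ c r' = (κ * κ) • ∮ w in C(c, r'),
      ∮ z in C(c, r), (w - z)⁻¹ • pencilResolvent B Φ z := by
    rw [rieszProj, rieszProj, smul_mul_assoc, mul_smul_comm, smul_smul]
    have h3 := mul_circleIntegral_smul_pencilResolvent hr' hS' (f := fun _ => 1)
      continuousOn_const (∮ z in C(c, r), pencilResolvent B Φ z)
    simp only [one_smul] at h3
    rw [h3, circleIntegral.integral_congr hr'.le h1]
  have h3 : (∮ w in C(c, r'), ∮ z in C(c, r), (w - z)⁻¹ • pencilResolvent B Φ z) =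
      ∮ z in C(c, r), ∮ w in C(c, r'), (w - z)⁻¹ • pencilResolvent B Φ z := by
    refine circleIntegral_swap ?_
    rw [abs_of_pos hr, abs_of_pos hr']
    refine ContinuousOn.smul (ContinuousOn.inv₀
      (continuous_fst.sub continuous_snd).continuousOn ?_) ?_
    · rintro ⟨w, z⟩ ⟨hw, hz⟩ h
      have h : w - z = 0 := h
      rw [sub_eq_zero] at h
      simp only at h hw hz
      subst h
      rw [mem_sphere] at hz hw
      linarith
    · exact (continuousOn_pencilResolvent hS).comp continuousOn_snd fun x hx => hx.2
  have h4 : ∀ z ∈ sphere c r, (∮ w in C(c, r'), (w - z)⁻¹ • pencilResolvent B Φ z) =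
      (2 * Real.pi * I : ℂ) • pencilResolvent B Φ z := by
    intro z hz
    rw [circleIntegral.integral_smul_const, circleIntegral.integral_sub_inv_of_mem_ball]
    rw [mem_ball]
    rw [mem_sphere] at hz
    linarith
  calc rieszProj B Φ c r * rieszProj B Φ c r = rieszProj B Φ c r * rieszProj B Φ c r' := by rw [hP]
    _ = rieszProj B Φ c r := by
      rw [h2, h3, circleIntegral.integral_congr hr.le h4, circleIntegral.integral_smul, smul_smul,
        mul_assoc, hκ1, mul_one, rieszProj]

theorem rieszProj_mul_pencilResolvent (hr : 0 < r) (hS : ∀ z ∈ sphere c r, IsUnit (pencil B Φ z))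
    {w : ℂ} (hw : IsUnit (pencil B Φ w)) :
    rieszProj B Φ c r * pencilResolvent B Φ w = pencilResolvent B Φ w * rieszProj B Φ c r := by
  have h1 := circleIntegral_smul_pencilResolvent_mul hr hS (f := fun _ => 1) continuousOn_const
    (pencilResolvent B Φ w)
  have h2 := mul_circleIntegral_smul_pencilResolvent hr hS (f := fun _ => 1) continuousOn_const
    (pencilResolvent B Φ w)
  simp only [one_smul] at h1 h2
  rw [rieszProj, smul_mul_assoc, mul_smul_comm, h1, h2]
  congr 1
  exact circleIntegral.integral_congr hr.le fun z hz => pencilResolvent_comm (hS z hz) hw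

theorem rieszPart_mul_rieszProj (hr : 0 < r) (hS : ∀ z ∈ sphere c r, IsUnit (pencil B Φ z)) :
    rieszPart B Φ c r * rieszProj B Φ c r = rieszProj B Φ c r * rieszPart B Φ c r := by
  have h1 := circleIntegral_smul_pencilResolvent_mul hr hS (f := fun z => z) continuousOn_id
    (rieszProj B Φ c r)
  have h2 := mul_circleIntegral_smul_pencilResolvent hr hS (f := fun z => z) continuousOn_id
    (rieszProj B Φ c r)
  rw [rieszPart, smul_mul_assoc, mul_smul_comm, h1, h2]
  congr 1
  refine circleIntegral.integral_congr hr.le fun z hz => ?_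
  rw [rieszProj_mul_pencilResolvent hr hS (hS z hz)]

/-- The pencil form of (z - L)P = zP - A, with A the compressed operator: J(z)R(w) = B + (z - w)B
R(w), and the constant B integrates to zero over the circle. -/
theorem pencil_mul_rieszProj (hr : 0 < r) (hS : ∀ z ∈ sphere c r, IsUnit (pencil B Φ z)) (z : ℂ) :
    pencil B Φ z * rieszProj B Φ c r = B * (z • rieszProj B Φ c r - rieszPart B Φ c r) := by
  have h1 := mul_circleIntegral_smul_pencilResolvent hr hS (f := fun _ => 1) continuousOn_const
    (pencil B Φ z)
  have h2 := mul_circleIntegral_smul_pencilResolvent hr hS (f := fun _ => 1) continuousOn_const B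
  have h3 := mul_circleIntegral_smul_pencilResolvent hr hS (f := fun z => z) continuousOn_id B
  simp only [one_smul] at h1 h2
  have i1 := circleIntegrable_pencilResolvent hr hS
  have i2 := circleIntegrable_smul_pencilResolvent hr hS (f := fun z => z) continuousOn_id
  have h4 : ∀ w ∈ sphere c r, pencil B Φ z * pencilResolvent B Φ w =
      B + (ContinuousLinearMap.mul ℂ (V →L[ℂ] V) B)
        (z • pencilResolvent B Φ w - w • pencilResolvent B Φ w) := by
    intro w hw
    rw [pencil_eq_add w z, add_mul, pencil_mul_pencilResolvent (hS w hw), ← sub_smul,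
      ContinuousLinearMap.mul_apply', smul_mul_assoc, mul_smul_comm]
  have i3 : CircleIntegrable (fun w => z • pencilResolvent B Φ w - w • pencilResolvent B Φ w) c r :=
    CircleIntegrable.sub (circleIntegrable_smul_pencilResolvent hr hS (f := fun _ => z)
      continuousOn_const) i2
  have i4 : CircleIntegrable (fun w => (ContinuousLinearMap.mul ℂ (V →L[ℂ] V) B)
      (z • pencilResolvent B Φ w - w • pencilResolvent B Φ w)) c r := by
    refine ContinuousOn.circleIntegrable hr.le ((ContinuousLinearMap.continuous _).comp_continuousOn
      (ContinuousOn.sub ?_ ?_))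
    · exact ContinuousOn.smul (f := fun _ : ℂ => z) continuousOn_const
        (continuousOn_pencilResolvent hS)
    · exact ContinuousOn.smul (f := fun w : ℂ => w) continuousOn_id
        (continuousOn_pencilResolvent hS)
  have h5 : (∮ _w in C(c, r), B) = 0 := by
    have := circleIntegral.integral_smul_const (fun _ => (1 : ℂ)) B c r
    simp only [one_smul] at this
    rw [this]
    have h6 := circleIntegral.integral_sub_zpow_of_ne (n := 0) (by norm_num) c 0 r
    simp only [zpow_zero] at h6
    rw [h6, zero_smul]
  rw [rieszProj, rieszPart, mul_smul_comm, h1, circleIntegral.integral_congr hr.le h4,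
    circleIntegral.integral_add (circleIntegrable_const B c r) i4, h5, zero_add,
    ← clm_circleIntegral _ i3, circleIntegral.integral_sub
      (circleIntegrable_smul_pencilResolvent hr hS (f := fun _ => z) continuousOn_const) i2,
    circleIntegral.integral_smul, ContinuousLinearMap.mul_apply', ← mul_smul_comm, smul_sub,
    smul_comm z]

theorem rieszProj_apply (hr : 0 < r) (hS : ∀ z ∈ sphere c r, IsUnit (pencil B Φ z)) (x : V) :
    rieszProj B Φ c r x = (2 * Real.pi * I : ℂ)⁻¹ • ∮ z in C(c, r), pencilResolvent B Φ z x := by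
  have h := clm_circleIntegral (ContinuousLinearMap.apply ℂ V x)
    (circleIntegrable_pencilResolvent hr hS)
  simp only [ContinuousLinearMap.apply_apply] at h
  rw [rieszProj, smul_apply, h]

theorem continuousOn_pencilResolvent_apply {s : Set ℂ} (hs : ∀ z ∈ s, IsUnit (pencil B Φ z))
    (x : V) : ContinuousOn (fun w => pencilResolvent B Φ w x) s :=
  (ContinuousLinearMap.continuous (ContinuousLinearMap.apply ℂ V x)).comp_continuousOn
    (continuousOn_pencilResolvent hs)

theorem continuousOn_inv_pow {s : Set ℂ} {z : ℂ} (hz : z ∉ s) (j : ℕ) :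
    ContinuousOn (fun w : ℂ => ((w - z) ^ j)⁻¹) s := by
  refine ContinuousOn.inv₀ (by fun_prop) fun w hw => pow_ne_zero _ (sub_ne_zero.2 ?_)
  rintro rfl
  exact hz hw

/-- On a root vector, the moments of the resolvent over a circle are the residues of
`(w - z)^{-j-1}`. -/
theorem circleIntegral_pencilResolvent_rootChain (hr : 0 < r)
    (hS : ∀ z ∈ sphere c r, IsUnit (pencil B Φ z)) {z : ℂ} (hz : z ∉ sphere c r) (k : ℕ) :
    ∀ (j : ℕ), ∀ x ∈ rootChain B Φ z k,
      (∮ w in C(c, r), ((w - z) ^ j)⁻¹ • pencilResolvent B Φ w x) =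
        (∮ w in C(c, r), ((w - z) ^ (j + 1))⁻¹) • x := by
  -- The exponent j stays general: passing from x to y = (z - L)x raises it by one.
  induction k with
  | zero =>
    intro j x hx
    have hx : x = 0 := by simpa [rootChain] using hx
    subst hx
    simp [circleIntegral]
  | succ k ih =>
    intro j x hx
    obtain ⟨y, hy, hB⟩ := mem_rootChain_succ.1 hx
    have e : ∀ w ∈ sphere c r, ((w - z) ^ j)⁻¹ • pencilResolvent B Φ w x =
        ((w - z) ^ (j + 1))⁻¹ • x - ((w - z) ^ (j + 1))⁻¹ • pencilResolvent B Φ w y := by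
      intro w hw
      have hwz : w ≠ z := by
        rintro rfl
        exact hz hw
      rw [pencilResolvent_rootChain (hS w hw) hwz hB, smul_sub, smul_smul, smul_smul,
        ← mul_inv, ← pow_succ]
    have c1 := continuousOn_inv_pow hz (j + 1)
    have i1 : CircleIntegrable (fun w => ((w - z) ^ (j + 1))⁻¹ • x) c r :=
      ContinuousOn.circleIntegrable hr.le (c1.smul continuousOn_const)
    have i2 : CircleIntegrable (fun w => ((w - z) ^ (j + 1))⁻¹ • pencilResolvent B Φ w y) c r :=
      ContinuousOn.circleIntegrable hr.le (c1.smul (continuousOn_pencilResolvent_apply hS y))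
    -- By induction the contribution of y is this integral times y; the exponent is at least 2, so
    -- it has no residue.
    have h0 : (∮ w in C(c, r), ((w - z) ^ (j + 1 + 1))⁻¹) = 0 := by
      have := circleIntegral.integral_sub_zpow_of_ne (n := -(j + 1 + 1 : ℕ)) (by omega) c z r
      simpa only [zpow_neg, zpow_natCast] using this
    rw [circleIntegral.integral_congr hr.le e, circleIntegral.integral_sub i1 i2,
      circleIntegral.integral_smul_const, ih (j + 1) y hy, h0, zero_smul, sub_zero]

theorem rieszProj_rootChain_of_mem_ball (hr : 0 < r)
    (hS : ∀ z ∈ sphere c r, IsUnit (pencil B Φ z)) {z : ℂ} (hz : z ∈ ball c r) {k : ℕ} {x : V}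
    (hx : x ∈ rootChain B Φ z k) : rieszProj B Φ c r x = x := by
  have h := circleIntegral_pencilResolvent_rootChain hr hS (z := z)
    (fun h => (mem_ball.1 hz).ne (mem_sphere.1 h)) k 0 x hx
  simp only [pow_zero, inv_one, one_smul, zero_add, pow_one] at h
  rw [rieszProj_apply hr hS, h, circleIntegral.integral_sub_inv_of_mem_ball hz, smul_smul,
    inv_mul_cancel₀ Complex.two_pi_I_ne_zero, one_smul]

theorem rieszProj_rootChain_of_notMem (hr : 0 < r)
    (hS : ∀ z ∈ sphere c r, IsUnit (pencil B Φ z)) {z : ℂ} (hz : z ∉ closedBall c r) {k : ℕ}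
    {x : V} (hx : x ∈ rootChain B Φ z k) : rieszProj B Φ c r x = 0 := by
  have h := circleIntegral_pencilResolvent_rootChain hr hS (z := z)
    (fun h => hz (sphere_subset_closedBall h)) k 0 x hx
  simp only [pow_zero, inv_one, one_smul, zero_add, pow_one] at h
  rw [rieszProj_apply hr hS, h, circleIntegral_sub_inv_eq_zero hr.le hz, zero_smul, smul_zero]

end Pencil

/-! ### Eigenvalue multisets in finite dimension -/

section RootMultiset

/-- The eigenvalues of an endomorphism of a finite-dimensional space, listed with their algebraic
multiplicities. -/
theorem exists_multiset_maxGenEigenspace {W : Type*} [AddCommGroup W] [Module ℂ W]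
    [FiniteDimensional ℂ W] (f : Module.End ℂ W) :
    ∃ S : Multiset ℂ, S.card = Module.finrank ℂ W ∧
      ∀ z, S.count z = Module.finrank ℂ (f.maxGenEigenspace z) := by
  classical
  have hds := DirectSum.isInternal_submodule_of_iSupIndep_of_iSup_eq_top
    f.independent_maxGenEigenspace f.iSup_maxGenEigenspace_eq_top
  have hfin : {μ | f.maxGenEigenspace μ ≠ ⊥}.Finite :=
    WellFoundedGT.finite_ne_bot_of_iSupIndep f.independent_maxGenEigenspace
  -- The trace of the identity turns the decomposition into generalized eigenspaces into the
  -- dimension formula.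
  have htr := LinearMap.trace_eq_sum_trace_restrict' hds hfin (f := LinearMap.id)
    (fun _ x hx => hx)
  have hid : ∀ z, LinearMap.trace ℂ (f.maxGenEigenspace z)
      ((LinearMap.id : W →ₗ[ℂ] W).restrict (fun x (hx : x ∈ f.maxGenEigenspace z) => hx)) =
      (Module.finrank ℂ (f.maxGenEigenspace z) : ℂ) := fun z => by
    rw [← LinearMap.trace_id]
    rfl
  rw [LinearMap.trace_id, Finset.sum_congr rfl fun z _ => hid z] at htr
  refine ⟨∑ z ∈ hfin.toFinset,
    Multiset.replicate (Module.finrank ℂ (f.maxGenEigenspace z)) z, ?_, fun z => ?_⟩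
  · rw [Multiset.card_sum]
    simp only [Multiset.card_replicate]
    exact_mod_cast htr.symm
  · rw [Multiset.count_sum']
    simp only [Multiset.count_replicate]
    rw [Finset.sum_ite_eq']
    split_ifs with h
    · rfl
    · have : f.maxGenEigenspace z = ⊥ := by simpa using h
      rw [this, finrank_bot]

end RootMultiset

/-! ### Counting eigenvalues by the rank of the Riesz projection -/

noncomputable section Pencil

variable {V : Type*} [NormedAddCommGroup V] [NormedSpace ℂ V]
variable {B Φ : V →L[ℂ] V} {c : ℂ} {r : ℝ}

theorem monotone_rootChain (z : ℂ) : Monotone (rootChain B Φ z) := by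
  refine monotone_nat_of_le_succ fun k => ?_
  induction k with
  | zero => exact bot_le
  | succ k ih => exact Submodule.comap_mono (Submodule.map_mono ih)

theorem mem_iSup_rootChain {z : ℂ} {x : V} :
    x ∈ ⨆ k, rootChain B Φ z k ↔ ∃ k, x ∈ rootChain B Φ z k :=
  Submodule.mem_iSup_of_directed _ (monotone_rootChain z).directed_le

/-- P is injective on the range of Q: if P kills v = Qy, then ‖v‖ = ‖(P - Q)v‖ ≤ ‖P - Q‖‖v‖, so v =
0. -/
theorem finrank_range_of_norm_sub_lt_one {P Q : V →L[ℂ] V} (hQ : Q * Q = Q)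
    (h : ‖P - Q‖ < 1) [FiniteDimensional ℂ (LinearMap.range (P : V →ₗ[ℂ] V))] :
    FiniteDimensional ℂ (LinearMap.range (Q : V →ₗ[ℂ] V)) ∧
      Module.finrank ℂ (LinearMap.range (Q : V →ₗ[ℂ] V)) ≤
        Module.finrank ℂ (LinearMap.range (P : V →ₗ[ℂ] V)) := by
  set g : LinearMap.range (Q : V →ₗ[ℂ] V) →ₗ[ℂ] LinearMap.range (P : V →ₗ[ℂ] V) :=
    (P : V →ₗ[ℂ] V).rangeRestrict ∘ₗ Submodule.subtype _ with hg
  have hinj : Function.Injective g := by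
    rw [← LinearMap.ker_eq_bot, eq_bot_iff]
    rintro ⟨x, y, rfl⟩ hx
    have h1 : P (Q y) = 0 := congrArg Subtype.val (LinearMap.mem_ker.1 hx)
    have h2 : Q (Q y) = Q y := DFunLike.congr_fun hQ y
    have h3 : ‖Q y‖ ≤ ‖P - Q‖ * ‖Q y‖ := by
      have := (P - Q).le_opNorm (Q y)
      rwa [sub_apply, h1, h2, zero_sub, norm_neg] at this
    have h4 : ‖Q y‖ = 0 := by
      by_contra h0
      have : 0 < ‖Q y‖ := lt_of_le_of_ne (norm_nonneg _) (Ne.symm h0)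
      nlinarith
    rw [Submodule.mem_bot]
    exact Subtype.ext (norm_eq_zero.1 h4)
  exact ⟨Module.Finite.of_injective g hinj, LinearMap.finrank_le_finrank_of_injective hinj⟩

variable [CompleteSpace V]

/-- If the circle is free of eigenvalues and the Riesz projection has finite rank, then the
eigenvalues in the disc, listed with their algebraic multiplicities, form a multiset whose
cardinality is this rank. -/
theorem exists_multiset_rootChain (hr : 0 < r) (hB : Function.Injective B)
    (hS : ∀ z ∈ sphere c r, IsUnit (pencil B Φ z))
    [FiniteDimensional ℂ (LinearMap.range (rieszProj B Φ c r : V →ₗ[ℂ] V))] :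
    ∃ S : Multiset ℂ,
      S.card = Module.finrank ℂ (LinearMap.range (rieszProj B Φ c r : V →ₗ[ℂ] V)) ∧
      (∀ z ∈ S, z ∈ ball c r) ∧
      ∀ z ∈ ball c r, Cardinal.toENat (Module.rank ℂ (⨆ k, rootChain B Φ z k : Submodule ℂ V)) =
        S.count z := by
  set P := rieszProj B Φ c r with hPdef
  set A := rieszPart B Φ c r with hAdef
  set W := LinearMap.range (P : V →ₗ[ℂ] V) with hW
  have hPP : ∀ x ∈ W, P x = x := by
    rintro _ ⟨y, rfl⟩
    exact DFunLike.congr_fun (rieszProj_mul_self hr hS) y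
  have hAW : ∀ x ∈ W, (A : V →ₗ[ℂ] V) x ∈ W := by
    intro x hx
    refine ⟨A x, ?_⟩
    have := DFunLike.congr_fun (rieszPart_mul_rieszProj hr hS) x
    change A (P x) = P (A x) at this
    change P (A x) = A x
    rw [← this, hPP x hx]
  have hpencil : ∀ x ∈ W, ∀ z, pencil B Φ z x = B (z • x - A x) := by
    intro x hx z
    have := DFunLike.congr_fun (pencil_mul_rieszProj hr hS z) x
    change pencil B Φ z (P x) = B (z • P x - A x) at this
    rwa [hPP x hx] at this
  -- On W the relation J(z)x = B(zx - Ax) and the injectivity of B make f act as L, so its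
  -- generalized eigenspaces are the root spaces intersected with W.
  set f : Module.End ℂ W := (A : V →ₗ[ℂ] V).restrict hAW with hf
  have hchain : ∀ (z : ℂ) (k : ℕ) (x : W), ((f - z • 1) ^ k) x = 0 ↔
      (x : V) ∈ rootChain B Φ z k := by
    intro z k
    induction k with
    | zero =>
      intro x
      simp [rootChain]
    | succ k ih =>
      intro x
      have e : (((f - z • 1) x : W) : V) = A x - z • (x : V) := rfl
      rw [pow_succ, Module.End.mul_apply, ih, mem_rootChain_succ, e, hpencil x x.2]
      constructor
      · intro h
        exact ⟨_, neg_mem h, by rw [neg_sub]⟩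
      · rintro ⟨y, hy, hBy⟩
        rw [← neg_sub, ← hB hBy]
        exact neg_mem hy
  have hmem : ∀ (z : ℂ), f.maxGenEigenspace z =
      (⨆ k, rootChain B Φ z k : Submodule ℂ V).comap W.subtype := by
    intro z
    ext x
    rw [Module.End.mem_maxGenEigenspace, Submodule.mem_comap, mem_iSup_rootChain]
    simp only [hchain]
    rfl
  obtain ⟨S, hS1, hS2⟩ := exists_multiset_maxGenEigenspace f
  refine ⟨S, hS1, fun z hz => ?_, fun z hz => ?_⟩
  · have h1 : f.maxGenEigenspace z ≠ ⊥ := by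
      rw [← Multiset.count_pos, hS2, Nat.pos_iff_ne_zero, Ne, Submodule.finrank_eq_zero] at hz
      exact hz
    obtain ⟨x, hx, hx0⟩ := Submodule.exists_mem_ne_zero_of_ne_bot h1
    rw [hmem, Submodule.mem_comap, mem_iSup_rootChain] at hx
    obtain ⟨k, hk⟩ := hx
    have hx1 : (x : V) ≠ 0 := by simpa using hx0
    -- An eigenvalue of f cannot lie on the circle, where the pencil is injective, nor outside it,
    -- where P kills root vectors although it fixes W.
    by_contra hzb
    by_cases hzs : z ∈ sphere c r
    · have hu : Function.Injective (pencil B Φ z) := by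
        intro u v huv
        have h := Ring.inverse_mul_cancel _ (hS z hzs)
        have h2 : ∀ y, Ring.inverse (pencil B Φ z) (pencil B Φ z y) = y := fun y =>
          DFunLike.congr_fun h y
        rw [← h2 u, ← h2 v, huv]
      rw [rootChain_eq_bot hu k] at hk
      exact hx1 (by simpa using hk)
    · have hzc : z ∉ closedBall c r := by
        rw [← ball_union_sphere]
        exact fun h => h.elim hzb hzs
      have h2 := rieszProj_rootChain_of_notMem hr hS hzc hk
      rw [← hPdef] at h2
      have h3 := hPP x x.2
      exact hx1 (by rw [← h3]; exact h2)
  · have hle : (⨆ k, rootChain B Φ z k : Submodule ℂ V) ≤ W := by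
      intro x hx
      rw [mem_iSup_rootChain] at hx
      obtain ⟨k, hk⟩ := hx
      exact ⟨x, rieszProj_rootChain_of_mem_ball hr hS hz hk⟩
    rw [hS2, hmem, ← (Submodule.comapSubtypeEquivOfLe hle).rank_eq, ← Module.finrank_eq_rank,
      map_natCast]

/-- The integrand is jointly continuous in t and the angle, since inversion is continuous at units.
-/
theorem continuous_rieszProj_homotopy
    (hS : ∀ t : Icc (0 : ℝ) 1, ∀ z ∈ sphere c |r|, IsUnit (pencil B ((t : ℂ) • Φ) z)) :
    Continuous fun t : Icc (0 : ℝ) 1 => rieszProj B ((t : ℂ) • Φ) c r := by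
  unfold rieszProj circleIntegral
  simp only [deriv_circleMap]
  suffices key : Continuous (Function.uncurry fun (t : Icc (0 : ℝ) 1) (θ : ℝ) =>
      (circleMap 0 r θ * I) • pencilResolvent B ((t : ℂ) • Φ) (circleMap c r θ)) by
    exact (intervalIntegral.continuous_parametric_intervalIntegral_of_continuous' (μ := volume)
      key 0 (2 * Real.pi)).const_smul (2 * Real.pi * I : ℂ)⁻¹
  refine Continuous.smul (f := fun x : Icc (0 : ℝ) 1 × ℝ => circleMap 0 r x.2 * I)
    (g := fun x : Icc (0 : ℝ) 1 × ℝ => pencilResolvent B ((x.1 : ℂ) • Φ) (circleMap c r x.2))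
    (((continuous_circleMap 0 r).comp continuous_snd).mul continuous_const) ?_
  unfold pencilResolvent
  refine Continuous.mul ?_ continuous_const
  rw [continuous_iff_continuousAt]
  rintro ⟨t, θ⟩
  have hu := hS t (circleMap c r θ) (circleMap_mem_sphere' c r θ)
  have hc : Continuous fun x : Icc (0 : ℝ) 1 × ℝ =>
      pencil B ((x.1 : ℂ) • Φ) (circleMap c r x.2) := by
    have h1 : Continuous fun x : Icc (0 : ℝ) 1 × ℝ => circleMap c r x.2 :=
      (continuous_circleMap c r).comp continuous_snd
    have h2 : Continuous fun x : Icc (0 : ℝ) 1 × ℝ => ((x.1 : ℝ) : ℂ) :=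
      Complex.continuous_ofReal.comp (continuous_subtype_val.comp continuous_fst)
    unfold pencil
    exact (continuous_const.add ((h1.sub continuous_const).smul continuous_const)).sub
      (continuous_const.mul (h2.smul continuous_const))
  have h3 : ContinuousAt Ring.inverse (pencil B ((t : ℂ) • Φ) (circleMap c r θ)) := by
    have := NormedRing.inverse_continuousAt hu.unit
    rwa [IsUnit.unit_spec] at this
  exact ContinuousAt.comp (f := fun x : Icc (0 : ℝ) 1 × ℝ =>
      pencil B ((x.1 : ℂ) • Φ) (circleMap c r x.2)) (x := (t, θ)) h3 hc.continuousAt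

/-- The rank of the Riesz projection does not change along a homotopy without eigenvalues on the
circle. -/
theorem finrank_range_rieszProj_homotopy (hr : 0 < r)
    (hS : ∀ t ∈ Icc (0 : ℝ) 1, ∀ z ∈ sphere c r, IsUnit (pencil B ((t : ℂ) • Φ) z))
    (h0 : FiniteDimensional ℂ (LinearMap.range (rieszProj B 0 c r : V →ₗ[ℂ] V))) :
    FiniteDimensional ℂ (LinearMap.range (rieszProj B Φ c r : V →ₗ[ℂ] V)) ∧
      Module.finrank ℂ (LinearMap.range (rieszProj B Φ c r : V →ₗ[ℂ] V)) =
        Module.finrank ℂ (LinearMap.range (rieszProj B 0 c r : V →ₗ[ℂ] V)) := by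
  have hS' : ∀ t : Icc (0 : ℝ) 1, ∀ z ∈ sphere c |r|, IsUnit (pencil B ((t : ℂ) • Φ) z) :=
    fun t z hz => hS t t.2 z (by rwa [abs_of_pos hr] at hz)
  have hcont := continuous_rieszProj_homotopy hS'
  set N := Module.finrank ℂ (LinearMap.range (rieszProj B 0 c r : V →ₗ[ℂ] V)) with hN
  -- Finite dimension belongs to the locally constant property: `finrank` alone would be 0 on an
  -- infinite-dimensional range.
  let Q : (V →L[ℂ] V) → Prop := fun P =>
    FiniteDimensional ℂ (LinearMap.range (P : V →ₗ[ℂ] V)) ∧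
      Module.finrank ℂ (LinearMap.range (P : V →ₗ[ℂ] V)) = N
  let g : Icc (0 : ℝ) 1 → Prop := fun t => Q (rieszProj B ((t : ℂ) • Φ) c r)
  have key : ∀ s t : Icc (0 : ℝ) 1,
      ‖rieszProj B ((s : ℂ) • Φ) c r - rieszProj B ((t : ℂ) • Φ) c r‖ < 1 → g s → g t := by
    rintro s t hst ⟨h1, h2⟩
    have h3 := rieszProj_mul_self hr (hS t t.2)
    have h4 := rieszProj_mul_self hr (hS s s.2)
    obtain ⟨h5, h6⟩ := finrank_range_of_norm_sub_lt_one h3 hst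
    rw [norm_sub_rev] at hst
    obtain ⟨-, h7⟩ := finrank_range_of_norm_sub_lt_one h4 hst
    exact ⟨h5, (h6.antisymm h7).trans h2⟩
  have hloc : IsLocallyConstant g := by
    rw [IsLocallyConstant.iff_eventually_eq]
    intro t
    have h1 := (Metric.continuous_iff'.1 hcont) t 1 one_pos
    filter_upwards [h1] with s hs
    rw [dist_eq_norm] at hs
    exact propext ⟨key s t hs, key t s (by rwa [norm_sub_rev])⟩
  have h2 := hloc.apply_eq_of_preconnectedSpace ⟨0, by simp⟩ ⟨1, by simp⟩
  have h3 : Q (rieszProj B (((0 : ℝ) : ℂ) • Φ) c r) := by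
    rw [Complex.ofReal_zero, zero_smul]
    exact ⟨h0, rfl⟩
  have h4 : Q (rieszProj B (((1 : ℝ) : ℂ) • Φ) c r) := by
    change g ⟨1, by simp⟩
    rw [← h2]
    exact h3
  rw [Complex.ofReal_one, one_smul] at h4
  exact h4

/-- The Fredholm alternative: J(z) = 1 - K with K = BΦ - (z - i)B compact, so either 1 is an
eigenvalue of K, against injectivity, or 1 - K is invertible. -/
theorem isUnit_pencil_of_injective (hB : IsCompactOperator B) {z : ℂ}
    (h : Function.Injective (pencil B Φ z)) : IsUnit (pencil B Φ z) := by
  have hK : IsCompactOperator (B * Φ - (z - I) • B : V →L[ℂ] V) :=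
    (hB.comp_clm Φ).sub (hB.smul (z - I))
  have e : pencil B Φ z = 1 - (B * Φ - (z - I) • B) := by
    unfold pencil
    abel
  rcases hK.hasEigenvalue_or_mem_resolventSet one_ne_zero with h1 | h1
  · obtain ⟨x, hx⟩ := h1.exists_hasEigenvector
    refine absurd (h (a₁ := x) (a₂ := 0) ?_) hx.2
    have h2 : (B * Φ - (z - I) • B : V →L[ℂ] V) x = x := by
      simpa using hx.apply_eq_smul
    rw [e, sub_apply, h2, map_zero]
    exact sub_self x
  · rw [spectrum.mem_resolventSet_iff, map_one, ← e] at h1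
    exact h1

end Pencil

/-! ### The operator in Fourier coordinates on ℓ²(ℤ) -/

noncomputable section Sequences

/-- The sequence space `ℓ²(ℤ, ℂ)`. -/
abbrev SeqSpace : Type := lp (fun _ : ℤ => ℂ) 2

/-- The diagonal operator with bounded entries. -/
def diagOp (d : ℤ → ℂ) {K : ℝ} (hK : 0 ≤ K) (hd : ∀ m, ‖d m‖ ≤ K) : SeqSpace →L[ℂ] SeqSpace :=
  lp.mapCLM 2 (fun m => d m • ContinuousLinearMap.id ℂ ℂ) hK (fun m => by
    rw [norm_smul]
    refine (mul_le_mul_of_nonneg_left ContinuousLinearMap.norm_id_le (norm_nonneg _)).trans ?_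
    rw [mul_one]
    exact hd m)

theorem diagOp_apply (d : ℤ → ℂ) {K : ℝ} (hK : 0 ≤ K) (hd : ∀ m, ‖d m‖ ≤ K) (x : SeqSpace)
    (m : ℤ) : diagOp d hK hd x m = d m * x m := by
  simp [diagOp]

theorem hasSum_norm_sq (x : SeqSpace) : HasSum (fun m => ‖x m‖ ^ 2) (‖x‖ ^ 2) := by
  have h := lp.hasSum_norm (p := 2) (by norm_num) x
  simpa using h

theorem summable_norm_sq (x : SeqSpace) : Summable fun m => ‖x m‖ ^ 2 := (hasSum_norm_sq x).summable

theorem memℓp_two_iff {f : ℤ → ℂ} : Memℓp f 2 ↔ Summable fun m => ‖f m‖ ^ 2 := by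
  rw [memℓp_gen_iff (by norm_num)]
  simp

theorem norm_le_of_forall_sum_sq_le {x : SeqSpace} {C : ℝ} (hC : 0 ≤ C)
    (h : ∀ s : Finset ℤ, ∑ m ∈ s, ‖x m‖ ^ 2 ≤ C ^ 2) : ‖x‖ ≤ C := by
  refine lp.norm_le_of_forall_sum_le (by norm_num) hC fun s => ?_
  simpa using h s

/-- The reflection `x ↦ (x_{j-m})_m`. -/
def reflectOp (j : ℤ) : SeqSpace →L[ℂ] SeqSpace :=
  LinearMap.mkContinuous
    { toFun := fun x => ⟨fun m => x (j - m), memℓp_two_iff.2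
        ((summable_norm_sq x).comp_injective (sub_right_injective (b := j)))⟩
      map_add' := fun x y => by ext m; rfl
      map_smul' := fun c x => by ext m; rfl } 1 fun x => by
    rw [one_mul]
    refine norm_le_of_forall_sum_sq_le (norm_nonneg _) fun s => ?_
    have h := sum_le_hasSum (s.map (Equiv.subLeft j).toEmbedding) (fun i _ => sq_nonneg _)
      (hasSum_norm_sq x)
    rw [Finset.sum_map] at h
    exact h

theorem norm_reflectOp_le (j : ℤ) : ‖reflectOp j‖ ≤ 1 :=
  LinearMap.mkContinuous_norm_le _ zero_le_one _

/-- The Hankel operator `(x_m) ↦ (∑ₖ p_{m+k} x_k)`. -/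
def hankelOp (p : ℤ → ℂ) : SeqSpace →L[ℂ] SeqSpace := ∑' j, p j • reflectOp j

variable {p q : ℤ → ℂ}

theorem norm_smul_reflectOp_le (j : ℤ) : ‖p j • reflectOp j‖ ≤ ‖p j‖ := by
  rw [norm_smul]
  exact mul_le_of_le_one_right (norm_nonneg _) (norm_reflectOp_le j)

theorem summable_smul_reflectOp (hp : Summable fun j => ‖p j‖) :
    Summable fun j => p j • reflectOp j :=
  Summable.of_norm_bounded hp norm_smul_reflectOp_le

theorem norm_hankelOp_le (hp : Summable fun j => ‖p j‖) : ‖hankelOp p‖ ≤ ∑' j, ‖p j‖ :=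
  tsum_of_norm_bounded hp.hasSum norm_smul_reflectOp_le

/-- The norm-convergent series of reflections is evaluated at coordinate m, and the substitution j =
m + k gives the matrix form. -/
theorem hasSum_hankelOp (hp : Summable fun j => ‖p j‖) (x : SeqSpace) (m : ℤ) :
    HasSum (fun k => p (m + k) * x k) (hankelOp p x m) := by
  have h := ((summable_smul_reflectOp hp).hasSum.mapL (ContinuousLinearMap.apply ℂ SeqSpace x)).mapL
    (lp.evalCLM ℂ (fun _ : ℤ => ℂ) 2 m)
  have e : ∀ j : ℤ, (lp.evalCLM ℂ (fun _ : ℤ => ℂ) 2 m)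
      ((ContinuousLinearMap.apply ℂ SeqSpace x) (p j • reflectOp j)) = p j * x (j - m) :=
    fun j => rfl
  simp only [e] at h
  rw [← (Equiv.subRight m).hasSum_iff]
  refine h.congr_fun fun j => ?_
  change p (m + (j - m)) * x (j - m) = _
  rw [add_sub_cancel]

theorem hankelOp_smul (t : ℂ) : hankelOp (t • p) = t • hankelOp p := by
  unfold hankelOp
  rw [← tsum_const_smul'']
  congr 1
  ext1 j
  rw [smul_smul]
  rfl

/-- The potential part of the Zakharov–Shabat operator in Fourier coordinates. -/
def potentialOp (p q : ℤ → ℂ) : SeqSpace × SeqSpace →L[ℂ] SeqSpace × SeqSpace :=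
  ((hankelOp p).comp (ContinuousLinearMap.snd ℂ SeqSpace SeqSpace)).prod
    ((hankelOp q).comp (ContinuousLinearMap.fst ℂ SeqSpace SeqSpace))

theorem potentialOp_smul (t : ℂ) : potentialOp (t • p) (t • q) = t • potentialOp p q := by
  unfold potentialOp
  rw [hankelOp_smul, hankelOp_smul]
  rfl

theorem I_sub_ne_zero (m : ℤ) : I - (m : ℂ) * Real.pi ≠ 0 := by
  intro h
  have := congrArg Complex.im h
  simp at this

theorem norm_I_sub_inv_le_one (m : ℤ) : ‖(I - (m : ℂ) * Real.pi)⁻¹‖ ≤ 1 := by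
  rw [norm_inv]
  refine inv_le_one_of_one_le₀ ?_
  have := Complex.abs_im_le_norm (I - (m : ℂ) * Real.pi)
  simpa using this

theorem norm_I_sub_inv_le (m : ℤ) {N : ℕ} (hN : 1 ≤ N) (hm : (N : ℤ) ≤ |m|) :
    ‖(I - (m : ℂ) * Real.pi)⁻¹‖ ≤ (N : ℝ)⁻¹ := by
  rw [norm_inv]
  have h1 := Complex.abs_re_le_norm (I - (m : ℂ) * Real.pi)
  have h2 : |(I - (m : ℂ) * Real.pi).re| = |(m : ℝ)| * Real.pi := by
    simp [abs_mul, abs_of_pos Real.pi_pos]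
  rw [h2] at h1
  have h3 : (N : ℝ) ≤ |(m : ℝ)| := by exact_mod_cast hm
  have h4 := Real.pi_gt_three
  have h5 : (0 : ℝ) < N := by exact_mod_cast hN
  refine inv_anti₀ h5 ?_
  nlinarith

/-- `(i - D)⁻¹` on one component. -/
def baseDiag : SeqSpace →L[ℂ] SeqSpace :=
  diagOp (fun m => (I - (m : ℂ) * Real.pi)⁻¹) zero_le_one norm_I_sub_inv_le_one

theorem baseDiag_apply (x : SeqSpace) (m : ℤ) :
    baseDiag x m = (I - (m : ℂ) * Real.pi)⁻¹ * x m := diagOp_apply _ _ _ _ _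

theorem baseDiag_injective : Function.Injective baseDiag := by
  intro x y h
  ext m
  have := congrArg (fun z : SeqSpace => z m) h
  simp only [baseDiag_apply] at this
  exact mul_left_cancel₀ (inv_ne_zero (I_sub_ne_zero m)) this

/-- The finite-rank truncations to |m| < N converge in norm, the discarded entries being at most
1/N. -/
theorem isCompactOperator_baseDiag : IsCompactOperator baseDiag := by
  let T : ℕ → SeqSpace →L[ℂ] SeqSpace := fun N => ∑ m ∈ Finset.Ioo (-(N : ℤ)) N,
    (I - (m : ℂ) * Real.pi)⁻¹ • (lp.singleContinuousLinearMap ℂ (fun _ : ℤ => ℂ) 2 m).comp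
      (lp.evalCLM ℂ (fun _ : ℤ => ℂ) 2 m)
  have hT : ∀ N (x : SeqSpace) (k : ℤ), T N x k = if k ∈ Finset.Ioo (-(N : ℤ)) N then
      (I - (k : ℂ) * Real.pi)⁻¹ * x k else 0 := by
    intro N x k
    have h : T N x k = ∑ m ∈ Finset.Ioo (-(N : ℤ)) N, (I - (m : ℂ) * Real.pi)⁻¹ *
        (lp.single 2 m (x m) : SeqSpace) k := by
      simp only [T, sum_apply, lp.coeFn_sum, Finset.sum_apply]
      rfl
    rw [h]
    split_ifs with hk
    · rw [Finset.sum_eq_single_of_mem k hk, lp.single_apply_self]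
      intro b _ hb
      rw [lp.single_apply_ne 2 b _ (Ne.symm hb), mul_zero]
    · refine Finset.sum_eq_zero fun m hm => ?_
      rw [lp.single_apply_ne 2 m _, mul_zero]
      rintro rfl
      exact hk hm
  have hcomp : ∀ N, IsCompactOperator (T N) := by
    intro N
    have : T N ∈ compactOperator (RingHom.id ℂ) SeqSpace SeqSpace := by
      refine Submodule.sum_mem _ fun m _ => Submodule.smul_mem _ _ ?_
      change IsCompactOperator _
      have h1 : IsCompactOperator (lp.singleContinuousLinearMap ℂ (fun _ : ℤ => ℂ) 2 m) :=
        isCompactOperator_of_locallyCompactSpace_rng _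
      exact h1.comp_clm (lp.evalCLM ℂ (fun _ : ℤ => ℂ) 2 m)
    exact this
  have hlim : Filter.Tendsto T Filter.atTop (nhds baseDiag) := by
    rw [tendsto_iff_norm_sub_tendsto_zero]
    refine squeeze_zero' (Filter.Eventually.of_forall fun _ => norm_nonneg _)
      (Filter.eventually_atTop.2 ⟨1, fun N hN => ?_⟩)
      (tendsto_inv_atTop_nhds_zero_nat (𝕜 := ℝ))
    refine ContinuousLinearMap.opNorm_le_bound _ (by positivity) fun x => ?_
    have e : ‖((N : ℂ)⁻¹) • x‖ = (N : ℝ)⁻¹ * ‖x‖ := by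
      rw [norm_smul, norm_inv, Complex.norm_natCast]
    rw [← e]
    refine lp.norm_mono (by norm_num) fun k => ?_
    have e1 : ((T N - baseDiag) x) k = T N x k - baseDiag x k := by
      rw [sub_apply]
      rfl
    have e2 : ((N : ℂ)⁻¹ • x) k = (N : ℂ)⁻¹ * x k := rfl
    rw [e2, norm_mul, norm_inv, Complex.norm_natCast, e1, baseDiag_apply, hT]
    split_ifs with hk
    · rw [sub_self, norm_zero]
      positivity
    · rw [zero_sub, norm_neg, norm_mul]
      refine mul_le_mul_of_nonneg_right (norm_I_sub_inv_le k hN ?_) (norm_nonneg _)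
      rw [Finset.mem_Ioo, ← abs_lt, not_lt] at hk
      exact hk
  exact isCompactOperator_of_tendsto hlim (Filter.Eventually.of_forall hcomp)

/-- `(i - D)⁻¹`. -/
def baseOp : SeqSpace × SeqSpace →L[ℂ] SeqSpace × SeqSpace := baseDiag.prodMap baseDiag

theorem baseOp_injective : Function.Injective baseOp := by
  rintro ⟨x, y⟩ ⟨x', y'⟩ h
  exact Prod.ext (baseDiag_injective (congrArg Prod.fst h))
    (baseDiag_injective (congrArg Prod.snd h))

theorem isCompactOperator_baseOp : IsCompactOperator baseOp := by
  have h1 := (isCompactOperator_baseDiag.comp_clm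
    (ContinuousLinearMap.fst ℂ SeqSpace SeqSpace)).clm_comp
    (ContinuousLinearMap.inl ℂ SeqSpace SeqSpace)
  have h2 := (isCompactOperator_baseDiag.comp_clm
    (ContinuousLinearMap.snd ℂ SeqSpace SeqSpace)).clm_comp
    (ContinuousLinearMap.inr ℂ SeqSpace SeqSpace)
  have e : (baseOp : SeqSpace × SeqSpace → SeqSpace × SeqSpace) = fun x =>
      (baseDiag x.1, (0 : SeqSpace)) + ((0 : SeqSpace), baseDiag x.2) := by
    ext1 x
    rw [Prod.mk_add_mk, add_zero, zero_add]
    rfl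
  rw [e]
  exact h1.add h2

/-- The coordinates of `J(z) x = B y`. -/
theorem pencil_apply_eq_iff {z : ℂ} {x y : SeqSpace × SeqSpace} :
    pencil baseOp (potentialOp p q) z x = baseOp y ↔
      (∀ m : ℤ, (z - m * Real.pi) * x.1 m = hankelOp p x.2 m + y.1 m) ∧
      ∀ m : ℤ, (z - m * Real.pi) * x.2 m = hankelOp q x.1 m + y.2 m := by
  have e : pencil baseOp (potentialOp p q) z x =
      x + (z - I) • baseOp x - baseOp (potentialOp p q x) := rfl
  rw [e, Prod.ext_iff]
  have key : ∀ (u v w y : SeqSpace), u + (z - I) • baseDiag v - baseDiag w = baseDiag y ↔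
      ∀ m : ℤ, (I - m * Real.pi) * u m + (z - I) * v m = w m + y m := by
    intro u v w y
    rw [← sub_eq_zero (b := baseDiag y)]
    have e1 : ∀ m : ℤ, (u + (z - I) • baseDiag v - baseDiag w - baseDiag y) m =
        (I - m * Real.pi)⁻¹ * ((I - m * Real.pi) * u m + (z - I) * v m - (w m + y m)) := by
      intro m
      have e2 : (u + (z - I) • baseDiag v - baseDiag w - baseDiag y) m =
        u m + (z - I) * baseDiag v m - baseDiag w m - baseDiag y m := rfl
      rw [e2, baseDiag_apply, baseDiag_apply, baseDiag_apply]
      have := I_sub_ne_zero m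
      field_simp
      ring
    constructor
    · intro h m
      have h1 := e1 m
      rw [h, lp.coeFn_zero, Pi.zero_apply, eq_comm, mul_eq_zero] at h1
      rcases h1 with h1 | h1
      · exact absurd h1 (inv_ne_zero (I_sub_ne_zero m))
      · exact sub_eq_zero.1 h1
    · intro h
      ext m
      rw [e1, h, sub_self, mul_zero]
      rfl
  refine and_congr ((key x.1 x.1 (hankelOp p x.2) y.1).trans (forall_congr' fun m => ?_))
    ((key x.2 x.2 (hankelOp q x.1) y.2).trans (forall_congr' fun m => ?_))
  · rw [← add_mul]
    ring_nf
  · rw [← add_mul]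
    ring_nf

theorem hankelOp_zero : hankelOp 0 = 0 := by simp [hankelOp]

theorem potentialOp_zero : potentialOp 0 0 = 0 := by
  have := potentialOp_smul (p := 0) (q := 0) 0
  rwa [smul_zero, zero_smul] at this

/-- The Riesz projection of the free operator. -/
theorem rieszProj_zero_apply {c : ℂ} {r : ℝ} (hr : 0 < r)
    (hS : ∀ z ∈ sphere c r, IsUnit (pencil baseOp 0 z)) (x : SeqSpace × SeqSpace)
    {s : Finset ℤ} (hs : ∀ m : ℤ, m ∈ s ↔ (m * Real.pi : ℂ) ∈ ball c r) (m : ℤ) :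
    (rieszProj baseOp 0 c r x).1 m = (if m ∈ s then x.1 m else 0) ∧
      (rieszProj baseOp 0 c r x).2 m = if m ∈ s then x.2 m else 0 := by
  have hcoord : ∀ z ∈ sphere c r, ∀ m : ℤ,
      (z - m * Real.pi) * (pencilResolvent baseOp 0 z x).1 m = x.1 m ∧
      (z - m * Real.pi) * (pencilResolvent baseOp 0 z x).2 m = x.2 m := by
    intro z hz m
    have h : pencil baseOp 0 z (pencilResolvent baseOp 0 z x) = baseOp x :=
      DFunLike.congr_fun (pencil_mul_pencilResolvent (hS z hz)) x
    rw [← potentialOp_zero, pencil_apply_eq_iff, potentialOp_zero, hankelOp_zero] at h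
    refine ⟨(h.1 m).trans ?_, (h.2 m).trans ?_⟩ <;>
    · change 0 + _ = _
      rw [zero_add]
  -- If mπ were on the circle, the unit vector at m would lie in the kernel of the free pencil
  -- there.
  have hne : ∀ z ∈ sphere c r, z - m * Real.pi ≠ 0 := by
    intro z hz h0
    let e : SeqSpace := lp.single 2 m (1 : ℂ)
    have h : pencil baseOp (potentialOp 0 0) z (e, 0) = baseOp 0 := by
      rw [pencil_apply_eq_iff, hankelOp_zero]
      refine ⟨fun k => ?_, fun k => ?_⟩
      · change _ = (0 : ℂ) + 0
        rw [add_zero]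
        rcases eq_or_ne k m with rfl | hk
        · rw [h0, zero_mul]
        · change _ * (lp.single 2 m (1 : ℂ) : SeqSpace) k = 0
          rw [lp.single_apply_ne 2 m _ hk, mul_zero]
      · change _ * (0 : ℂ) = (0 : ℂ) + 0
        ring
    rw [map_zero, potentialOp_zero] at h
    have h2 : Ring.inverse (pencil baseOp 0 z) (pencil baseOp 0 z (e, 0)) = (e, 0) :=
      DFunLike.congr_fun (Ring.inverse_mul_cancel _ (hS z hz)) (e, 0)
    rw [h, map_zero] at h2
    have h3 : (lp.single 2 m (1 : ℂ) : SeqSpace) m = 0 := by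
      change e m = 0
      have : (0 : SeqSpace) = e := congrArg Prod.fst h2
      rw [← this]
      rfl
    rw [lp.single_apply_self] at h3
    exact one_ne_zero h3
  have hint : (∮ z in C(c, r), (z - m * Real.pi)⁻¹) = if m ∈ s then 2 * Real.pi * I else 0 := by
    split_ifs with h
    · exact circleIntegral.integral_sub_inv_of_mem_ball ((hs m).1 h)
    · refine circleIntegral_sub_inv_eq_zero hr.le fun h1 => ?_
      rw [← ball_union_sphere] at h1
      rcases h1 with h1 | h1
      · exact h ((hs m).2 h1)
      · exact hne _ h1 (sub_self _)
  have hR := (continuousOn_pencilResolvent_apply hS x).circleIntegrable hr.le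
  have key : ∀ (L : SeqSpace × SeqSpace →L[ℂ] ℂ),
      (∀ z ∈ sphere c r, (z - m * Real.pi) * L (pencilResolvent baseOp 0 z x) = L x) →
      L (rieszProj baseOp 0 c r x) = if m ∈ s then L x else 0 := by
    intro L hL
    rw [rieszProj_apply hr hS, map_smul, clm_circleIntegral L hR]
    have h1 : ∀ z ∈ sphere c r, L (pencilResolvent baseOp 0 z x) =
        (z - m * Real.pi)⁻¹ • L x := by
      intro z hz
      rw [← hL z hz, smul_eq_mul, inv_mul_cancel_left₀ (hne z hz)]
    rw [circleIntegral.integral_congr hr.le h1, circleIntegral.integral_smul_const, hint]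
    split_ifs
    · rw [smul_smul, inv_mul_cancel₀ Complex.two_pi_I_ne_zero, one_smul]
    · rw [zero_smul, smul_zero]
  exact ⟨key ((lp.evalCLM ℂ (fun _ : ℤ => ℂ) 2 m).comp (ContinuousLinearMap.fst ℂ _ _))
      fun z hz => (hcoord z hz m).1,
    key ((lp.evalCLM ℂ (fun _ : ℤ => ℂ) 2 m).comp (ContinuousLinearMap.snd ℂ _ _))
      fun z hz => (hcoord z hz m).2⟩

/-- The free projection restricts both components to the coordinates in s; the factor 2 counts the
components. -/
theorem finrank_range_rieszProj_zero {c : ℂ} {r : ℝ} (hr : 0 < r)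
    (hS : ∀ z ∈ sphere c r, IsUnit (pencil baseOp 0 z))
    {s : Finset ℤ} (hs : ∀ m : ℤ, m ∈ s ↔ (m * Real.pi : ℂ) ∈ ball c r) :
    FiniteDimensional ℂ (LinearMap.range
      (rieszProj baseOp 0 c r : SeqSpace × SeqSpace →ₗ[ℂ] SeqSpace × SeqSpace)) ∧
    Module.finrank ℂ (LinearMap.range
      (rieszProj baseOp 0 c r : SeqSpace × SeqSpace →ₗ[ℂ] SeqSpace × SeqSpace)) = 2 * s.card := by
  set P := rieszProj baseOp 0 c r with hP
  have hc := fun x => rieszProj_zero_apply hr hS x hs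
  -- coordinates on the range
  let g : LinearMap.range (P : SeqSpace × SeqSpace →ₗ[ℂ] SeqSpace × SeqSpace) →ₗ[ℂ]
      (s → ℂ) × (s → ℂ) :=
    { toFun := fun x => (fun m => x.1.1 m, fun m => x.1.2 m)
      map_add' := fun x y => rfl
      map_smul' := fun a x => rfl }
  have hinj : Function.Injective g := by
    rw [← LinearMap.ker_eq_bot, eq_bot_iff]
    rintro ⟨_, x, rfl⟩ hx
    rw [LinearMap.mem_ker] at hx
    rw [Submodule.mem_bot]
    refine Subtype.ext (Prod.ext ?_ ?_)
    · ext m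
      change (P x).1 m = 0
      by_cases hm : m ∈ s
      · exact congrFun (congrArg Prod.fst hx) ⟨m, hm⟩
      · rw [(hc x m).1, if_neg hm]
    · ext m
      change (P x).2 m = 0
      by_cases hm : m ∈ s
      · exact congrFun (congrArg Prod.snd hx) ⟨m, hm⟩
      · rw [(hc x m).2, if_neg hm]
  have hsurj : Function.Surjective g := by
    rintro ⟨u, v⟩
    have hmem : ∀ u : s → ℂ, Memℓp (fun m : ℤ => if h : m ∈ s then u ⟨m, h⟩ else 0) 2 := by
      intro u
      rw [memℓp_two_iff]
      refine summable_of_ne_finset_zero (s := s) fun m hm => ?_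
      rw [dif_neg hm]
      simp
    let x : SeqSpace × SeqSpace := (⟨_, hmem u⟩, ⟨_, hmem v⟩)
    refine ⟨⟨P x, x, rfl⟩, Prod.ext (funext fun m => ?_) (funext fun m => ?_)⟩
    · change (P x).1 m = u m
      rw [(hc x m).1, if_pos m.2]
      exact dif_pos m.2
    · change (P x).2 m = v m
      rw [(hc x m).2, if_pos m.2]
      exact dif_pos m.2
  let e := LinearEquiv.ofBijective g ⟨hinj, hsurj⟩
  refine ⟨Module.Finite.of_injective g hinj, ?_⟩
  rw [e.finrank_eq, Module.finrank_prod, Module.finrank_fintype_fun_eq_card, Fintype.card_coe]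
  ring

end Sequences

/-! ### Weighted estimates and localization of eigenvalues -/

noncomputable section Estimates

theorem sum_one_div_int_sq_le (s : Finset ℤ) : ∑ j ∈ s, 1 / (j : ℝ) ^ 2 ≤ Real.pi ^ 2 / 3 := by
  have h1 : HasSum (fun n : ℕ => 1 / (((n : ℤ) : ℝ)) ^ 2) (Real.pi ^ 2 / 6) := by
    simpa using hasSum_zeta_two
  have h2 : HasSum (fun n : ℕ => 1 / (((-(n : ℤ) : ℤ) : ℝ)) ^ 2) (Real.pi ^ 2 / 6) := by
    simpa using hasSum_zeta_two
  have h3 := HasSum.of_nat_of_neg (f := fun j : ℤ => 1 / (j : ℝ) ^ 2) h1 h2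
  refine (sum_le_hasSum s (fun j _ => by positivity) h3).trans (le_of_eq ?_)
  simp
  ring

theorem sum_one_div_int_sub_sq_le (s : Finset ℤ) (n : ℤ) :
    ∑ j ∈ s, 1 / ((j : ℝ) - n) ^ 2 ≤ Real.pi ^ 2 / 3 := by
  have h := sum_one_div_int_sq_le (s.map (Equiv.subRight n).toEmbedding)
  rw [Finset.sum_map] at h
  simpa using h

/-- The weight `⟨jπ⟩` of the `H¹` norm. -/
def weight (j : ℤ) : ℝ := 1 + Real.pi * |(j : ℝ)|

theorem one_le_weight (j : ℤ) : 1 ≤ weight j := by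
  have := mul_nonneg Real.pi_pos.le (abs_nonneg (j : ℝ))
  unfold weight
  linarith

theorem weight_pos (j : ℤ) : 0 < weight j := one_pos.trans_le (one_le_weight j)

/-- The index k = -l contributes at most 1; the others contribute at most π⁻² · π²/3 = 1/3 by ζ(2).
-/
theorem sum_inv_weight_sq_le (s : Finset ℤ) (l : ℤ) :
    ∑ k ∈ s, (1 / weight (k + l)) ^ 2 ≤ 4 / 3 := by
  have h1 : ∀ k ∈ s, (1 / weight (k + l)) ^ 2 ≤
      (if k = -l then 1 else 0) + 1 / Real.pi ^ 2 * (1 / ((k : ℝ) - ((-l : ℤ) : ℝ)) ^ 2) := by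
    intro k _
    split_ifs with hk
    · subst hk
      simp [weight]
    · have h0 : (0 : ℝ) < |(k : ℝ) + l| := by
        rw [abs_pos]
        intro h
        apply hk
        have : k + l = 0 := by exact_mod_cast h
        omega
      have e : Real.pi ^ 2 * ((k : ℝ) - ((-l : ℤ) : ℝ)) ^ 2 = (Real.pi * |(k : ℝ) + l|) ^ 2 := by
        rw [mul_pow, sq_abs]
        push_cast
        ring
      have hpi := Real.pi_pos
      rw [zero_add, one_div_mul_one_div, e, div_pow, one_pow]
      refine one_div_le_one_div_of_le (by positivity) (pow_le_pow_left₀ (by positivity) ?_ 2)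
      unfold weight
      push_cast
      linarith
  refine (Finset.sum_le_sum h1).trans ?_
  rw [Finset.sum_add_distrib, ← Finset.mul_sum, Finset.sum_ite_eq']
  have h2 := sum_one_div_int_sub_sq_le s (-l)
  have h3 : 1 / Real.pi ^ 2 * (Real.pi ^ 2 / 3) = 1 / 3 := by
    have := Real.pi_ne_zero
    field_simp
  have h4 := mul_le_mul_of_nonneg_left h2 (by positivity : (0 : ℝ) ≤ 1 / Real.pi ^ 2)
  rw [h3] at h4
  split_ifs <;> linarith

/-- `p` has weighted `ℓ²` norm at most `α`. -/
structure WeightedBound (p : ℤ → ℂ) (α : ℝ) : Prop where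
  nonneg : 0 ≤ α
  sum_le : ∀ s : Finset ℤ, ∑ j ∈ s, (weight j * ‖p j‖) ^ 2 ≤ α ^ 2

variable {p q : ℤ → ℂ} {α β : ℝ}

theorem WeightedBound.norm_le (h : WeightedBound p α) (j : ℤ) : weight j * ‖p j‖ ≤ α := by
  have := h.sum_le {j}
  rw [Finset.sum_singleton] at this
  exact le_of_sq_le_sq this h.nonneg

theorem WeightedBound.sum_comp_le (h : WeightedBound p α) (n : ℤ) (s : Finset ℤ) :
    ∑ k ∈ s, (weight (n + k) * ‖p (n + k)‖) ^ 2 ≤ α ^ 2 := by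
  have := h.sum_le (s.map (Equiv.addLeft n).toEmbedding)
  rw [Finset.sum_map] at this
  exact this

/-- Cauchy–Schwarz against the weight, with 4/3 ≤ (6/5)². This ℓ¹ bound also controls the Hankel
operator norm. -/
theorem WeightedBound.sum_norm_le (h : WeightedBound p α) (s : Finset ℤ) :
    ∑ j ∈ s, ‖p j‖ ≤ 6 / 5 * α := by
  have h1 := Finset.sum_mul_sq_le_sq_mul_sq s (fun j => weight j * ‖p j‖) (fun j => 1 / weight j)
  have e : ∀ j, weight j * ‖p j‖ * (1 / weight j) = ‖p j‖ := fun j => by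
    have := (weight_pos j).ne'
    field_simp
  simp only [e] at h1
  have h2 := sum_inv_weight_sq_le s 0
  simp only [add_zero] at h2
  have h3 := h.sum_le s
  have h4 := h.nonneg
  refine le_of_sq_le_sq ?_ (by positivity)
  calc (∑ j ∈ s, ‖p j‖) ^ 2 ≤ _ := h1
    _ ≤ α ^ 2 * (4 / 3) := mul_le_mul h3 h2 (Finset.sum_nonneg fun _ _ => sq_nonneg _)
        (sq_nonneg _)
    _ ≤ (6 / 5 * α) ^ 2 := by nlinarith [sq_nonneg α]

theorem WeightedBound.summable (h : WeightedBound p α) : Summable fun j => ‖p j‖ :=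
  summable_of_sum_le (fun _ => norm_nonneg _) h.sum_norm_le

theorem WeightedBound.norm_hankelOp_le (h : WeightedBound p α) : ‖hankelOp p‖ ≤ 6 / 5 * α :=
  (ZakharovShabat.norm_hankelOp_le h.summable).trans (h.summable.tsum_le_of_sum_le h.sum_norm_le)

theorem WeightedBound.smul (h : WeightedBound p α) {t : ℂ} (ht : ‖t‖ ≤ 1) :
    WeightedBound (t • p) α := by
  refine ⟨h.nonneg, fun s => (Finset.sum_le_sum fun j _ => ?_).trans (h.sum_le s)⟩
  have h1 : ‖(t • p) j‖ ≤ ‖p j‖ := by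
    rw [Pi.smul_apply, norm_smul]
    exact mul_le_of_le_one_left (norm_nonneg _) ht
  have := (weight_pos j).le
  gcongr

theorem norm_le_of_hasSum_mul {u v : ℤ → ℂ} {z : ℂ} {C D : ℝ} (hC : 0 ≤ C) (hD : 0 ≤ D)
    (h : HasSum (fun k => u k * v k) z) (hu : ∀ s : Finset ℤ, ∑ k ∈ s, ‖u k‖ ^ 2 ≤ C ^ 2)
    (hv : ∀ s : Finset ℤ, ∑ k ∈ s, ‖v k‖ ^ 2 ≤ D ^ 2) : ‖z‖ ≤ C * D := by
  refine le_of_tendsto h.norm (Filter.Eventually.of_forall fun s => ?_)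
  refine (norm_sum_le _ _).trans ?_
  simp only [norm_mul]
  refine le_of_sq_le_sq ?_ (by positivity)
  rw [mul_pow]
  exact (Finset.sum_mul_sq_le_sq_mul_sq s _ _).trans (mul_le_mul (hu s) (hv s)
    (Finset.sum_nonneg fun _ _ => sq_nonneg _) (sq_nonneg _))

theorem sum_norm_sq_le (x : SeqSpace) (s : Finset ℤ) : ∑ k ∈ s, ‖x k‖ ^ 2 ≤ ‖x‖ ^ 2 :=
  sum_le_hasSum s (fun _ _ => sq_nonneg _) (hasSum_norm_sq x)

/-- The unit vector `e_n`. -/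
def unitVec (n : ℤ) : SeqSpace := lp.single 2 n (1 : ℂ)

theorem unitVec_self (n : ℤ) : unitVec n n = 1 := lp.single_apply_self _ _ _

theorem unitVec_of_ne {n k : ℤ} (h : k ≠ n) : unitVec n k = 0 := lp.single_apply_ne _ _ _ h

theorem norm_unitVec (n : ℤ) : ‖unitVec n‖ = 1 := by
  unfold unitVec
  rw [lp.norm_single (by norm_num), norm_one]

theorem hankelOp_unitVec (hp : Summable fun j => ‖p j‖) (n m : ℤ) :
    hankelOp p (unitVec n) m = p (m + n) := by
  have h1 := hasSum_hankelOp hp (unitVec n) m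
  have h2 : HasSum (fun k => p (m + k) * unitVec n k) (p (m + n) * unitVec n n) :=
    hasSum_single n fun k hk => by rw [unitVec_of_ne hk, mul_zero]
  rw [h1.unique h2, unitVec_self, mul_one]

variable {z : ℂ} {n : ℤ}

theorem pi_mul_le_norm_sub (hz : |z.re - n * Real.pi| ≤ Real.pi / 2) (k : ℤ) :
    Real.pi * (|(k : ℝ) - n| - 1 / 2) ≤ ‖z - k * Real.pi‖ := by
  have h1 := Complex.abs_re_le_norm (z - k * Real.pi)
  have h2 : (z - k * Real.pi).re = (z.re - n * Real.pi) - (k - n) * Real.pi := by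
    simp
    ring
  rw [h2] at h1
  have h3 : |((k : ℝ) - n) * Real.pi| - |z.re - n * Real.pi| ≤
      |(z.re - n * Real.pi) - (k - n) * Real.pi| := by
    rw [abs_sub_comm (z.re - n * Real.pi)]
    exact abs_sub_abs_le_abs_sub _ _
  rw [abs_mul, abs_of_pos Real.pi_pos] at h3
  linarith

theorem one_le_abs_int_sub {k n : ℤ} (h : k ≠ n) : (1 : ℝ) ≤ |(k : ℝ) - n| := by
  have : (1 : ℤ) ≤ |k - n| := Int.one_le_abs (sub_ne_zero.2 h)
  exact_mod_cast this

/-- The entries of the reduced resolvent of the free operator in the strip around `nπ`. -/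
def reducedEntry (z : ℂ) (n k : ℤ) : ℂ := if k = n then 0 else (z - k * Real.pi)⁻¹

theorem norm_reducedEntry_le (hz : |z.re - n * Real.pi| ≤ Real.pi / 2) {k : ℤ} (hk : k ≠ n) :
    ‖reducedEntry z n k‖ ≤ 1 / (Real.pi * (|(k : ℝ) - n| - 1 / 2)) := by
  rw [reducedEntry, if_neg hk, norm_inv, ← one_div]
  have h1 := one_le_abs_int_sub hk
  have := Real.pi_pos
  refine one_div_le_one_div_of_le (mul_pos this (by linarith)) (pi_mul_le_norm_sub hz k)

theorem norm_reducedEntry_le_one (hz : |z.re - n * Real.pi| ≤ Real.pi / 2) (k : ℤ) :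
    ‖reducedEntry z n k‖ ≤ 1 := by
  by_cases hk : k = n
  · simp [reducedEntry, hk]
  · refine (norm_reducedEntry_le hz hk).trans ?_
    have h1 := one_le_abs_int_sub hk
    have := Real.pi_gt_three
    rw [div_le_one (by nlinarith)]
    nlinarith

/-- Either the Fourier coefficient or the resolvent gains a factor `⟨n⟩`. -/
theorem bracket_mul_norm_reducedEntry_le (hz : |z.re - n * Real.pi| ≤ Real.pi / 2) (k : ℤ) :
    bracket n * ‖reducedEntry z n k‖ ≤ weight (n + k) := by
  by_cases hk : k = n
  · simp [reducedEntry, hk, (weight_pos _).le]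
  · have h0 := norm_reducedEntry_le hz hk
    have h1 := one_le_abs_int_sub hk
    have h2 := Real.pi_gt_three
    have h3 : 2 * |(n : ℝ)| ≤ |(n : ℝ) + k| + |(k : ℝ) - n| := by
      have : (2 : ℝ) * n = (n + k) - (k - n) := by ring
      calc 2 * |(n : ℝ)| = |(n + k) - ((k : ℝ) - n)| := by rw [← this, abs_mul, abs_two]
        _ ≤ _ := abs_sub _ _
    have h4 : 0 ≤ bracket n := by unfold bracket; positivity
    refine (mul_le_mul_of_nonneg_left h0 h4).trans ?_
    rw [mul_one_div, div_le_iff₀ (mul_pos (by linarith) (by linarith))]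
    unfold weight bracket
    push_cast
    set a := |(n : ℝ) + k|
    set b := |(k : ℝ) - n|
    have ha : 0 ≤ a := abs_nonneg _
    have h5 : (1 + 3 * a) * (3 * (b - 1 / 2)) ≤ (1 + Real.pi * a) * (Real.pi * (b - 1 / 2)) := by
      have : 0 ≤ b - 1 / 2 := by linarith
      gcongr
    nlinarith

/-- With y = π(|k-n| - 1/2) and x = π(|l-n| - 1/2), the inequality 2|n| ≤ |k+l| + |k-n| + |l-n|
gives ⟨n⟩ ≤ (w + y)x, where w is the weight of k + l. Dividing by w, x and y leaves 1/w + 1/y, which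
is square summable in k uniformly in l. -/
theorem bracket_mul_norm_reducedEntry_mul_le (hz : |z.re - n * Real.pi| ≤ Real.pi / 2) (k l : ℤ) :
    bracket n * (‖reducedEntry z n k‖ * ‖reducedEntry z n l‖ / weight (k + l)) ≤
      1 / weight (k + l) + 2 / Real.pi * |1 / ((k : ℝ) - n)| := by
  have hw := weight_pos (k + l)
  have hpi := Real.pi_gt_three
  by_cases hk : k = n
  · have : reducedEntry z n k = 0 := if_pos hk
    rw [this, norm_zero, zero_mul, zero_div, mul_zero]
    positivity
  by_cases hl : l = n
  · have : reducedEntry z n l = 0 := if_pos hl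
    rw [this, norm_zero, mul_zero, zero_div, mul_zero]
    positivity
  have k0 := norm_reducedEntry_le hz hk
  have k1 := one_le_abs_int_sub hk
  have l0 := norm_reducedEntry_le hz hl
  have l1 := one_le_abs_int_sub hl
  have h3 : 2 * |(n : ℝ)| ≤ |(k : ℝ) + l| + |(k : ℝ) - n| + |(l : ℝ) - n| := by
    have : (2 : ℝ) * n = (k + l) - (k - n) - (l - n) := by ring
    calc 2 * |(n : ℝ)| = |((k : ℝ) + l) - (k - n) - (l - n)| := by rw [← this, abs_mul, abs_two]
      _ ≤ |((k : ℝ) + l) - (k - n)| + |(l : ℝ) - n| := abs_sub _ _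
      _ ≤ _ := by gcongr; exact abs_sub _ _
  have h4 : 0 ≤ bracket n := by unfold bracket; positivity
  set y := Real.pi * (|(k : ℝ) - n| - 1 / 2) with hy
  set x := Real.pi * (|(l : ℝ) - n| - 1 / 2) with hx
  have hy0 : 0 < y := mul_pos (by linarith) (by linarith)
  have hx0 : 0 < x := mul_pos (by linarith) (by linarith)
  have key : bracket n ≤ (weight (k + l) + y) * x := by
    rw [hx, hy]
    unfold weight bracket
    push_cast
    set a := |(k : ℝ) + l|
    set b := |(k : ℝ) - n|
    set c := |(l : ℝ) - n|
    have ha : 0 ≤ a := abs_nonneg _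
    -- Lowering π to 3 is enough, because b and c are at least 1.
    have h5 : (1 + 3 * a + 3 * (b - 1 / 2)) * (3 * (c - 1 / 2)) ≤
        (1 + Real.pi * a + Real.pi * (b - 1 / 2)) * (Real.pi * (c - 1 / 2)) := by
      have : 0 ≤ b - 1 / 2 := by linarith
      have : 0 ≤ c - 1 / 2 := by linarith
      gcongr
    nlinarith [mul_nonneg ha (by linarith : (0 : ℝ) ≤ c - 1),
      mul_nonneg (by linarith : (0 : ℝ) ≤ b - 1) (by linarith : (0 : ℝ) ≤ c - 1)]
  have h6 : 1 / y ≤ 2 / Real.pi * |1 / ((k : ℝ) - n)| := by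
    rw [abs_div, abs_one, div_mul_div_comm, mul_one, div_le_div_iff₀ hy0 (by positivity), hy]
    nlinarith
  calc bracket n * (‖reducedEntry z n k‖ * ‖reducedEntry z n l‖ / weight (k + l))
      ≤ ((weight (k + l) + y) * x) * (1 / y * (1 / x) / weight (k + l)) := by gcongr
    _ = 1 / weight (k + l) + 1 / y := by field_simp; ring
    _ ≤ _ := by gcongr

/-- By (u + v)² ≤ 2u² + 2v² each of the two parts contributes at most 2 · 4/3, and 16/3 ≤ (5/2)². -/
theorem sum_kernel_sq_le (hz : |z.re - n * Real.pi| ≤ Real.pi / 2) (l : ℤ) (s : Finset ℤ) :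
    ∑ k ∈ s, (‖reducedEntry z n k‖ * ‖reducedEntry z n l‖ / weight (k + l)) ^ 2 ≤
      (5 / 2 / bracket n) ^ 2 := by
  have hb : 0 < bracket n := by unfold bracket; positivity
  have h1 : ∀ k ∈ s, (‖reducedEntry z n k‖ * ‖reducedEntry z n l‖ / weight (k + l)) ^ 2 ≤
      (1 / bracket n) ^ 2 * (2 * (1 / weight (k + l)) ^ 2 +
        2 * (4 / Real.pi ^ 2) * (1 / ((k : ℝ) - n) ^ 2)) := by
    intro k _
    have h2 := bracket_mul_norm_reducedEntry_mul_le hz k l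
    have h3 : ‖reducedEntry z n k‖ * ‖reducedEntry z n l‖ / weight (k + l) ≤ 1 / bracket n *
        (1 / weight (k + l) + 2 / Real.pi * |1 / ((k : ℝ) - n)|) := by
      rw [one_div_mul_eq_div, le_div_iff₀ hb, mul_comm]
      exact h2
    have h4 : 0 ≤ ‖reducedEntry z n k‖ * ‖reducedEntry z n l‖ / weight (k + l) := by
      have := (weight_pos (k + l)).le
      positivity
    refine (pow_le_pow_left₀ h4 h3 2).trans ?_
    rw [mul_pow]
    refine mul_le_mul_of_nonneg_left ?_ (sq_nonneg _)
    refine (add_sq_le).trans (le_of_eq ?_)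
    rw [mul_pow, sq_abs, div_pow, div_pow 1 ((k : ℝ) - n)]
    ring
  refine (Finset.sum_le_sum h1).trans ?_
  rw [← Finset.mul_sum, Finset.sum_add_distrib, ← Finset.mul_sum, ← Finset.mul_sum]
  have h2 := sum_inv_weight_sq_le s l
  have h3 := sum_one_div_int_sub_sq_le s n
  have h4 : 4 / Real.pi ^ 2 * (Real.pi ^ 2 / 3) = 4 / 3 := by
    have := Real.pi_ne_zero
    field_simp
  have h5 := mul_le_mul_of_nonneg_left h3 (by positivity : (0 : ℝ) ≤ 4 / Real.pi ^ 2)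
  rw [h4] at h5
  rw [div_pow (5 / 2 : ℝ), div_pow 1, one_pow, one_div_mul_eq_div]
  gcongr
  linarith

/-- The reduced resolvent of the free operator. -/
def reducedOp (hz : |z.re - n * Real.pi| ≤ Real.pi / 2) : SeqSpace →L[ℂ] SeqSpace :=
  diagOp (reducedEntry z n) zero_le_one (norm_reducedEntry_le_one hz)

theorem reducedOp_apply (hz : |z.re - n * Real.pi| ≤ Real.pi / 2) (x : SeqSpace) (k : ℤ) :
    reducedOp hz x k = reducedEntry z n k * x k := diagOp_apply _ _ _ _ _

theorem bracket_pos (x : ℝ) : 0 < bracket x := by unfold bracket; positivity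

theorem WeightedBound.sum_reduced_le (h : WeightedBound p α)
    (hz : |z.re - n * Real.pi| ≤ Real.pi / 2) (s : Finset ℤ) :
    ∑ k ∈ s, ‖p (n + k) * reducedEntry z n k‖ ^ 2 ≤ (α / bracket n) ^ 2 := by
  have hb := bracket_pos n
  have h1 : ∀ k ∈ s, ‖p (n + k) * reducedEntry z n k‖ ^ 2 ≤
      (1 / bracket n) ^ 2 * (weight (n + k) * ‖p (n + k)‖) ^ 2 := by
    intro k _
    rw [← mul_pow]
    refine pow_le_pow_left₀ (norm_nonneg _) ?_ 2
    rw [one_div_mul_eq_div, le_div_iff₀ hb, norm_mul]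
    have := mul_le_mul_of_nonneg_right (bracket_mul_norm_reducedEntry_le hz k)
      (norm_nonneg (p (n + k)))
    linarith
  refine (Finset.sum_le_sum h1).trans ?_
  rw [← Finset.mul_sum]
  refine (mul_le_mul_of_nonneg_left (h.sum_comp_le n s) (sq_nonneg _)).trans (le_of_eq ?_)
  rw [← mul_pow]
  ring

theorem WeightedBound.norm_reducedOp_hankelOp_unitVec_le (h : WeightedBound p α)
    (hz : |z.re - n * Real.pi| ≤ Real.pi / 2) :
    ‖reducedOp hz (hankelOp p (unitVec n))‖ ≤ α / bracket n := by
  refine norm_le_of_forall_sum_sq_le (div_nonneg h.nonneg (bracket_pos n).le) fun s => ?_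
  refine le_trans (le_of_eq (Finset.sum_congr rfl fun k _ => ?_)) (h.sum_reduced_le hz s)
  rw [reducedOp_apply, hankelOp_unitVec h.summable, mul_comm, add_comm]

/-- Only the n-th row is bounded: there a single reduced entry already exchanges the weight of
p_{n+k} for a factor ⟨n⟩. The full operator H_p R has no such gain. -/
theorem WeightedBound.norm_hankelOp_reducedOp_apply_le (h : WeightedBound p α)
    (hz : |z.re - n * Real.pi| ≤ Real.pi / 2) (x : SeqSpace) :
    ‖hankelOp p (reducedOp hz x) n‖ ≤ α / bracket n * ‖x‖ := by
  have h1 := hasSum_hankelOp h.summable (reducedOp hz x) n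
  simp only [reducedOp_apply, ← mul_assoc] at h1
  exact norm_le_of_hasSum_mul (div_nonneg h.nonneg (bracket_pos n).le) (norm_nonneg _) h1
    (h.sum_reduced_le hz) (sum_norm_sq_le x)

/-- Write the kernel as (w p)_{k+l} times R_k R_l / w_{k+l}. Cauchy–Schwarz in l spends α on the
first factor for every row k; summing over k then needs only the column sums of the squared second
factor, bounded by `sum_kernel_sq_le`. -/
theorem WeightedBound.norm_reducedOp_hankelOp_reducedOp_le (h : WeightedBound p α)
    (hz : |z.re - n * Real.pi| ≤ Real.pi / 2) (x : SeqSpace) :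
    ‖reducedOp hz (hankelOp p (reducedOp hz x))‖ ≤ 5 / 2 * (α / bracket n) * ‖x‖ := by
  have hb := bracket_pos n
  have hα := h.nonneg
  set f : ℤ → ℤ → ℝ := fun k l =>
    (‖reducedEntry z n k‖ * ‖reducedEntry z n l‖ / weight (k + l)) ^ 2 * ‖x l‖ ^ 2 with hf
  have hf0 : ∀ k l, 0 ≤ f k l := fun k l => by positivity
  have hfs : ∀ k, Summable (f k) := by
    intro k
    refine Summable.of_nonneg_of_le (hf0 k) (fun l => ?_)
      ((summable_norm_sq x).mul_left ((5 / 2 / bracket n) ^ 2))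
    -- A one-element sum bounds the single kernel entry, which suffices for summability in l.
    have := sum_kernel_sq_le hz l {k}
    rw [Finset.sum_singleton] at this
    exact mul_le_mul_of_nonneg_right this (sq_nonneg _)
  refine norm_le_of_forall_sum_sq_le (by positivity) fun s => ?_
  have h1 : ∀ k ∈ s, ‖reducedOp hz (hankelOp p (reducedOp hz x)) k‖ ^ 2 ≤
      α ^ 2 * ∑' l, f k l := by
    intro k _
    have h2 := (hasSum_hankelOp h.summable (reducedOp hz x) k).mul_left (reducedEntry z n k)
    have e : ∀ l, reducedEntry z n k * (p (k + l) * reducedOp hz x l) =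
        ((weight (k + l) : ℂ) * p (k + l)) *
          (reducedEntry z n k * reducedEntry z n l / weight (k + l) * x l) := by
      intro l
      have : (weight (k + l) : ℂ) ≠ 0 := by exact_mod_cast (weight_pos _).ne'
      rw [reducedOp_apply]
      field_simp
    simp only [e] at h2
    have h3 := norm_le_of_hasSum_mul (C := α) (D := Real.sqrt (∑' l, f k l)) hα
      (Real.sqrt_nonneg _) h2 (fun t => ?_) (fun t => ?_)
    · rw [reducedOp_apply]
      refine (pow_le_pow_left₀ (norm_nonneg _) h3 2).trans (le_of_eq ?_)
      rw [mul_pow, Real.sq_sqrt (tsum_nonneg (hf0 k))]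
    · refine le_trans (le_of_eq (Finset.sum_congr rfl fun l _ => ?_)) (h.sum_comp_le k t)
      rw [norm_mul, Complex.norm_real, Real.norm_of_nonneg (weight_pos _).le]
    · rw [Real.sq_sqrt (tsum_nonneg (hf0 k))]
      refine le_trans (le_of_eq (Finset.sum_congr rfl fun l _ => ?_))
        ((hfs k).sum_le_tsum t fun l _ => hf0 k l)
      rw [norm_mul, norm_div, norm_mul, Complex.norm_real,
        Real.norm_of_nonneg (weight_pos _).le, mul_pow]
  refine (Finset.sum_le_sum h1).trans ?_
  rw [← Finset.mul_sum, ← Summable.tsum_finsetSum fun k _ => hfs k]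
  have h2 : ∑' l, ∑ k ∈ s, f k l ≤ (5 / 2 / bracket n) ^ 2 * ‖x‖ ^ 2 := by
    rw [← (hasSum_norm_sq x).tsum_eq, ← tsum_mul_left]
    refine Summable.tsum_le_tsum (fun l => ?_) (summable_sum fun k _ => hfs k)
      ((summable_norm_sq x).mul_left _)
    rw [← Finset.sum_mul]
    exact mul_le_mul_of_nonneg_right (sum_kernel_sq_le hz l s) (sq_nonneg _)
  refine (mul_le_mul_of_nonneg_left h2 (sq_nonneg α)).trans (le_of_eq ?_)
  ring

/-- Inside the strip z - mπ vanishes at most for m = n, so every other coordinate can be solved for.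
-/
theorem sub_smul_unitVec_eq_reducedOp (hz : |z.re - n * Real.pi| ≤ Real.pi / 2) {x y : SeqSpace}
    (h : ∀ m : ℤ, (z - m * Real.pi) * x m = y m) : x - x n • unitVec n = reducedOp hz y := by
  ext k
  have e1 : (x - x n • unitVec n) k = x k - x n * unitVec n k := rfl
  rw [e1, reducedOp_apply]
  by_cases hk : k = n
  · subst hk
    rw [unitVec_self, mul_one, sub_self, reducedEntry, if_pos rfl, zero_mul]
  · rw [unitVec_of_ne hk, mul_zero, sub_zero, reducedEntry, if_neg hk, ← h,
      inv_mul_cancel_left₀]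
    have h1 := pi_mul_le_norm_sub hz k
    have h2 := one_le_abs_int_sub hk
    have h3 := Real.pi_pos
    rw [← norm_pos_iff]
    nlinarith

/-- The Lyapunov–Schmidt reduction: an eigenvector is controlled by its `n`-th coordinates. -/
theorem norm_sub_smul_unitVec_le (hp : WeightedBound p α) (hq : WeightedBound q β)
    (hαβ : α * β ≤ bracket n / 16) (hz : |z.re - n * Real.pi| ≤ Real.pi / 2) {a b : SeqSpace}
    (ha : ∀ m : ℤ, (z - m * Real.pi) * a m = hankelOp p b m)
    (hb : ∀ m : ℤ, (z - m * Real.pi) * b m = hankelOp q a m) :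
    ‖a - a n • unitVec n‖ ≤
      6 * (α * β / bracket n) * ‖a n‖ + 2 * (α / bracket n) * ‖b n‖ := by
  have hn := bracket_pos n
  have hα := hp.nonneg
  have hβ := hq.nonneg
  set e := unitVec n with he
  set u := a - a n • e with hu
  have hu1 : u = reducedOp hz (hankelOp p b) := sub_smul_unitVec_eq_reducedOp hz ha
  have hv1 : b = reducedOp hz (hankelOp q a) + b n • e := by
    rw [← sub_smul_unitVec_eq_reducedOp hz hb]
    abel
  have ha1 : a = u + a n • e := by rw [hu]; abel
  -- One substitution of the second equation into the first. R H_p alone need not be small, whereas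
  -- R H_p R H_q has norm at most (5/2)(6/5)A = 3A with A = αβ/⟨n⟩.
  have hu2 : u = reducedOp hz (hankelOp p (reducedOp hz (hankelOp q u))) +
      a n • reducedOp hz (hankelOp p (reducedOp hz (hankelOp q e))) +
      b n • reducedOp hz (hankelOp p e) := by
    conv_lhs => rw [hu1, hv1, ha1]
    simp only [map_add, map_smul]
  have n1 := hp.norm_reducedOp_hankelOp_reducedOp_le hz (hankelOp q u)
  have n2 := hp.norm_reducedOp_hankelOp_reducedOp_le hz (hankelOp q e)
  have n3 := hp.norm_reducedOp_hankelOp_unitVec_le hz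
  have n4 : ‖hankelOp q u‖ ≤ 6 / 5 * β * ‖u‖ :=
    (hankelOp q).le_of_opNorm_le hq.norm_hankelOp_le u
  have n5 : ‖hankelOp q e‖ ≤ 6 / 5 * β * 1 := by
    have := (hankelOp q).le_of_opNorm_le hq.norm_hankelOp_le e
    rwa [norm_unitVec] at this
  set A := α * β / bracket n with hA
  have hA1 : A ≤ 1 / 16 := by
    rw [hA, div_le_iff₀ hn]
    linarith
  have hA0 : 0 ≤ A := by positivity
  have m1 : ‖reducedOp hz (hankelOp p (reducedOp hz (hankelOp q u)))‖ ≤ 3 * A * ‖u‖ := by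
    refine n1.trans ((mul_le_mul_of_nonneg_left n4 (by positivity)).trans (le_of_eq ?_))
    rw [hA]
    ring
  have m2 : ‖reducedOp hz (hankelOp p (reducedOp hz (hankelOp q e)))‖ ≤ 3 * A := by
    refine n2.trans ((mul_le_mul_of_nonneg_left n5 (by positivity)).trans (le_of_eq ?_))
    rw [hA]
    ring
  have m3 : ‖u‖ ≤ 3 * A * ‖u‖ + ‖a n‖ * (3 * A) + ‖b n‖ * (α / bracket n) := by
    conv_lhs => rw [hu2]
    refine (norm_add₃_le).trans ?_
    rw [norm_smul, norm_smul]
    gcongr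
  -- Since 3A ≤ 3/16 < 1/2, the term in ‖u‖ is absorbed at the cost of a factor 2.
  nlinarith [norm_nonneg u, norm_nonneg (a n), norm_nonneg (b n)]

theorem weight_two_mul (n : ℤ) : bracket (2 * n) ≤ weight (n + n) := by
  unfold bracket weight
  have h : |((n + n : ℤ) : ℝ)| = |2 * (n : ℝ)| := by push_cast; ring_nf
  rw [h]
  have := Real.pi_gt_three
  nlinarith [abs_nonneg (2 * (n : ℝ))]

/-- The n-th equation after eliminating the other coordinates: the diagonal part is of order αβ/⟨n⟩,
while the coupling to b_n is p_{2n}, bounded by α/⟨2n⟩, plus a correction coming from u. Since A ≤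
1/16 the corrections fit into the two factors 2. -/
theorem norm_mul_coord_le (hp : WeightedBound p α) (hq : WeightedBound q β)
    (hαβ : α * β ≤ bracket n / 16) (hz : |z.re - n * Real.pi| ≤ Real.pi / 2) {a b : SeqSpace}
    (ha : ∀ m : ℤ, (z - m * Real.pi) * a m = hankelOp p b m)
    (hb : ∀ m : ℤ, (z - m * Real.pi) * b m = hankelOp q a m) :
    ‖z - n * Real.pi‖ * ‖a n‖ ≤
      2 * (α * β / bracket n) * ‖a n‖ + 2 * (α / bracket (2 * n)) * ‖b n‖ := by
  have hn := bracket_pos n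
  have h2n := bracket_pos (2 * n)
  have hα := hp.nonneg
  have hβ := hq.nonneg
  have hu := norm_sub_smul_unitVec_le hp hq hαβ hz ha hb
  set e := unitVec n with he
  set u := a - a n • e with hudef
  have ha1 : a = u + a n • e := by rw [hudef]; abel
  have hb1 : b = reducedOp hz (hankelOp q u) + a n • reducedOp hz (hankelOp q e) + b n • e := by
    have h1 := sub_smul_unitVec_eq_reducedOp hz hb
    rw [ha1, map_add, map_add, map_smul, map_smul] at h1
    rw [← h1]
    abel
  have e1 : (z - n * Real.pi) * a n = hankelOp p (reducedOp hz (hankelOp q u)) n +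
      a n * hankelOp p (reducedOp hz (hankelOp q e)) n + b n * p (n + n) := by
    rw [ha n, ← hankelOp_unitVec hp.summable n n]
    conv_lhs => rw [hb1]
    simp only [map_add, map_smul]
    rfl
  have n1 := hp.norm_hankelOp_reducedOp_apply_le hz (hankelOp q u)
  have n2 := hp.norm_hankelOp_reducedOp_apply_le hz (hankelOp q e)
  have n4 : ‖hankelOp q u‖ ≤ 6 / 5 * β * ‖u‖ :=
    (hankelOp q).le_of_opNorm_le hq.norm_hankelOp_le u
  have n5 : ‖hankelOp q e‖ ≤ 6 / 5 * β * 1 := by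
    have := (hankelOp q).le_of_opNorm_le hq.norm_hankelOp_le e
    rwa [norm_unitVec] at this
  have n6 : ‖p (n + n)‖ ≤ α / bracket (2 * n) := by
    rw [le_div_iff₀ h2n, mul_comm]
    exact (mul_le_mul_of_nonneg_right (weight_two_mul n) (norm_nonneg _)).trans (hp.norm_le _)
  have n7 : α / bracket n ≤ 2 * (α / bracket (2 * n)) := by
    rw [← mul_div_assoc, div_le_div_iff₀ hn h2n]
    have : bracket (2 * n) ≤ 2 * bracket n := by
      unfold bracket
      rw [abs_mul, abs_two]
      linarith
    nlinarith
  set A := α * β / bracket n with hA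
  have hA1 : A ≤ 1 / 16 := by
    rw [hA, div_le_iff₀ hn]
    linarith
  have hA0 : 0 ≤ A := by positivity
  have m1 : ‖hankelOp p (reducedOp hz (hankelOp q u)) n‖ ≤ 6 / 5 * A * ‖u‖ := by
    refine n1.trans ((mul_le_mul_of_nonneg_left n4 (by positivity)).trans (le_of_eq ?_))
    rw [hA]
    ring
  have m2 : ‖hankelOp p (reducedOp hz (hankelOp q e)) n‖ ≤ 6 / 5 * A := by
    refine n2.trans ((mul_le_mul_of_nonneg_left n5 (by positivity)).trans (le_of_eq ?_))
    rw [hA]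
    ring
  have m3 : ‖z - n * Real.pi‖ * ‖a n‖ ≤ 6 / 5 * A * ‖u‖ + ‖a n‖ * (6 / 5 * A) +
      ‖b n‖ * (α / bracket (2 * n)) := by
    rw [← norm_mul, e1]
    refine (norm_add₃_le).trans ?_
    rw [norm_mul, norm_mul]
    gcongr
  set X := ‖a n‖ with hX
  set Y := ‖b n‖ with hY
  have hX0 : 0 ≤ X := norm_nonneg _
  have hY0 : 0 ≤ Y := norm_nonneg _
  have m4 : 6 / 5 * A * ‖u‖ ≤ 6 / 5 * A * (6 * A * X + 2 * (α / bracket n) * Y) :=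
    mul_le_mul_of_nonneg_left hu (by positivity)
  have m5 : A * A ≤ A * (1 / 16) := mul_le_mul_of_nonneg_left hA1 hA0
  have m6 : A * A * X ≤ A * (1 / 16) * X := mul_le_mul_of_nonneg_right m5 hX0
  have m7 : A * (α / bracket n * Y) ≤ 1 / 16 * (2 * (α / bracket (2 * n)) * Y) :=
    mul_le_mul hA1 (mul_le_mul_of_nonneg_right n7 hY0) (by positivity) (by norm_num)
  have m8 : 0 ≤ A * X := mul_nonneg hA0 hX0
  have m9 : 0 ≤ α / bracket (2 * n) * Y := by positivity
  nlinarith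

/-- Localisation of the eigenvalues in the strip around `nπ`. -/
theorem norm_sub_le_of_eigenvector (hp : WeightedBound p α) (hq : WeightedBound q β)
    (hn : 8 * (α ^ 2 + β ^ 2) ≤ bracket n) (hz : |z.re - n * Real.pi| ≤ Real.pi / 2)
    {a b : SeqSpace} (hab : (a, b) ≠ 0)
    (ha : ∀ m : ℤ, (z - m * Real.pi) * a m = hankelOp p b m)
    (hb : ∀ m : ℤ, (z - m * Real.pi) * b m = hankelOp q a m) :
    ‖z - n * Real.pi‖ ≤ (α ^ 2 + β ^ 2) / bracket n +
      Real.sqrt 2 * Real.sqrt (α ^ 2 + β ^ 2) / bracket (2 * n) := by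
  have hα := hp.nonneg
  have hβ := hq.nonneg
  have hb0 := bracket_pos n
  have h2n := bracket_pos (2 * n)
  have h2αβ : 2 * (α * β) ≤ α ^ 2 + β ^ 2 := by nlinarith [sq_nonneg (α - β)]
  have hαβ : α * β ≤ bracket n / 16 := by linarith
  have hβα : β * α ≤ bracket n / 16 := by linarith
  have k1 := norm_mul_coord_le hp hq hαβ hz ha hb
  have k2 := norm_mul_coord_le hq hp hβα hz hb ha
  have u1 := norm_sub_smul_unitVec_le hp hq hαβ hz ha hb
  have u2 := norm_sub_smul_unitVec_le hq hp hβα hz hb ha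
  set X := ‖a n‖ with hX
  set Y := ‖b n‖ with hY
  have hX0 : 0 ≤ X := norm_nonneg _
  have hY0 : 0 ≤ Y := norm_nonneg _
  -- If both n-th coordinates vanished, the reduction would force the whole eigenvector to vanish.
  have hXY : 0 < X ∨ 0 < Y := by
    by_contra! h
    have hX1 : X = 0 := le_antisymm h.1 hX0
    have hY1 : Y = 0 := le_antisymm h.2 hY0
    rw [hX1, hY1, mul_zero, mul_zero, add_zero, norm_le_zero_iff, norm_eq_zero.1 hX1, zero_smul,
      sub_zero] at u1
    rw [hX1, hY1, mul_zero, mul_zero, add_zero, norm_le_zero_iff, norm_eq_zero.1 hY1, zero_smul,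
      sub_zero] at u2
    exact hab (Prod.ext u1 u2)
  rw [mul_comm β α] at k2
  set L := ‖z - n * Real.pi‖ with hL
  set s := α ^ 2 + β ^ 2 with hs
  have hs0 : 0 ≤ s := by positivity
  have hA : 2 * (α * β / bracket n) ≤ s / bracket n := by
    rw [← mul_div_assoc]
    gcongr
  set A := α * β / bracket n
  rcases le_or_gt L (2 * A) with h | h
  · have : 0 ≤ Real.sqrt 2 * Real.sqrt s / bracket (2 * n) := by positivity
    linarith
  have j1 : (L - 2 * A) * X ≤ 2 * (α / bracket (2 * n)) * Y := by linarith
  have j2 : (L - 2 * A) * Y ≤ 2 * (β / bracket (2 * n)) * X := by linarith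
  have hd : 0 < L - 2 * A := by linarith
  have hα' : 0 ≤ 2 * (α / bracket (2 * n)) := by positivity
  have hβ' : 0 ≤ 2 * (β / bracket (2 * n)) := by positivity
  -- Chaining the two inequalities cancels whichever coordinate is nonzero; the right side equals
  -- 4αβ/⟨2n⟩², at most 2(α² + β²)/⟨2n⟩².
  have hprod : (L - 2 * A) ^ 2 ≤ 2 * (α / bracket (2 * n)) * (2 * (β / bracket (2 * n))) := by
    set d := L - 2 * A
    set μ := 2 * (α / bracket (2 * n))
    set ν := 2 * (β / bracket (2 * n))
    rcases hXY with hX1 | hY1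
    · have : d ^ 2 * X ≤ μ * ν * X := by
        calc d ^ 2 * X = d * (d * X) := by ring
          _ ≤ d * (μ * Y) := by gcongr
          _ = μ * (d * Y) := by ring
          _ ≤ μ * (ν * X) := by gcongr
          _ = μ * ν * X := by ring
      exact le_of_mul_le_mul_right this hX1
    · have : d ^ 2 * Y ≤ μ * ν * Y := by
        calc d ^ 2 * Y = d * (d * Y) := by ring
          _ ≤ d * (ν * X) := by gcongr
          _ = ν * (d * X) := by ring
          _ ≤ ν * (μ * Y) := by gcongr
          _ = μ * ν * Y := by ring
      exact le_of_mul_le_mul_right this hY1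
  have hfin : L - 2 * A ≤ Real.sqrt 2 * Real.sqrt s / bracket (2 * n) := by
    refine le_of_sq_le_sq ?_ (by positivity)
    refine hprod.trans ?_
    rw [div_pow, mul_pow, Real.sq_sqrt (by norm_num), Real.sq_sqrt hs0,
      show 2 * (α / bracket (2 * n)) * (2 * (β / bracket (2 * n))) =
        4 * (α * β) / bracket (2 * n) ^ 2 by field_simp; ring]
    exact div_le_div_of_nonneg_right (by linarith) (by positivity)
  linarith

/-- As |Im z| ≤ |z - mπ| for all m, the two equations give |Im z|‖a‖ ≤ (6/5)α‖b‖ and |Im z|‖b‖ ≤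
(6/5)β‖a‖. Chaining yields (36/25)αβ ≤ (18/25)(α² + β²). -/
theorem abs_im_le_of_eigenvector (hp : WeightedBound p α) (hq : WeightedBound q β)
    {a b : SeqSpace} (hab : (a, b) ≠ 0)
    (ha : ∀ m : ℤ, (z - m * Real.pi) * a m = hankelOp p b m)
    (hb : ∀ m : ℤ, (z - m * Real.pi) * b m = hankelOp q a m) :
    |z.im| ≤ Real.sqrt (α ^ 2 + β ^ 2) := by
  have hα := hp.nonneg
  have hβ := hq.nonneg
  have key : ∀ {x y : SeqSpace}, (∀ m : ℤ, (z - m * Real.pi) * x m = y m) →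
      |z.im| * ‖x‖ ≤ ‖y‖ := by
    intro x y h
    have e : ‖((|z.im| : ℝ) : ℂ) • x‖ = |z.im| * ‖x‖ := by
      rw [norm_smul, Complex.norm_real, Real.norm_of_nonneg (abs_nonneg _)]
    rw [← e]
    refine lp.norm_mono (by norm_num) fun m => ?_
    have e2 : (((|z.im| : ℝ) : ℂ) • x) m = ((|z.im| : ℝ) : ℂ) * x m := rfl
    rw [← h m, e2, norm_mul, norm_mul, Complex.norm_real, Real.norm_of_nonneg (abs_nonneg _)]
    refine mul_le_mul_of_nonneg_right ?_ (norm_nonneg _)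
    have := Complex.abs_im_le_norm (z - m * Real.pi)
    simpa using this
  have h1 := (key ha).trans ((hankelOp p).le_of_opNorm_le hp.norm_hankelOp_le b)
  have h2 := (key hb).trans ((hankelOp q).le_of_opNorm_le hq.norm_hankelOp_le a)
  refine Real.le_sqrt_of_sq_le ?_
  set t := |z.im| with ht
  have ht0 : 0 ≤ t := abs_nonneg _
  have h2αβ : 2 * (α * β) ≤ α ^ 2 + β ^ 2 := by nlinarith [sq_nonneg (α - β)]
  have hne : 0 < ‖a‖ ∨ 0 < ‖b‖ := by
    by_contra! h
    exact hab (Prod.ext (norm_le_zero_iff.1 h.1) (norm_le_zero_iff.1 h.2))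
  have hprod : t ^ 2 ≤ 36 / 25 * (α * β) := by
    rcases hne with h | h
    · have : t ^ 2 * ‖a‖ ≤ 36 / 25 * (α * β) * ‖a‖ := by
        calc t ^ 2 * ‖a‖ = t * (t * ‖a‖) := by ring
          _ ≤ t * (6 / 5 * α * ‖b‖) := by gcongr
          _ = 6 / 5 * α * (t * ‖b‖) := by ring
          _ ≤ 6 / 5 * α * (6 / 5 * β * ‖a‖) := by gcongr
          _ = 36 / 25 * (α * β) * ‖a‖ := by ring
      exact le_of_mul_le_mul_right this h
    · have : t ^ 2 * ‖b‖ ≤ 36 / 25 * (α * β) * ‖b‖ := by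
        calc t ^ 2 * ‖b‖ = t * (t * ‖b‖) := by ring
          _ ≤ t * (6 / 5 * β * ‖a‖) := by gcongr
          _ = 6 / 5 * β * (t * ‖a‖) := by ring
          _ ≤ 6 / 5 * β * (6 / 5 * α * ‖b‖) := by gcongr
          _ = 36 / 25 * (α * β) * ‖b‖ := by ring
      exact le_of_mul_le_mul_right this h
  have : 0 ≤ α * β := by positivity
  linarith

end Estimates

/-! ### Fourier series and periodic derivatives on [0, 2] -/

noncomputable section FourierInterval

/-- Lebesgue measure on `(0, 2]`. -/
abbrev intervalMeasure : Measure ℝ := volume.restrict (Set.Ioc (0 : ℝ) 2)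

/-- `e^{iπmx}`. -/
def wave (m : ℤ) (x : ℝ) : ℂ := cexp (I * Real.pi * m * x)

theorem wave_zero (x : ℝ) : wave 0 x = 1 := by simp [wave]

theorem wave_add (m k : ℤ) (x : ℝ) : wave (m + k) x = wave m x * wave k x := by
  rw [wave, wave, wave, ← Complex.exp_add]
  congr 1
  push_cast
  ring

theorem norm_wave (m : ℤ) (x : ℝ) : ‖wave m x‖ = 1 := by
  have : I * Real.pi * m * x = ((Real.pi * m * x : ℝ) : ℂ) * I := by
    push_cast
    ring
  rw [wave, this, Complex.norm_exp_ofReal_mul_I]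

theorem conj_wave (m : ℤ) (x : ℝ) : (starRingEnd ℂ) (wave m x) = wave (-m) x := by
  rw [wave, wave, ← Complex.exp_conj]
  congr 1
  simp

theorem continuous_wave (m : ℤ) : Continuous (wave m) := by
  unfold wave
  fun_prop

theorem hasDerivAt_wave (m : ℤ) (x : ℝ) :
    HasDerivAt (wave m) (I * Real.pi * m * wave m x) x := by
  have h : HasDerivAt (fun x : ℝ => I * Real.pi * m * (x : ℂ)) (I * Real.pi * m) x := by
    simpa using (Complex.ofRealCLM.hasDerivAt (x := x)).const_mul (I * Real.pi * (m : ℂ))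
  have := h.cexp
  rwa [mul_comm (cexp _)] at this

theorem wave_at_two (m : ℤ) : wave m 2 = 1 := by
  rw [wave, Complex.exp_eq_one_iff]
  exact ⟨m, by push_cast; ring⟩

theorem wave_at_zero (m : ℤ) : wave m 0 = 1 := by simp [wave]

theorem integral_wave_interval (m : ℤ) (a b : ℝ) :
    I * Real.pi * m * ∫ x in a..b, wave m x = wave m b - wave m a := by
  rw [← intervalIntegral.integral_const_mul]
  exact intervalIntegral.integral_eq_sub_of_hasDerivAt (fun x _ => hasDerivAt_wave m x)
    ((continuous_const.mul (continuous_wave m)).intervalIntegrable _ _)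

theorem I_mul_pi_mul_ne_zero {m : ℤ} (hm : m ≠ 0) : I * Real.pi * (m : ℂ) ≠ 0 :=
  mul_ne_zero (mul_ne_zero I_ne_zero (ofReal_ne_zero.2 Real.pi_ne_zero)) (Int.cast_ne_zero.2 hm)

theorem integral_wave (m : ℤ) : ∫ x, wave m x ∂intervalMeasure = if m = 0 then 2 else 0 := by
  rw [← intervalIntegral.integral_of_le (by norm_num : (0 : ℝ) ≤ 2)]
  split_ifs with h
  · subst h
    simp [wave_zero]
  · have := integral_wave_interval m 0 2
    rw [wave_at_two, wave_at_zero, sub_self, mul_eq_zero] at this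
    exact this.resolve_left (I_mul_pi_mul_ne_zero h)

theorem memLp_wave (m : ℤ) : MemLp (wave m) 2 intervalMeasure :=
  MemLp.of_bound (continuous_wave m).aestronglyMeasurable 1
    (Filter.Eventually.of_forall fun x => (norm_wave m x).le)

theorem integrable_L2Interval (f : L2Interval) : Integrable (⇑f) intervalMeasure :=
  (Lp.memLp f).integrable (by norm_num)

theorem integrable_wave_mul {f : ℝ → ℂ} (hf : Integrable f intervalMeasure) (m : ℤ) :
    Integrable (fun x => wave m x * f x) intervalMeasure :=
  hf.bdd_mul (continuous_wave m).aestronglyMeasurable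
    (Filter.Eventually.of_forall fun x => (norm_wave m x).le)

/-- The Fourier integral `∫₀² e^{-iπmx} f(x) dx`. -/
def fourierInt (f : ℝ → ℂ) (m : ℤ) : ℂ := ∫ x, wave (-m) x * f x ∂intervalMeasure

theorem fourierInt_congr {f g : ℝ → ℂ} (h : f =ᵐ[intervalMeasure] g) (m : ℤ) :
    fourierInt f m = fourierInt g m :=
  integral_congr_ae (h.mono fun x hx => by dsimp only; rw [hx])

theorem fourierInt_add {f g : ℝ → ℂ} (hf : Integrable f intervalMeasure)
    (hg : Integrable g intervalMeasure) (m : ℤ) :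
    fourierInt (fun x => f x + g x) m = fourierInt f m + fourierInt g m := by
  unfold fourierInt
  rw [← integral_add (integrable_wave_mul hf _) (integrable_wave_mul hg _)]
  congr 1
  ext1 x
  ring

/-- Completeness of the waves from Parseval's identity on an interval of length 2. -/
theorem eq_zero_of_fourierInt_eq_zero (f : L2Interval) (h : ∀ m, fourierInt f m = 0) : f = 0 := by
  have h1 := hasSum_sq_fourierCoeffOn (by norm_num : (0 : ℝ) < 2) (Lp.memLp f)
  have h2 : ∀ m, fourierCoeffOn (by norm_num : (0 : ℝ) < 2) (⇑f) m = 0 := by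
    intro m
    rw [fourierCoeffOn_eq_integral, intervalIntegral.integral_of_le (by norm_num : (0 : ℝ) ≤ 2)]
    have : ∫ x in Ioc (0 : ℝ) 2, fourier (-m) (x : AddCircle ((2 : ℝ) - 0)) • f x =
        fourierInt f m := by
      unfold fourierInt
      congr 1
      ext1 x
      rw [fourier_coe_apply, wave, smul_eq_mul]
      congr 2
      push_cast
      ring
    rw [this, h m, smul_zero]
  simp only [h2, norm_zero] at h1
  rw [zero_pow two_ne_zero] at h1
  have h3 := h1.unique hasSum_zero
  rw [smul_eq_zero_iff_right (by norm_num),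
    intervalIntegral.integral_of_le (by norm_num : (0 : ℝ) ≤ 2),
    integral_eq_zero_iff_of_nonneg (fun x => sq_nonneg _) ((Lp.memLp f).norm.integrable_sq)] at h3
  refine (Lp.eq_zero_iff_ae_eq_zero).2 (h3.mono fun x hx => ?_)
  simpa using hx

theorem inner_wave (m : ℤ) (f : L2Interval) :
    inner ℂ ((memLp_wave m).toLp (wave m)) f = fourierInt f m := by
  rw [L2.inner_def]
  refine integral_congr_ae ((memLp_wave m).coeFn_toLp.mono fun x hx => ?_)
  dsimp only
  rw [hx, RCLike.inner_apply', conj_wave]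

/-- The orthonormal waves, with frequencies enumerated by `σ`. -/
def waveVec (σ : ℤ ≃ ℤ) (m : ℤ) : L2Interval :=
  ((Real.sqrt 2)⁻¹ : ℂ) • (memLp_wave (σ m)).toLp (wave (σ m))

theorem inner_waveVec (σ : ℤ ≃ ℤ) (m : ℤ) (f : L2Interval) :
    inner ℂ (waveVec σ m) f = ((Real.sqrt 2)⁻¹ : ℂ) * fourierInt f (σ m) := by
  rw [waveVec, inner_smul_left, inner_wave]
  congr 1
  rw [map_inv₀, Complex.conj_ofReal]

theorem sqrt_two_inv_mul_self : ((Real.sqrt 2)⁻¹ : ℂ) * (((Real.sqrt 2)⁻¹ : ℂ) * 2) = 1 := by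
  rw [← mul_assoc, ← mul_inv, ← Complex.ofReal_mul, Real.mul_self_sqrt (by norm_num)]
  norm_num

theorem sqrt_two_inv_ne_zero : ((Real.sqrt 2)⁻¹ : ℂ) ≠ 0 := by
  simp

theorem orthonormal_waveVec (σ : ℤ ≃ ℤ) : Orthonormal ℂ (waveVec σ) := by
  rw [orthonormal_iff_ite]
  intro m k
  rw [inner_waveVec]
  have h : fourierInt (waveVec σ k) (σ m) =
      ((Real.sqrt 2)⁻¹ : ℂ) * ∫ x, wave (-σ m + σ k) x ∂intervalMeasure := by
    rw [← integral_const_mul]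
    refine integral_congr_ae ?_
    filter_upwards [Lp.coeFn_smul ((Real.sqrt 2)⁻¹ : ℂ) ((memLp_wave (σ k)).toLp (wave (σ k))),
      (memLp_wave (σ k)).coeFn_toLp] with x h1 h2
    rw [waveVec, h1, Pi.smul_apply, h2, wave_add, smul_eq_mul]
    ring
  rw [h, integral_wave]
  by_cases hmk : m = k
  · subst hmk
    rw [if_pos (neg_add_cancel _), if_pos rfl, sqrt_two_inv_mul_self]
  · rw [if_neg, if_neg hmk, mul_zero, mul_zero]
    intro h0
    exact hmk (σ.injective (by omega))

theorem span_waveVec_orthogonal (σ : ℤ ≃ ℤ) :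
    (Submodule.span ℂ (Set.range (waveVec σ)))ᗮ = ⊥ := by
  rw [eq_bot_iff]
  intro f hf
  rw [Submodule.mem_bot]
  refine eq_zero_of_fourierInt_eq_zero f fun m => ?_
  have h := (Submodule.mem_orthogonal _ f).1 hf _ (Submodule.subset_span ⟨σ.symm m, rfl⟩)
  rw [inner_waveVec, σ.apply_symm_apply, mul_eq_zero] at h
  exact h.resolve_left sqrt_two_inv_ne_zero

/-- Fourier coordinates on `L²([0, 2])`. -/
def fourierEquiv (σ : ℤ ≃ ℤ) : L2Interval ≃ₗ[ℂ] SeqSpace :=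
  (HilbertBasis.mkOfOrthogonalEqBot (orthonormal_waveVec σ)
    (span_waveVec_orthogonal σ)).repr.toLinearEquiv

theorem fourierEquiv_apply (σ : ℤ ≃ ℤ) (f : L2Interval) (m : ℤ) :
    fourierEquiv σ f m = ((Real.sqrt 2)⁻¹ : ℂ) * fourierInt f (σ m) := by
  have := HilbertBasis.repr_apply_apply (HilbertBasis.mkOfOrthogonalEqBot (orthonormal_waveVec σ)
    (span_waveVec_orthogonal σ)) f m
  rw [HilbertBasis.coe_mkOfOrthogonalEqBot, inner_waveVec] at this
  exact this

theorem fourierInt_zero (f : L2Interval) : fourierInt f 0 = ∫ t in (0 : ℝ)..2, f t := by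
  rw [intervalIntegral.integral_of_le (by norm_num : (0 : ℝ) ≤ 2), fourierInt]
  congr 1
  ext1 x
  rw [neg_zero, wave_zero, one_mul]

theorem fourierInt_const (c : ℂ) {m : ℤ} (hm : m ≠ 0) : fourierInt (fun _ => c) m = 0 := by
  unfold fourierInt
  rw [integral_mul_const, integral_wave, if_neg (neg_ne_zero.2 hm), zero_mul]

theorem primitive_eq_indicator (d : L2Interval) {x : ℝ} (hx : x ∈ Ioc (0 : ℝ) 2) :
    ∫ t in (0 : ℝ)..x, d t = ∫ t, (if t ≤ x then d t else 0) ∂intervalMeasure := by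
  rw [intervalIntegral.integral_of_le hx.1.le]
  have h : (fun t => if t ≤ x then d t else 0) = (Iic x).indicator d := by
    ext1 t
    rw [Set.indicator_apply]
    rfl
  rw [h, integral_indicator measurableSet_Iic, Measure.restrict_restrict measurableSet_Iic]
  congr 2
  ext t
  simp only [mem_Ioc, mem_inter_iff, mem_Iic]
  constructor
  · rintro ⟨h1, h2⟩
    exact ⟨h2, h1, h2.trans hx.2⟩
  · rintro ⟨h1, h2, h3⟩
    exact ⟨h2, h1⟩

theorem integral_wave_Ici (m : ℤ) {t : ℝ} (ht : t ∈ Ioc (0 : ℝ) 2) :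
    I * Real.pi * m * ∫ x, (if t ≤ x then wave (-m) x else 0) ∂intervalMeasure =
      wave (-m) t - 1 := by
  have h : (fun x => if t ≤ x then wave (-m) x else 0) = (Ici t).indicator (wave (-m)) := by
    ext1 x
    rw [Set.indicator_apply]
    rfl
  have h2 : Ici t ∩ Ioc 0 2 = Icc t 2 := by
    ext x
    simp only [mem_Ioc, mem_inter_iff, mem_Ici, mem_Icc]
    constructor
    · rintro ⟨h1, h2, h3⟩
      exact ⟨h1, h3⟩
    · rintro ⟨h1, h2⟩
      exact ⟨h1, ht.1.trans_le h1, h2⟩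
  rw [h, integral_indicator measurableSet_Ici, Measure.restrict_restrict measurableSet_Ici, h2,
    integral_Icc_eq_integral_Ioc, ← intervalIntegral.integral_of_le ht.2]
  have h3 := integral_wave_interval (-m) t 2
  rw [wave_at_two] at h3
  push_cast at h3
  linear_combination -h3

theorem integrable_primitive_kernel (d : L2Interval) (m : ℤ) :
    Integrable (Function.uncurry fun x t : ℝ => wave (-m) x * (if t ≤ x then d t else 0))
      (intervalMeasure.prod intervalMeasure) := by
  have h1 : Integrable (fun z : ℝ × ℝ => wave (-m) z.1 * d z.2)
      (intervalMeasure.prod intervalMeasure) :=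
    Integrable.mul_prod ((memLp_wave (-m)).integrable (by norm_num)) (integrable_L2Interval d)
  have h2 : (Function.uncurry fun x t : ℝ => wave (-m) x * (if t ≤ x then d t else 0)) =
      {z : ℝ × ℝ | z.2 ≤ z.1}.indicator (fun z : ℝ × ℝ => wave (-m) z.1 * d z.2) := by
    ext1 ⟨x, t⟩
    rw [Set.indicator_apply]
    simp only [Function.uncurry_apply_pair, mem_ofPred_eq]
    split_ifs
    · rfl
    · rw [mul_zero]
  rw [h2]
  exact h1.indicator (measurableSet_le measurable_snd measurable_fst)

theorem integrable_primitive (d : L2Interval) :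
    Integrable (fun x : ℝ => ∫ t in (0 : ℝ)..x, d t) intervalMeasure := by
  have h := (integrable_primitive_kernel d 0).integral_prod_left
  refine h.congr ?_
  filter_upwards [ae_restrict_mem measurableSet_Ioc] with x hx
  rw [primitive_eq_indicator d hx]
  congr 1
  ext1 t
  rw [Function.uncurry_apply_pair, neg_zero, wave_zero, one_mul]

/-- Integration by parts in the form of Fubini: exchange the integrals over the triangle t ≤ x, then
integrate the wave over [t, 2]. -/
theorem fourierInt_primitive (d : L2Interval) (m : ℤ) :
    I * Real.pi * m * fourierInt (fun x => ∫ t in (0 : ℝ)..x, d t) m =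
      fourierInt d m - ∫ t in (0 : ℝ)..2, d t := by
  have h1 : fourierInt (fun x => ∫ t in (0 : ℝ)..x, d t) m =
      ∫ x, ∫ t, wave (-m) x * (if t ≤ x then d t else 0) ∂intervalMeasure ∂intervalMeasure := by
    refine integral_congr_ae ?_
    filter_upwards [ae_restrict_mem measurableSet_Ioc] with x hx
    rw [primitive_eq_indicator d hx, integral_const_mul]
  rw [h1, integral_integral_swap (integrable_primitive_kernel d m), ← integral_const_mul,
    intervalIntegral.integral_of_le (by norm_num : (0 : ℝ) ≤ 2), fourierInt,
    ← integral_sub (integrable_wave_mul (integrable_L2Interval d) _) (integrable_L2Interval d)]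
  refine integral_congr_ae ?_
  filter_upwards [ae_restrict_mem measurableSet_Ioc] with t ht
  have h2 : ∀ x : ℝ, wave (-m) x * (if t ≤ x then d t else 0) =
      (if t ≤ x then wave (-m) x else 0) * d t := by
    intro x
    split_ifs
    · rfl
    · rw [mul_zero, zero_mul]
  simp only [h2]
  rw [integral_mul_const, ← mul_assoc, integral_wave_Ici m ht]
  ring

theorem ext_fourierInt {f g : L2Interval} (h : ∀ m, fourierInt f m = fourierInt g m) : f = g := by
  refine (fourierEquiv (Equiv.refl ℤ)).injective ?_
  ext m
  rw [fourierEquiv_apply, fourierEquiv_apply, h]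

/-- Differentiation becomes multiplication by iπm: the primitive of d has the right coefficients for
m ≠ 0, and the case m = 0 says exactly that d has integral zero, which is periodicity. -/
theorem isPeriodicDeriv_iff {f d : L2Interval} :
    IsPeriodicDeriv f d ↔ ∀ m : ℤ, fourierInt d m = I * Real.pi * m * fourierInt f m := by
  constructor
  · rintro ⟨⟨c, hc⟩, h0⟩ m
    rw [fourierInt_congr hc, fourierInt_add (integrable_const c) (integrable_primitive d), mul_add,
      fourierInt_primitive, h0, sub_zero]
    rcases eq_or_ne m 0 with rfl | hm
    · simp
    · rw [fourierInt_const c hm, mul_zero, zero_add]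
  · intro h
    have h0 : ∫ t in (0 : ℝ)..2, d t = 0 := by
      rw [← fourierInt_zero, h 0]
      simp
    refine ⟨?_, h0⟩
    have hcont : ContinuousOn (fun x : ℝ => ∫ t in (0 : ℝ)..x, d t) (Set.Icc 0 2) := by
      have h1 := intervalIntegral.continuousOn_primitive_interval ((intervalIntegrable_iff'
        (f := ⇑d)).1 (intervalIntegrable_coe d (by norm_num : (2 : ℝ) ∈ Icc (0 : ℝ) 2)))
      rwa [Set.uIcc_of_le (by norm_num : (0 : ℝ) ≤ 2)] at h1
    obtain ⟨K, hK⟩ := isCompact_Icc.exists_bound_of_continuousOn hcont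
    have hP : MemLp (fun x : ℝ => ∫ t in (0 : ℝ)..x, d t) 2 intervalMeasure := by
      refine MemLp.of_bound (integrable_primitive d).aestronglyMeasurable K ?_
      filter_upwards [ae_restrict_mem measurableSet_Ioc] with x hx
      exact hK x ⟨hx.1.le, hx.2⟩
    -- The constant of integration is fixed by the zero mode, which the derivative does not see; the
    -- interval has length 2.
    set c : ℂ := (fourierInt f 0 - fourierInt (fun x => ∫ t in (0 : ℝ)..x, d t) 0) / 2 with hc
    have hG : MemLp (fun x : ℝ => c + ∫ t in (0 : ℝ)..x, d t) 2 intervalMeasure :=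
      (memLp_const c).add hP
    refine ⟨c, ?_⟩
    have hfG : f = hG.toLp _ := by
      refine ext_fourierInt fun m => ?_
      rw [fourierInt_congr hG.coeFn_toLp,
        fourierInt_add (integrable_const c) (integrable_primitive d)]
      rcases eq_or_ne m 0 with rfl | hm
      · have : fourierInt (fun _ => c) 0 = 2 * c := by
          simp [fourierInt, wave_zero]
        rw [this, hc]
        ring
      · rw [fourierInt_const c hm, zero_add]
        refine mul_left_cancel₀ (I_mul_pi_mul_ne_zero hm) ?_
        rw [fourierInt_primitive, h0, sub_zero, h m]
    rw [hfG]
    exact hG.coeFn_toLp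
end FourierInterval

/-! ### From the Zakharov–Shabat operator to the pencil -/

noncomputable section FourierPotential

theorem haarAddCircle_eq_volume : (AddCircle.haarAddCircle : Measure UnitAddCircle) = volume := by
  have := AddCircle.volume_eq_smul_haarAddCircle (T := 1)
  simpa using this.symm

theorem fourier_coe_eq_wave (j : ℤ) (x : ℝ) :
    fourier j (x : UnitAddCircle) = wave (2 * j) x := by
  rw [fourier_coe_apply, wave]
  congr 1
  push_cast
  ring

/-- The interval (0, 2] is two periods, and the projection to the circle preserves measure on each.
-/
theorem ae_interval_of_ae_circle {P : UnitAddCircle → Prop}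
    (h : ∀ᵐ y ∂(AddCircle.haarAddCircle : Measure UnitAddCircle), P y) :
    ∀ᵐ x : ℝ ∂intervalMeasure, P (x : UnitAddCircle) := by
  rw [haarAddCircle_eq_volume] at h
  have h1 := (UnitAddCircle.measurePreserving_mk 0).quasiMeasurePreserving.ae h
  have h2 := (UnitAddCircle.measurePreserving_mk 1).quasiMeasurePreserving.ae h
  rw [zero_add] at h1
  rw [one_add_one_eq_two] at h2
  have e : Ioc (0 : ℝ) 2 = Ioc 0 1 ∪ Ioc 1 2 :=
    (Ioc_union_Ioc_eq_Ioc zero_le_one one_le_two).symm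
  rw [intervalMeasure, e, ae_restrict_union_iff]
  exact ⟨h1, h2⟩

/-- A function on the circle with an absolutely convergent Fourier series is a.e. the sum of the
series. -/
theorem exists_continuous_of_summable_fourierCoeff (u : L2Circle)
    (hu : Summable fun j => ‖fourierCoeff u j‖) :
    ∃ g : C(UnitAddCircle, ℂ), (∀ᵐ x : ℝ ∂intervalMeasure, u (x : UnitAddCircle) = g x) ∧
      ∀ x : ℝ, HasSum (fun j => fourierCoeff u j * wave (2 * j) x) (g x) := by
  have h1 : Summable fun j => fourierCoeff u j • (fourier j : C(UnitAddCircle, ℂ)) := by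
    refine Summable.of_norm ?_
    simpa only [norm_smul, fourier_norm, mul_one] using hu
  have h2 := h1.hasSum
  refine ⟨∑' j, fourierCoeff u j • (fourier j : C(UnitAddCircle, ℂ)), ?_, fun x => ?_⟩
  · set g : C(UnitAddCircle, ℂ) := ∑' j, fourierCoeff u j • (fourier j : C(UnitAddCircle, ℂ))
    let T : C(UnitAddCircle, ℂ) →L[ℂ] L2Circle := ContinuousMap.toLp 2 AddCircle.haarAddCircle ℂ
    have h3 := h2.mapL T
    simp only [map_smul] at h3
    have h4 : u = T g := (hasSum_fourier_series_L2 u).unique h3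
    refine ae_interval_of_ae_circle (P := fun y => u y = g y) ?_
    have h5 : (T g : UnitAddCircle → ℂ) =ᵐ[AddCircle.haarAddCircle] g :=
      ContinuousMap.coeFn_toLp _ _
    rwa [← h4] at h5
  · let T : C(UnitAddCircle, ℂ) →L[ℂ] ℂ := ContinuousMap.evalCLM ℂ (x : UnitAddCircle)
    have h3 := h2.mapL T
    refine h3.congr_fun fun j => ?_
    change _ = fourierCoeff u j • fourier j (x : UnitAddCircle)
    rw [fourier_coe_eq_wave, smul_eq_mul]

/-- Absolute summability replaces u by a continuous function, so the product stays in L² and the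
series may be integrated term by term. Only even shifts 2j occur, because u has period one on an
interval of length two. -/
theorem exists_mul_potential (u : L2Circle) (hu : Summable fun j => ‖fourierCoeff u j‖)
    (f : L2Interval) : ∃ h : L2Interval,
      (∀ᵐ x : ℝ ∂intervalMeasure, h x = u (x : UnitAddCircle) * f x) ∧
      ∀ m : ℤ, HasSum (fun j => fourierCoeff u j * fourierInt f (m - 2 * j)) (fourierInt h m) := by
  obtain ⟨g, hg, hsum⟩ := exists_continuous_of_summable_fourierCoeff u hu
  have hL : MemLp (fun x : ℝ => g (x : UnitAddCircle) * f x) 2 intervalMeasure := by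
    have hgm : MemLp (fun x : ℝ => g (x : UnitAddCircle)) ⊤ intervalMeasure := by
      refine memLp_top_of_bound ?_ ‖g‖ (Filter.Eventually.of_forall fun x => g.norm_coe_le_norm _)
      exact (g.continuous.comp (AddCircle.continuous_mk' 1)).aestronglyMeasurable
    exact (Lp.memLp f).mul hgm
  refine ⟨hL.toLp _, ?_, fun m => ?_⟩
  · filter_upwards [hL.coeFn_toLp, hg] with x h1 h2
    rw [h1, h2]
  · rw [fourierInt_congr hL.coeFn_toLp]
    have hF : ∀ j : ℤ, ∀ x : ℝ, wave (-m) x * (fourierCoeff u j * wave (2 * j) x * f x) =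
        fourierCoeff u j * (wave (-(m - 2 * j)) x * f x) := by
      intro j x
      rw [show -(m - 2 * j) = -m + 2 * j by ring, wave_add]
      ring
    have key := hasSum_integral_of_summable_integral_norm (μ := intervalMeasure)
      (F := fun (j : ℤ) (x : ℝ) => wave (-m) x * (fourierCoeff u j * wave (2 * j) x * f x)) ?_ ?_
    · have e : ∀ x : ℝ, ∑' j, wave (-m) x * (fourierCoeff u j * wave (2 * j) x * f x) =
          wave (-m) x * (g (x : UnitAddCircle) * f x) := fun x =>
        (((hsum x).mul_right (f x)).mul_left (wave (-m) x)).tsum_eq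
      simp only [e] at key
      refine key.congr_fun fun j => ?_
      simp only [hF]
      rw [integral_const_mul]
      rfl
    · intro j
      simp only [hF]
      exact (integrable_wave_mul (integrable_L2Interval f) _).const_mul _
    · have e : ∀ j : ℤ, ∫ x, ‖wave (-m) x * (fourierCoeff u j * wave (2 * j) x * f x)‖
          ∂intervalMeasure = ‖fourierCoeff u j‖ * ∫ x, ‖f x‖ ∂intervalMeasure := by
        intro j
        rw [← integral_const_mul]
        congr 1
        ext1 x
        rw [norm_mul, norm_mul, norm_mul, norm_wave, norm_wave, one_mul, mul_one]
      simp only [e]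
      exact hu.mul_right _

/-- The sequence supported on the even integers with `2n ↦ c n`. -/
def evenExt (c : ℤ → ℂ) (j : ℤ) : ℂ := if Even j then c (j / 2) else 0

theorem evenExt_two_mul (c : ℤ → ℂ) (n : ℤ) : evenExt c (2 * n) = c n := by
  rw [evenExt, if_pos (even_two_mul n)]
  congr 1
  omega

theorem evenExt_of_not_even (c : ℤ → ℂ) {j : ℤ} (h : ¬ Even j) : evenExt c j = 0 := if_neg h

theorem hasSum_evenExt_iff {c : ℤ → ℂ} {G : ℤ → ℝ} (hG : ∀ j, evenExt c j = 0 → G j = 0) {a : ℝ} :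
    HasSum (fun n => G (2 * n)) a ↔ HasSum G a := by
  refine Function.Injective.hasSum_iff (g := fun n : ℤ => 2 * n) (f := G)
    (fun x y h => by simpa using h) fun j hj => hG j (evenExt_of_not_even c fun h => hj ?_)
  obtain ⟨n, rfl⟩ := h.exists_two_nsmul
  exact ⟨n, by simp⟩

/-- Numbering the first component by frequency -k turns the convolution into a Hankel sum, through
2j = m + k. -/
theorem hasSum_evenExt_plus {c : ℤ → ℂ} {F : ℤ → ℂ} {m : ℤ} {a : ℂ}
    (h : HasSum (fun j => c j * F (m - 2 * j)) a) :
    HasSum (fun k => evenExt c (m + k) * F (-k)) a := by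
  refine (Function.Injective.hasSum_iff (g := fun n : ℤ => 2 * n - m) ?_ ?_).1
    (h.congr_fun fun j => ?_)
  · intro x y h
    have : 2 * x - m = 2 * y - m := h
    omega
  · intro k hk
    rw [evenExt_of_not_even, zero_mul]
    rintro ⟨n, hn⟩
    exact hk ⟨n, by change 2 * n - m = k; omega⟩
  · change evenExt c (m + (2 * j - m)) * F (-(2 * j - m)) = _
    rw [show m + (2 * j - m) = 2 * j by ring, evenExt_two_mul, neg_sub]

theorem hasSum_evenExt_minus {c : ℤ → ℂ} {F : ℤ → ℂ} {m : ℤ} {a : ℂ}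
    (h : HasSum (fun j => c j * F (-m - 2 * j)) a) :
    HasSum (fun k => evenExt (fun n => c (-n)) (m + k) * F k) a := by
  refine (Function.Injective.hasSum_iff (g := fun n : ℤ => -m - 2 * n) ?_ ?_).1
    (h.congr_fun fun j => ?_)
  · intro x y h
    have : -m - 2 * x = -m - 2 * y := h
    omega
  · intro k hk
    rw [evenExt_of_not_even, zero_mul]
    rintro ⟨n, hn⟩
    exact hk ⟨-n, by change -m - 2 * (-n) = k; omega⟩
  · change evenExt (fun n => c (-n)) (m + (-m - 2 * j)) * F (-m - 2 * j) = _
    rw [show m + (-m - 2 * j) = 2 * (-j) by ring, evenExt_two_mul, neg_neg]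

/-- The coefficients of `φ₋` with respect to `e^{-iπjx}`, `j ∈ ℤ`. -/
def minusSeq (φ : Potential) : ℤ → ℂ := evenExt (coeffMinus φ)

/-- The coefficients of `φ₊` with respect to `e^{iπjx}`, `j ∈ ℤ`. -/
def plusSeq (φ : Potential) : ℤ → ℂ := evenExt (coeffPlus φ)

theorem bracket_two_mul_pi (n : ℤ) : bracket (2 * n * Real.pi) = weight (2 * n) := by
  rw [bracket, weight, abs_mul, abs_of_pos Real.pi_pos, mul_comm Real.pi]
  push_cast
  rfl

theorem weightedBound_evenExt {c : ℤ → ℂ} {S : ℝ} (hS : 0 ≤ S)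
    (h : HasSum (fun n : ℤ => (weight (2 * n) * ‖c n‖) ^ 2) S) :
    WeightedBound (evenExt c) (Real.sqrt S) := by
  refine ⟨Real.sqrt_nonneg _, fun s => ?_⟩
  rw [Real.sq_sqrt hS]
  refine sum_le_hasSum s (fun j _ => sq_nonneg _)
    ((hasSum_evenExt_iff (c := c) (G := fun j => (weight j * ‖evenExt c j‖) ^ 2) ?_).1 ?_)
  · intro j hj
    rw [hj]
    simp
  · simpa only [evenExt_two_mul] using h

theorem exists_weightedBound {φ : Potential} (hφ : MemH1 φ) : ∃ α β : ℝ,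
    WeightedBound (minusSeq φ) α ∧ WeightedBound (plusSeq φ) β ∧
      α ^ 2 + β ^ 2 = h1Norm φ ^ 2 := by
  have e : ∀ n : ℤ, h1Term φ n =
      (weight (2 * n) * ‖coeffMinus φ n‖) ^ 2 + (weight (2 * n) * ‖coeffPlus φ n‖) ^ 2 := by
    intro n
    rw [h1Term, bracket_two_mul_pi]
    ring
  have h1 : Summable fun n : ℤ => (weight (2 * n) * ‖coeffMinus φ n‖) ^ 2 :=
    Summable.of_nonneg_of_le (fun n => sq_nonneg _)
      (fun n => by rw [e]; exact le_add_of_nonneg_right (sq_nonneg _)) hφ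
  have h2 : Summable fun n : ℤ => (weight (2 * n) * ‖coeffPlus φ n‖) ^ 2 :=
    Summable.of_nonneg_of_le (fun n => sq_nonneg _)
      (fun n => by rw [e]; exact le_add_of_nonneg_left (sq_nonneg _)) hφ
  have n1 := h1.hasSum.nonneg fun n => sq_nonneg _
  have n2 := h2.hasSum.nonneg fun n => sq_nonneg _
  refine ⟨_, _, weightedBound_evenExt n1 h1.hasSum, weightedBound_evenExt n2 h2.hasSum, ?_⟩
  rw [Real.sq_sqrt n1, Real.sq_sqrt n2, h1Norm, Real.sq_sqrt, ← h1.tsum_add h2]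
  · simp only [e]
  · refine tsum_nonneg fun n => ?_
    rw [e]
    positivity

theorem summable_norm_of_evenExt {c : ℤ → ℂ} (h : Summable fun j => ‖evenExt c j‖) :
    Summable fun n => ‖c n‖ := by
  have := h.comp_injective (i := fun n : ℤ => 2 * n) (fun x y h => by simpa using h)
  refine this.congr fun n => ?_
  simp [evenExt_two_mul]

/-- Fourier coordinates on `L²([0, 2], ℂ²)`, in which the free operator is `diag(mπ)`. -/
def stateEquiv : StateSpace ≃ₗ[ℂ] SeqSpace × SeqSpace :=
  (fourierEquiv (Equiv.neg ℤ)).prodCongr (fourierEquiv (Equiv.refl ℤ))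

theorem stateEquiv_fst (f : StateSpace) (m : ℤ) :
    (stateEquiv f).1 m = ((Real.sqrt 2)⁻¹ : ℂ) * fourierInt f.1 (-m) :=
  fourierEquiv_apply _ _ _

theorem stateEquiv_snd (f : StateSpace) (m : ℤ) :
    (stateEquiv f).2 m = ((Real.sqrt 2)⁻¹ : ℂ) * fourierInt f.2 m :=
  fourierEquiv_apply _ _ _

theorem fourierInt_smul_sub (a : ℂ) (g h : L2Interval) (m : ℤ) :
    fourierInt (a • (g - h) : L2Interval) m = a * (fourierInt g m - fourierInt h m) := by
  have e := fourierEquiv_apply (Equiv.refl ℤ) (a • (g - h)) m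
  rw [map_smul, map_sub] at e
  have e2 : (a • (fourierEquiv (Equiv.refl ℤ) g - fourierEquiv (Equiv.refl ℤ) h)) m =
      a * (fourierEquiv (Equiv.refl ℤ) g m - fourierEquiv (Equiv.refl ℤ) h m) := rfl
  rw [e2, fourierEquiv_apply, fourierEquiv_apply] at e
  refine mul_left_cancel₀ sqrt_two_inv_ne_zero (e.symm.trans ?_)
  simp only [Equiv.refl_apply]
  ring

/-- The equations determine the derivatives, f₋' = -i(g₋ - φ₋f₊) and f₊' = i(g₊ - φ₊f₋), so the
existential over them disappears. -/
theorem mem_zsGraph_iff_of_ae {φ : Potential} {f g : StateSpace} {h₁ h₂ : L2Interval}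
    (H₁ : ∀ᵐ x : ℝ ∂intervalMeasure, h₁ x = φ.1 (x : UnitAddCircle) * f.2 x)
    (H₂ : ∀ᵐ x : ℝ ∂intervalMeasure, h₂ x = φ.2 (x : UnitAddCircle) * f.1 x) :
    (f, g) ∈ zsGraph φ ↔
      IsPeriodicDeriv f.1 (-I • (g.1 - h₁)) ∧ IsPeriodicDeriv f.2 (I • (g.2 - h₂)) := by
  have I2 := Complex.I_mul_I
  constructor
  · rintro ⟨d, k1, k2, k3, k4⟩
    have e1 : -I • (g.1 - h₁) = d.1 := by
      refine Lp.ext ?_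
      filter_upwards [Lp.coeFn_smul (-I) (g.1 - h₁), Lp.coeFn_sub g.1 h₁, H₁, k3] with x a1 a2 a3 a4
      rw [a1, Pi.smul_apply, a2, Pi.sub_apply, a3, a4, smul_eq_mul]
      linear_combination -d.1 x * I2
    have e2 : I • (g.2 - h₂) = d.2 := by
      refine Lp.ext ?_
      filter_upwards [Lp.coeFn_smul I (g.2 - h₂), Lp.coeFn_sub g.2 h₂, H₂, k4] with x a1 a2 a3 a4
      rw [a1, Pi.smul_apply, a2, Pi.sub_apply, a3, a4, smul_eq_mul]
      linear_combination -d.2 x * I2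
    rw [e1, e2]
    exact ⟨k1, k2⟩
  · rintro ⟨k1, k2⟩
    refine ⟨(-I • (g.1 - h₁), I • (g.2 - h₂)), k1, k2, ?_, ?_⟩
    · filter_upwards [Lp.coeFn_smul (-I) (g.1 - h₁), Lp.coeFn_sub g.1 h₁, H₁] with x a1 a2 a3
      rw [a1, Pi.smul_apply, a2, Pi.sub_apply, ← a3, smul_eq_mul]
      linear_combination (g.1 x - h₁ x) * I2
    · filter_upwards [Lp.coeFn_smul I (g.2 - h₂), Lp.coeFn_sub g.2 h₂, H₂] with x a1 a2 a3
      rw [a1, Pi.smul_apply, a2, Pi.sub_apply, ← a3, smul_eq_mul]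
      linear_combination (g.2 x - h₂ x) * I2

/-- The opposite signs ±i d/dx are matched by the opposite frequencies of the components, so that
the free part is diag(mπ) on both. -/
theorem mem_zsGraph_iff {φ : Potential} (hp : Summable fun j => ‖minusSeq φ j‖)
    (hq : Summable fun j => ‖plusSeq φ j‖) {f g : StateSpace} :
    (f, g) ∈ zsGraph φ ↔
      (∀ m : ℤ, (stateEquiv g).1 m =
        m * Real.pi * (stateEquiv f).1 m + hankelOp (minusSeq φ) (stateEquiv f).2 m) ∧
      ∀ m : ℤ, (stateEquiv g).2 m =
        m * Real.pi * (stateEquiv f).2 m + hankelOp (plusSeq φ) (stateEquiv f).1 m := by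
  have hu1 : Summable fun j => ‖fourierCoeff φ.1 j‖ := by
    have := (summable_norm_of_evenExt hp).comp_injective neg_injective
    refine this.congr fun n => ?_
    simp [coeffMinus]
  obtain ⟨h₁, H₁, S₁⟩ := exists_mul_potential φ.1 hu1 f.2
  obtain ⟨h₂, H₂, S₂⟩ := exists_mul_potential φ.2 (summable_norm_of_evenExt hq) f.1
  have T₁ : ∀ m : ℤ, hankelOp (minusSeq φ) (stateEquiv f).2 m =
      ((Real.sqrt 2)⁻¹ : ℂ) * fourierInt h₁ (-m) := by
    intro m
    refine (hasSum_hankelOp hp _ m).unique ?_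
    refine ((hasSum_evenExt_minus (S₁ (-m))).mul_left ((Real.sqrt 2)⁻¹ : ℂ)).congr_fun fun k => ?_
    rw [stateEquiv_snd]
    change minusSeq φ (m + k) * _ = _ * (minusSeq φ (m + k) * _)
    ring
  have T₂ : ∀ m : ℤ, hankelOp (plusSeq φ) (stateEquiv f).1 m =
      ((Real.sqrt 2)⁻¹ : ℂ) * fourierInt h₂ m := by
    intro m
    refine (hasSum_hankelOp hq _ m).unique ?_
    refine ((hasSum_evenExt_plus (S₂ m)).mul_left ((Real.sqrt 2)⁻¹ : ℂ)).congr_fun fun k => ?_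
    rw [stateEquiv_fst]
    change plusSeq φ (m + k) * _ = _ * (plusSeq φ (m + k) * _)
    ring
  have I2 := Complex.I_mul_I
  rw [mem_zsGraph_iff_of_ae H₁ H₂, isPeriodicDeriv_iff, isPeriodicDeriv_iff]
  simp only [fourierInt_smul_sub]
  refine and_congr ?_ ?_
  · refine (neg_surjective (G := ℤ)).forall.trans (forall_congr' fun m => ?_)
    rw [T₁, stateEquiv_fst, stateEquiv_fst]
    constructor
    · intro h
      have h' : -I * (fourierInt g.1 (-m) - fourierInt h₁ (-m)) =
        I * Real.pi * ((-m : ℤ) : ℂ) * fourierInt f.1 (-m) := h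
      push_cast at h'
      refine mul_left_cancel₀ I_ne_zero ?_
      linear_combination (-((Real.sqrt 2)⁻¹ : ℂ)) * h'
    · intro h
      refine mul_left_cancel₀ sqrt_two_inv_ne_zero ?_
      change _ * (-I * (fourierInt g.1 (-m) - fourierInt h₁ (-m))) =
        _ * (I * Real.pi * ((-m : ℤ) : ℂ) * fourierInt f.1 (-m))
      push_cast
      linear_combination (-I) * h
  · refine forall_congr' fun m => ?_
    rw [T₂, stateEquiv_snd, stateEquiv_snd]
    constructor
    · intro h
      refine mul_left_cancel₀ I_ne_zero ?_
      linear_combination ((Real.sqrt 2)⁻¹ : ℂ) * h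
    · intro h
      refine mul_left_cancel₀ sqrt_two_inv_ne_zero ?_
      linear_combination I * h

theorem mem_kerPow_succ {H : Type*} [AddCommGroup H] [Module ℂ H] (T : H →ₗ.[ℂ] H) (z : ℂ) (k : ℕ)
    (f : H) : f ∈ kerPow T z (k + 1) ↔ ∃ g, (f, g) ∈ T.graph ∧ g - z • f ∈ kerPow T z k := by
  rw [kerPow, Submodule.mem_map]
  constructor
  · rintro ⟨x, hx, rfl⟩
    exact ⟨T x, T.mem_graph x, hx⟩
  · rintro ⟨g, hg, hk⟩
    obtain ⟨x, rfl, rfl⟩ := (LinearPMap.mem_graph_iff T).1 hg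
    exact ⟨x, hk, rfl⟩

/-- By induction: g = L(φ)f holds exactly when J(z)f = B(zf - g) in coordinates, domain condition
included. The chains use L - z on one side and z - L on the other, a sign which subspaces ignore. -/
theorem mem_kerPow_iff {φ : Potential} (hp : Summable fun j => ‖minusSeq φ j‖)
    (hq : Summable fun j => ‖plusSeq φ j‖) (z : ℂ) (k : ℕ) (f : StateSpace) :
    f ∈ kerPow (zsOperator φ) z k ↔
      stateEquiv f ∈ rootChain baseOp (potentialOp (minusSeq φ) (plusSeq φ)) z k := by
  induction k generalizing f with
  | zero =>
    change f ∈ (⊥ : Submodule ℂ StateSpace) ↔ stateEquiv f ∈ (⊥ : Submodule ℂ _)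
    rw [Submodule.mem_bot, Submodule.mem_bot, LinearEquiv.map_eq_zero_iff]
  | succ k ih =>
    rw [mem_kerPow_succ, mem_rootChain_succ, zsOperator_graph]
    have hrel : ∀ g : StateSpace, (f, g) ∈ zsGraph φ ↔
        pencil baseOp (potentialOp (minusSeq φ) (plusSeq φ)) z (stateEquiv f) =
          baseOp (stateEquiv (z • f - g)) := by
      intro g
      rw [mem_zsGraph_iff hp hq, pencil_apply_eq_iff, map_sub, map_smul]
      refine and_congr (forall_congr' fun m => ?_) (forall_congr' fun m => ?_)
      · change _ ↔ _ = _ + (z * (stateEquiv f).1 m - (stateEquiv g).1 m)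
        constructor <;> intro h <;> linear_combination h
      · change _ ↔ _ = _ + (z * (stateEquiv f).2 m - (stateEquiv g).2 m)
        constructor <;> intro h <;> linear_combination h
    constructor
    · rintro ⟨g, hg, hk⟩
      refine ⟨stateEquiv (z • f - g), (ih _).1 ?_, ((hrel g).1 hg).symm⟩
      rw [← neg_sub]
      exact neg_mem hk
    · rintro ⟨y, hy, he⟩
      refine ⟨z • f - stateEquiv.symm y, (hrel _).2 ?_, ?_⟩
      · rw [sub_sub_cancel, LinearEquiv.apply_symm_apply, he]
      · rw [ih, sub_sub_cancel_left, map_neg, LinearEquiv.apply_symm_apply]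
        exact neg_mem hy

theorem algMult_zsOperator {φ : Potential} (hp : Summable fun j => ‖minusSeq φ j‖)
    (hq : Summable fun j => ‖plusSeq φ j‖) (z : ℂ) :
    algMult (zsOperator φ) z = Cardinal.toENat (Module.rank ℂ
      (⨆ k, rootChain baseOp (potentialOp (minusSeq φ) (plusSeq φ)) z k :
        Submodule ℂ (SeqSpace × SeqSpace))) := by
  have h : ∀ k, (kerPow (zsOperator φ) z k).map
      (stateEquiv : StateSpace →ₗ[ℂ] SeqSpace × SeqSpace) =
      rootChain baseOp (potentialOp (minusSeq φ) (plusSeq φ)) z k := by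
    intro k
    ext x
    rw [Submodule.mem_map]
    constructor
    · rintro ⟨f, hf, rfl⟩
      exact (mem_kerPow_iff hp hq z k f).1 hf
    · intro hx
      exact ⟨stateEquiv.symm x, (mem_kerPow_iff hp hq z k _).2 (by simpa using hx), by simp⟩
  have h2 : (⨆ k, kerPow (zsOperator φ) z k).map
      (stateEquiv : StateSpace →ₗ[ℂ] SeqSpace × SeqSpace) =
      ⨆ k, rootChain baseOp (potentialOp (minusSeq φ) (plusSeq φ)) z k := by
    rw [Submodule.map_iSup]
    simp only [h]
  rw [algMult, ← h2]
  congr 1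
  exact (stateEquiv.submoduleMap (⨆ k, kerPow (zsOperator φ) z k)).rank_eq

end FourierPotential

/-! ### Counting eigenvalues in discs -/

noncomputable section Spectrum

variable {p q : ℤ → ℂ} {α β : ℝ}

/-- The dimension of the root space at `z`, in Fourier coordinates. -/
def rootMult (p q : ℤ → ℂ) (z : ℂ) : ℕ∞ :=
  Cardinal.toENat (Module.rank ℂ
    (⨆ k, rootChain baseOp (potentialOp p q) z k : Submodule ℂ (SeqSpace × SeqSpace)))

theorem not_isUnit_of_rootMult_ne_zero {z : ℂ} (h : rootMult p q z ≠ 0) :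
    ¬ IsUnit (pencil baseOp (potentialOp p q) z) := by
  intro hu
  apply h
  have hinj : Function.Injective (pencil baseOp (potentialOp p q) z) := by
    intro x y hxy
    have e : ∀ x, Ring.inverse (pencil baseOp (potentialOp p q) z)
        (pencil baseOp (potentialOp p q) z x) = x := fun x =>
      DFunLike.congr_fun (Ring.inverse_mul_cancel _ hu) x
    rw [← e x, hxy, e y]
  have hb : (⨆ k, rootChain baseOp (potentialOp p q) z k :
      Submodule ℂ (SeqSpace × SeqSpace)) = ⊥ := by
    rw [iSup_eq_bot]
    exact rootChain_eq_bot hinj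
  rw [rootMult, hb, rank_bot, map_zero]

theorem exists_eigenvector_of_not_isUnit {z : ℂ}
    (h : ¬ IsUnit (pencil baseOp (potentialOp p q) z)) : ∃ a b : SeqSpace, (a, b) ≠ 0 ∧
      (∀ m : ℤ, (z - m * Real.pi) * a m = hankelOp p b m) ∧
      ∀ m : ℤ, (z - m * Real.pi) * b m = hankelOp q a m := by
  have h1 : ¬ Function.Injective (pencil baseOp (potentialOp p q) z) := fun hi =>
    h (isUnit_pencil_of_injective isCompactOperator_baseOp hi)
  rw [injective_iff_map_eq_zero] at h1
  push Not at h1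
  obtain ⟨⟨a, b⟩, hx, hne⟩ := h1
  rw [← map_zero baseOp, pencil_apply_eq_iff] at hx
  refine ⟨a, b, hne, fun m => (hx.1 m).trans (add_zero _), fun m => (hx.2 m).trans (add_zero _)⟩

theorem norm_sub_le_of_not_isUnit (hp : WeightedBound p α) (hq : WeightedBound q β) {n : ℤ} {z : ℂ}
    (hn : 8 * (α ^ 2 + β ^ 2) ≤ bracket n) (hz : |z.re - n * Real.pi| ≤ Real.pi / 2)
    (h : ¬ IsUnit (pencil baseOp (potentialOp p q) z)) :
    ‖z - n * Real.pi‖ ≤ (α ^ 2 + β ^ 2) / bracket n +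
      Real.sqrt 2 * Real.sqrt (α ^ 2 + β ^ 2) / bracket (2 * n) := by
  obtain ⟨a, b, hab, ha, hb⟩ := exists_eigenvector_of_not_isUnit h
  exact norm_sub_le_of_eigenvector hp hq hn hz hab ha hb

theorem abs_im_le_of_not_isUnit (hp : WeightedBound p α) (hq : WeightedBound q β) {z : ℂ}
    (h : ¬ IsUnit (pencil baseOp (potentialOp p q) z)) :
    |z.im| ≤ Real.sqrt (α ^ 2 + β ^ 2) := by
  obtain ⟨a, b, hab, ha, hb⟩ := exists_eigenvector_of_not_isUnit h
  exact abs_im_le_of_eigenvector hp hq hab ha hb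

/-- From 8s ≤ ⟨n⟩ the first term is at most 1/8. The second is at most √(⟨n⟩/4)/⟨2n⟩ ≤ 1/2, since 1
≤ ⟨n⟩ ≤ ⟨2n⟩. The value 5/8 lies below both 1 and π/5. -/
theorem localization_radius_le {s : ℝ} (hs : 0 ≤ s) {n : ℤ} (hn : 8 * s ≤ bracket n) :
    s / bracket n + Real.sqrt 2 * Real.sqrt s / bracket (2 * n) ≤ 5 / 8 := by
  have h1 : 1 ≤ bracket n := by
    unfold bracket
    linarith [abs_nonneg (n : ℝ)]
  have h2 : bracket n ≤ bracket (2 * n) := by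
    unfold bracket
    rw [abs_mul, abs_two]
    linarith [abs_nonneg (n : ℝ)]
  have h3 : s / bracket n ≤ 1 / 8 := by
    rw [div_le_iff₀ (by linarith)]
    linarith
  have h4 : Real.sqrt 2 * Real.sqrt s ≤ 1 / 2 * bracket (2 * n) := by
    rw [← Real.sqrt_mul (by norm_num), Real.sqrt_le_left (by linarith)]
    nlinarith
  have h5 : Real.sqrt 2 * Real.sqrt s / bracket (2 * n) ≤ 1 / 2 := by
    rw [div_le_iff₀ (by linarith)]
    exact h4
  linarith

theorem norm_sub_le_five_eighths_of_not_isUnit (hp : WeightedBound p α) (hq : WeightedBound q β)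
    {n : ℤ} {z : ℂ} (hn : 8 * (α ^ 2 + β ^ 2) ≤ bracket n) (hz : |z.re - n * Real.pi| ≤ Real.pi / 2)
    (h : ¬ IsUnit (pencil baseOp (potentialOp p q) z)) : ‖z - n * Real.pi‖ ≤ 5 / 8 :=
  (norm_sub_le_of_not_isUnit hp hq hn hz h).trans (localization_radius_le (by positivity) hn)

/-- An eigenvalue beyond the vertical lines `|Re z| = (k + 1/2)π` is close to some `mπ`. -/
theorem exists_near_of_lt_abs_re (hp : WeightedBound p α) (hq : WeightedBound q β) {k : ℕ}
    (hk : 8 * (α ^ 2 + β ^ 2) ≤ k + 2) {z : ℂ} (hz : (k + 1 / 2) * Real.pi < |z.re|)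
    (h : ¬ IsUnit (pencil baseOp (potentialOp p q) z)) :
    ∃ m : ℤ, k + 1 ≤ m.natAbs ∧ ‖z - m * Real.pi‖ < 1 := by
  have hpi := Real.pi_pos
  -- The nearest multiple of π puts z in the strip of m. The bound on Re z forces |m| ≥ k + 1, hence
  -- ⟨m⟩ ≥ k + 2, as the strip estimate requires.
  set m : ℤ := round (z.re / Real.pi) with hm
  have h1 : |z.re - m * Real.pi| ≤ Real.pi / 2 := by
    have h2 := abs_sub_round (z.re / Real.pi)
    rw [← hm] at h2
    have h3 : z.re - m * Real.pi = (z.re / Real.pi - m) * Real.pi := by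
      field_simp
    rw [h3, abs_mul, abs_of_pos hpi]
    nlinarith
  have h2 : (k : ℝ) < |(m : ℝ)| := by
    have h3 : |z.re| ≤ |z.re - m * Real.pi| + |m * Real.pi| := by
      simpa using abs_add_le (z.re - m * Real.pi) (m * Real.pi)
    rw [abs_mul (m : ℝ), abs_of_pos hpi] at h3
    nlinarith
  have h3 : k + 1 ≤ m.natAbs := by
    rw [← Int.cast_abs, Int.abs_eq_natAbs] at h2
    have h4 : k < m.natAbs := by exact_mod_cast h2
    exact h4
  have h4 : (k : ℝ) + 1 ≤ |(m : ℝ)| := by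
    rw [← Int.cast_abs, Int.abs_eq_natAbs]
    exact_mod_cast h3
  refine ⟨m, h3, (norm_sub_le_five_eighths_of_not_isUnit hp hq ?_ h1 h).trans_lt (by norm_num)⟩
  unfold bracket
  linarith

/-- Radii of circles that separate the eigenvalues. -/
def cutRadius (k : ℕ) : ℝ := (k + 1 / 2) * Real.pi + 1 / 4

theorem cutRadius_pos (k : ℕ) : 0 < cutRadius k := by
  have := Real.pi_pos
  unfold cutRadius
  positivity

theorem cutRadius_lt_norm {k : ℕ} {m : ℤ} {z : ℂ} (hm : k + 1 ≤ m.natAbs)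
    (hz : ‖z - m * Real.pi‖ < 1) : cutRadius k < ‖z‖ := by
  have h1 : ‖(m * Real.pi : ℂ)‖ ≤ ‖z‖ + ‖z - m * Real.pi‖ := by
    have := norm_sub_le z (z - m * Real.pi)
    rwa [sub_sub_cancel] at this
  have hpi := Real.pi_gt_three
  rw [norm_mul, Complex.norm_real, Complex.norm_intCast, Real.norm_of_nonneg Real.pi_pos.le] at h1
  have h2 : (k : ℝ) + 1 ≤ |(m : ℝ)| := by
    rw [← Int.cast_abs, Int.abs_eq_natAbs]
    exact_mod_cast hm
  unfold cutRadius
  nlinarith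

theorem norm_lt_cutRadius {m : ℤ} {z : ℂ} (hz : ‖z - m * Real.pi‖ < 1) :
    ‖z‖ < cutRadius m.natAbs := by
  have h1 : ‖z‖ ≤ ‖z - m * Real.pi‖ + ‖(m * Real.pi : ℂ)‖ := by
    have := norm_add_le (z - m * Real.pi) (m * Real.pi)
    rwa [sub_add_cancel] at this
  have hpi := Real.pi_gt_three
  rw [norm_mul, Complex.norm_real, Complex.norm_intCast, Real.norm_of_nonneg Real.pi_pos.le] at h1
  have h2 : |(m : ℝ)| = (m.natAbs : ℝ) := by
    rw [← Int.cast_abs, Int.abs_eq_natAbs, Int.cast_natCast]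
  rw [h2] at h1
  unfold cutRadius
  linarith

theorem eq_of_norm_sub_lt_one {m n : ℤ} {z : ℂ} (hm : ‖z - m * Real.pi‖ < 1)
    (hn : ‖z - n * Real.pi‖ < 1) : m = n := by
  by_contra hne
  have h1 : ‖((m - n : ℤ) * Real.pi : ℂ)‖ < 2 := by
    have e : ((m - n : ℤ) * Real.pi : ℂ) = (z - n * Real.pi) - (z - m * Real.pi) := by
      push_cast
      ring
    rw [e]
    refine (norm_sub_le _ _).trans_lt ?_
    linarith
  have hpi := Real.pi_gt_three
  rw [norm_mul, Complex.norm_real, Complex.norm_intCast, Real.norm_of_nonneg Real.pi_pos.le] at h1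
  have h2 : (1 : ℝ) ≤ |((m - n : ℤ) : ℝ)| := by
    rw [← Int.cast_abs]
    exact_mod_cast Int.one_le_abs (sub_ne_zero.2 hne)
  nlinarith

/-- Purpose of the extra 1/4 in the radius: a point outside the circle but with |Re z| ≤ (k + 1/2)π
would have |Im z|² at least (k + 1/2)π/2 + 1/16, more than the (k + 2)/8 allowed by the bound on
imaginary parts. -/
theorem exists_near_of_cutRadius_le (hp : WeightedBound p α) (hq : WeightedBound q β) {k : ℕ}
    (hk : 8 * (α ^ 2 + β ^ 2) ≤ k + 2) {z : ℂ} (hz : cutRadius k ≤ ‖z‖)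
    (h : ¬ IsUnit (pencil baseOp (potentialOp p q) z)) :
    ∃ m : ℤ, k + 1 ≤ m.natAbs ∧ ‖z - m * Real.pi‖ < 1 := by
  refine exists_near_of_lt_abs_re hp hq hk ?_ h
  by_contra! hre
  have h1 : |z.im| ^ 2 ≤ α ^ 2 + β ^ 2 :=
    (Real.le_sqrt (abs_nonneg _) (by positivity)).1 (abs_im_le_of_not_isUnit hp hq h)
  have h2 : cutRadius k ^ 2 ≤ ‖z‖ ^ 2 := pow_le_pow_left₀ (cutRadius_pos k).le hz 2
  rw [Complex.sq_norm, Complex.normSq_apply] at h2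
  have h3 := pow_le_pow_left₀ (abs_nonneg _) hre 2
  rw [sq_abs] at h1 h3
  have hpi := Real.pi_gt_three
  have hk0 : (0 : ℝ) ≤ k := Nat.cast_nonneg k
  unfold cutRadius at h2
  nlinarith

/-- The circle avoids the spectrum for the whole family tφ, so the rank of the Riesz projection
equals its value at t = 0, twice the number of mπ in the disc. -/
theorem exists_multiset_of_isUnit {c : ℂ} {r : ℝ} (hr : 0 < r)
    (hS : ∀ t ∈ Icc (0 : ℝ) 1, ∀ z ∈ sphere c r,
      IsUnit (pencil baseOp (potentialOp ((t : ℂ) • p) ((t : ℂ) • q)) z))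
    {F : Finset ℤ} (hF : ∀ m : ℤ, m ∈ F ↔ (m * Real.pi : ℂ) ∈ ball c r) :
    ∃ S : Multiset ℂ, S.card = 2 * F.card ∧ (∀ z ∈ S, z ∈ ball c r) ∧
      ∀ z ∈ ball c r, rootMult p q z = S.count z := by
  simp only [potentialOp_smul] at hS
  have hS0 : ∀ z ∈ sphere c r, IsUnit (pencil baseOp 0 z) := by
    intro z hz
    have := hS 0 (by simp) z hz
    rwa [Complex.ofReal_zero, zero_smul] at this
  have hS1 : ∀ z ∈ sphere c r, IsUnit (pencil baseOp (potentialOp p q) z) := by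
    intro z hz
    have := hS 1 (by simp) z hz
    rwa [Complex.ofReal_one, one_smul] at this
  obtain ⟨f0, c0⟩ := finrank_range_rieszProj_zero hr hS0 hF
  obtain ⟨f1, c1⟩ := finrank_range_rieszProj_homotopy hr hS f0
  obtain ⟨S, hc, hb, hm⟩ := exists_multiset_rootChain hr baseOp_injective hS1
  refine ⟨S, ?_, hb, hm⟩
  rw [hc, ← c0]
  exact c1

theorem WeightedBound.smul_of_mem_Icc (hp : WeightedBound p α) {t : ℝ} (ht : t ∈ Icc (0 : ℝ) 1) :
    WeightedBound ((t : ℂ) • p) α :=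
  hp.smul (by rw [Complex.norm_real, Real.norm_of_nonneg ht.1]; exact ht.2)

/-- Along the homotopy, eigenvalues in the strip stay within 5/8 of nπ. The unit circle lies in the
strip, as 1 < π/2, and hence is free of them. -/
theorem exists_multiset_near (hp : WeightedBound p α) (hq : WeightedBound q β) {n : ℤ}
    (hn : 8 * (α ^ 2 + β ^ 2) ≤ bracket n) :
    ∃ S : Multiset ℂ, S.card = 2 ∧ (∀ z ∈ S, ‖z - n * Real.pi‖ < 1) ∧
      ∀ z : ℂ, ‖z - n * Real.pi‖ < 1 → rootMult p q z = S.count z := by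
  have h := exists_multiset_of_isUnit (p := p) (q := q) (c := n * Real.pi) one_pos ?_
    (F := {n}) fun m => ?_
  · simpa only [Finset.card_singleton, mul_one, mem_ball, dist_eq_norm] using h
  · intro t ht z hz
    by_contra hu
    rw [mem_sphere, dist_eq_norm] at hz
    have h1 := norm_sub_le_five_eighths_of_not_isUnit (hp.smul_of_mem_Icc ht)
      (hq.smul_of_mem_Icc ht) hn ?_ hu
    · rw [hz] at h1
      norm_num at h1
    · have h2 := Complex.abs_re_le_norm (z - n * Real.pi)
      have hpi := Real.pi_gt_three
      simp only [Complex.sub_re, Complex.mul_re, Complex.intCast_re, Complex.ofReal_re,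
        Complex.intCast_im, Complex.ofReal_im, mul_zero, sub_zero] at h2
      linarith
  · rw [Finset.mem_singleton, mem_ball, dist_eq_norm]
    constructor
    · rintro rfl
      simp
    · intro h
      exact eq_of_norm_sub_lt_one (z := m * Real.pi) (by simp) h

/-- An eigenvalue of tφ on the circle would be within 1 of some mπ with |m| ≥ k + 1, but such points
lie strictly outside, because π/2 > 5/4. -/
theorem exists_multiset_cut (hp : WeightedBound p α) (hq : WeightedBound q β) {k : ℕ}
    (hk : 8 * (α ^ 2 + β ^ 2) ≤ k + 2) :
    ∃ S : Multiset ℂ, S.card = 2 * (2 * k + 1) ∧ (∀ z ∈ S, ‖z‖ < cutRadius k) ∧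
      ∀ z : ℂ, ‖z‖ < cutRadius k → rootMult p q z = S.count z := by
  have h := exists_multiset_of_isUnit (p := p) (q := q) (c := 0) (cutRadius_pos k) ?_
    (F := Finset.Icc (-(k : ℤ)) k) fun m => ?_
  · have hc : (Finset.Icc (-(k : ℤ)) k).card = 2 * k + 1 := by
      rw [Int.card_Icc]
      omega
    simpa only [hc, mem_ball, dist_zero_right] using h
  · intro t ht z hz
    by_contra hu
    rw [mem_sphere, dist_zero_right] at hz
    obtain ⟨m, hm, hzm⟩ := exists_near_of_cutRadius_le (hp.smul_of_mem_Icc ht)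
      (hq.smul_of_mem_Icc ht) hk hz.ge hu
    exact (cutRadius_lt_norm hm hzm).ne' hz
  · rw [Finset.mem_Icc, mem_ball, dist_zero_right]
    constructor
    · intro h
      by_contra! h1
      have h2 : m.natAbs ≤ k := by omega
      have h3 : cutRadius m.natAbs ≤ cutRadius k := by
        have h4 : (m.natAbs : ℝ) ≤ k := by exact_mod_cast h2
        unfold cutRadius
        nlinarith [Real.pi_pos]
      exact absurd (norm_lt_cutRadius (m := m) (z := m * Real.pi) (by simp)) (by linarith)
    · intro h
      by_contra h1
      exact absurd (cutRadius_lt_norm (k := k) (m := m) (z := m * Real.pi) (by omega) (by simp))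
        (by linarith)

end Spectrum

/-! ### Monotone enumerations of multisets -/

section Enumeration

variable {X : Type*} [LinearOrder X]

theorem exists_enum_Icc [Inhabited X] (T : Multiset X) (a : ℤ) : ∃ f : ℤ → X,
    MonotoneOn f (Set.Icc a (a + T.card - 1)) ∧
      Multiset.map f (Finset.Icc a (a + T.card - 1)).val = T := by
  set l := T.sort (· ≤ ·) with hl
  have hlen : l.length = T.card := Multiset.length_sort _
  have hsorted : l.Pairwise (· ≤ ·) := Multiset.pairwise_sort T (· ≤ ·)
  -- The default value is taken only beyond the list; on the interval in question the index is in
  -- range.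
  refine ⟨fun j => l.getD (j - a).toNat default, ?_, ?_⟩
  · intro i hi j hj hij
    rw [Set.mem_Icc] at hi hj
    have h1 : (i - a).toNat < l.length := by omega
    have h2 : (j - a).toNat < l.length := by omega
    dsimp only
    rw [List.getD_eq_getElem _ _ h1, List.getD_eq_getElem _ _ h2]
    rcases eq_or_lt_of_le (show (i - a).toNat ≤ (j - a).toNat by omega) with h | h
    · simp only [h, le_refl]
    · exact List.pairwise_iff_getElem.1 hsorted _ _ h1 h2 h
  · obtain ⟨e, he⟩ : ∃ e : ℕ ↪ ℤ, ∀ i : ℕ, e i = a + i :=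
      ⟨⟨fun i => a + i, fun x y h => by simpa using h⟩, fun _ => rfl⟩
    have h1 : Finset.Icc a (a + T.card - 1) = (Finset.range T.card).map e := by
      ext j
      simp only [Finset.mem_Icc, Finset.mem_map, Finset.mem_range, he]
      constructor
      · intro h
        exact ⟨(j - a).toNat, by omega, by omega⟩
      · rintro ⟨i, hi, rfl⟩
        omega
    have h2 : T = (l : Multiset X) := (Multiset.sort_eq T (· ≤ ·)).symm
    rw [h1, Finset.map_val, Multiset.map_map, Finset.range_val, ← hlen]
    conv_rhs => rw [h2]
    rw [← Multiset.coe_range, Multiset.map_coe]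
    congr 1
    refine List.ext_getElem (by simp) fun i h3 h4 => ?_
    rw [List.getElem_map, List.getElem_range, Function.comp_apply, he, add_sub_cancel_left,
      Int.toNat_natCast, List.getD_eq_getElem _ _ h4]

theorem Icc_val_eq_add {a b c d : ℤ} (h1 : a ≤ b + 1) (h2 : b ≤ c) (h3 : c ≤ d) :
    (Finset.Icc a d).val =
      (Finset.Icc a b).val + (Finset.Icc (b + 1) c).val + (Finset.Icc (c + 1) d).val := by
  have d1 : Disjoint (Finset.Icc a b) (Finset.Icc (b + 1) c) := by
    rw [Finset.disjoint_left]
    intro x hx hy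
    rw [Finset.mem_Icc] at hx hy
    omega
  have d2 : Disjoint ((Finset.Icc a b).disjUnion _ d1) (Finset.Icc (c + 1) d) := by
    rw [Finset.disjoint_left]
    intro x hx hy
    simp only [Finset.mem_disjUnion, Finset.mem_Icc] at hx hy
    omega
  have e : Finset.Icc a d = ((Finset.Icc a b).disjUnion _ d1).disjUnion _ d2 := by
    ext x
    simp only [Finset.mem_disjUnion, Finset.mem_Icc]
    omega
  rw [e]
  rfl

/-- Monotone enumeration of the union of an increasing sequence of finite multisets, each of which
arises from the previous one by adding a pair on either side. -/
theorem exists_monotone_enumeration [Inhabited X] {S A B : ℕ → Multiset X} {K : ℕ}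
    (hS : (S 0).card = 2 * (2 * K + 1)) (hA : ∀ k, (A k).card = 2) (hB : ∀ k, (B k).card = 2)
    (hsucc : ∀ k, S (k + 1) = A k + S k + B k) (hAS : ∀ k, ∀ x ∈ A k, ∀ y ∈ S k, x ≤ y)
    (hSB : ∀ k, ∀ x ∈ S k, ∀ y ∈ B k, x ≤ y) :
    ∃ μ : ℤ → X, Monotone μ ∧
      (∀ k : ℕ, Multiset.map μ (Finset.Icc (-2 * (K + k : ℤ)) (2 * (K + k) + 1)).val = S k) ∧
      (∀ k : ℕ, Multiset.map μ (Finset.Icc (-2 * (K + k + 1 : ℤ))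
        (-2 * (K + k + 1 : ℤ) + 1)).val = A k) ∧
      ∀ k : ℕ, Multiset.map μ (Finset.Icc (2 * (K + k + 1 : ℤ))
        (2 * (K + k + 1 : ℤ) + 1)).val = B k := by
  obtain ⟨f, fm, hf⟩ := exists_enum_Icc (S 0) (-2 * K)
  choose g gm hg using fun k : ℕ => exists_enum_Icc (A k) (-2 * (K + k + 1))
  choose h hm hh using fun k : ℕ => exists_enum_Icc (B k) (2 * (K + k + 1))
  rw [show (-2 * (K : ℤ) + (S 0).card - 1) = 2 * K + 1 by rw [hS]; push_cast; ring] at fm hf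
  have eA : ∀ k : ℕ, (-2 * (K + k + 1 : ℤ) + (A k).card - 1) = -2 * (K + k + 1) + 1 := by
    intro k
    rw [hA]
    push_cast
    ring
  have eB : ∀ k : ℕ, (2 * (K + k + 1 : ℤ) + (B k).card - 1) = 2 * (K + k + 1) + 1 := by
    intro k
    rw [hB]
    push_cast
    ring
  simp only [eA] at gm hg
  simp only [eB] at hm hh
  -- Indices 2n and 2n + 1 form block n = ⌊j/2⌋. Outside the central list |n| = K + k + 1, which
  -- recovers the k whose pair is used.
  let μ : ℤ → X := fun j => if j < -2 * K then g (-(j / 2) - K - 1).toNat j else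
    if j ≤ 2 * K + 1 then f j else h (j / 2 - K - 1).toNat j
  have μf : ∀ j : ℤ, -2 * K ≤ j → j ≤ 2 * K + 1 → μ j = f j := by
    intro j h1 h2
    simp only [μ]
    rw [if_neg (by omega), if_pos h2]
  have μg : ∀ (k : ℕ) (j : ℤ), -2 * (K + k + 1) ≤ j → j ≤ -2 * (K + k + 1) + 1 → μ j = g k j := by
    intro k j h1 h2
    simp only [μ]
    rw [if_pos (by omega), show (-(j / 2) - K - 1).toNat = k by omega]
  have μh : ∀ (k : ℕ) (j : ℤ), 2 * (K + k + 1) ≤ j → j ≤ 2 * (K + k + 1) + 1 → μ j = h k j := by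
    intro k j h1 h2
    simp only [μ]
    rw [if_neg (by omega), if_neg (by omega), show (j / 2 - K - 1).toNat = k by omega]
  have mA : ∀ k : ℕ, Multiset.map μ (Finset.Icc (-2 * (K + k + 1 : ℤ))
      (-2 * (K + k + 1 : ℤ) + 1)).val = A k := by
    intro k
    rw [← hg k]
    refine Multiset.map_congr rfl fun j hj => ?_
    rw [Finset.mem_val, Finset.mem_Icc] at hj
    exact μg k j hj.1 hj.2
  have mB : ∀ k : ℕ, Multiset.map μ (Finset.Icc (2 * (K + k + 1 : ℤ))
      (2 * (K + k + 1 : ℤ) + 1)).val = B k := by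
    intro k
    rw [← hh k]
    refine Multiset.map_congr rfl fun j hj => ?_
    rw [Finset.mem_val, Finset.mem_Icc] at hj
    exact μh k j hj.1 hj.2
  have mS : ∀ k : ℕ, Multiset.map μ
      (Finset.Icc (-2 * (K + k : ℤ)) (2 * (K + k) + 1)).val = S k := by
    intro k
    induction k with
    | zero =>
      rw [← hf, Nat.cast_zero, add_zero]
      refine Multiset.map_congr rfl fun j hj => ?_
      rw [Finset.mem_val, Finset.mem_Icc] at hj
      exact μf j hj.1 hj.2
    | succ k ih =>
      rw [hsucc, ← ih, ← mA, ← mB, ← Multiset.map_add, ← Multiset.map_add]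
      congr 1
      rw [Icc_val_eq_add (b := -2 * (K + k + 1 : ℤ) + 1) (c := 2 * (K + k) + 1)
        (by push_cast; omega) (by omega) (by push_cast; omega)]
      have e1 : -2 * (K + k + 1 : ℤ) + 1 + 1 = -2 * (K + k) := by ring
      have e2 : 2 * (K + k : ℤ) + 1 + 1 = 2 * (K + k + 1) := by ring
      rw [e1, e2, Nat.cast_succ, add_assoc (K : ℤ)]
  have memS : ∀ (k : ℕ) (j : ℤ), -2 * (K + k : ℤ) ≤ j → j ≤ 2 * (K + k) + 1 → μ j ∈ S k := by
    intro k j h1 h2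
    rw [← mS k]
    exact Multiset.mem_map_of_mem _ (Finset.mem_Icc.2 ⟨h1, h2⟩)
  have memA : ∀ (k : ℕ) (j : ℤ), -2 * (K + k + 1 : ℤ) ≤ j → j ≤ -2 * (K + k + 1 : ℤ) + 1 →
      μ j ∈ A k := by
    intro k j h1 h2
    rw [← mA k]
    exact Multiset.mem_map_of_mem _ (Finset.mem_Icc.2 ⟨h1, h2⟩)
  have memB : ∀ (k : ℕ) (j : ℤ), 2 * (K + k + 1 : ℤ) ≤ j → j ≤ 2 * (K + k + 1 : ℤ) + 1 →
      μ j ∈ B k := by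
    intro k j h1 h2
    rw [← mB k]
    exact Multiset.mem_map_of_mem _ (Finset.mem_Icc.2 ⟨h1, h2⟩)
  refine ⟨μ, monotone_int_of_le_succ fun j => ?_, mS, mA, mB⟩
  by_cases h1 : -2 * (K : ℤ) ≤ j ∧ j + 1 ≤ 2 * K + 1
  · rw [μf j h1.1 (by omega), μf (j + 1) (by omega) h1.2]
    exact fm ⟨h1.1, by omega⟩ ⟨by omega, h1.2⟩ (by omega)
  rcases Int.even_or_odd' j with ⟨n, rfl | rfl⟩
  · rcases lt_or_ge (2 * n) 0 with hn | hn
    · obtain ⟨k, hk⟩ : ∃ k : ℕ, n = -(K + k + 1 : ℤ) := ⟨(-n - K - 1).toNat, by omega⟩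
      rw [μg k _ (by omega) (by omega), μg k _ (by omega) (by omega)]
      exact gm k ⟨by omega, by omega⟩ ⟨by omega, by omega⟩ (by omega)
    · obtain ⟨k, hk⟩ : ∃ k : ℕ, n = (K + k + 1 : ℤ) := ⟨(n - K - 1).toNat, by omega⟩
      rw [μh k _ (by omega) (by omega), μh k _ (by omega) (by omega)]
      exact hm k ⟨by omega, by omega⟩ ⟨by omega, by omega⟩ (by omega)
  · rcases lt_or_ge (2 * n) 0 with hn | hn
    · obtain ⟨k, hk⟩ : ∃ k : ℕ, n = -(K + k + 1 : ℤ) := ⟨(-n - K - 1).toNat, by omega⟩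
      exact hAS k _ (memA k _ (by omega) (by omega)) _ (memS k _ (by omega) (by omega))
    · obtain ⟨k, hk⟩ : ∃ k : ℕ, n = (K + k : ℤ) := ⟨(n - K).toNat, by omega⟩
      exact hSB k _ (memS k _ (by omega) (by omega)) _ (memB k _ (by omega) (by omega))

/-- Comparison of two monotone enumerations with the same multiplicities and a common cut. -/
theorem le_of_encard_fiber_eq {μ ν : ℤ → X} (hμ : Monotone μ) (hν : Monotone ν)
    (h : ∀ x, {j | μ j = x}.encard = {j | ν j = x}.encard) {b : ℤ} {P : X → Prop}
    (hμP : ∀ j, P (μ j) ↔ j ≤ b) (hνP : ∀ j, P (ν j) ↔ j ≤ b) {j : ℤ} (hj : j ≤ b) :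
    μ j ≤ ν j := by
  -- Pigeonhole: if ν j < μ j, every ν-index with a value among μ j, …, μ b lies in (j, b], since ν
  -- ≤ ν j < μ j up to j and the cut bounds it by b. Equal multiplicities would then fit b - j + 1
  -- entries into b - j places.
  by_contra! hlt
  have h1 : (Finset.Icc j b).card = ∑ x ∈ (Finset.Icc j b).image μ,
      ((Finset.Icc j b).filter fun i => μ i = x).card :=
    Finset.card_eq_sum_card_fiberwise fun i hi => Finset.mem_coe.2 (Finset.mem_image_of_mem μ hi)
  have h2 : ∑ x ∈ (Finset.Icc j b).image μ,
      ((Finset.Icc (j + 1) b).filter fun i => ν i = x).card ≤ (Finset.Icc (j + 1) b).card := by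
    rw [← Finset.card_biUnion]
    · refine Finset.card_le_card fun i hi => ?_
      obtain ⟨x, -, hx⟩ := Finset.mem_biUnion.1 hi
      exact (Finset.mem_filter.1 hx).1
    · intro x _ y _ hxy
      rw [Function.onFun, Finset.disjoint_left]
      intro i hx hy
      exact hxy ((Finset.mem_filter.1 hx).2.symm.trans (Finset.mem_filter.1 hy).2)
  have h3 : ∑ x ∈ (Finset.Icc j b).image μ, ((Finset.Icc j b).filter fun i => μ i = x).card ≤
      ∑ x ∈ (Finset.Icc j b).image μ, ((Finset.Icc (j + 1) b).filter fun i => ν i = x).card := by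
    refine Finset.sum_le_sum fun x hx => ?_
    obtain ⟨i₀, hi₀, rfl⟩ := Finset.mem_image.1 hx
    rw [Finset.mem_Icc] at hi₀
    have h4 : (((Finset.Icc j b).filter fun i => μ i = μ i₀ : Finset ℤ) : Set ℤ).encard ≤
        (((Finset.Icc (j + 1) b).filter fun i => ν i = μ i₀ : Finset ℤ) : Set ℤ).encard := by
      calc _ ≤ {i | μ i = μ i₀}.encard :=
            Set.encard_le_encard fun i hi => (Finset.mem_filter.1 hi).2
        _ = {i | ν i = μ i₀}.encard := h _
        _ ≤ _ := Set.encard_le_encard fun i hi => by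
            have hi' : ν i = μ i₀ := hi
            refine Finset.mem_coe.2 (Finset.mem_filter.2 ⟨Finset.mem_Icc.2 ⟨?_, ?_⟩, hi'⟩)
            · by_contra! hij
              have h5 : ν i ≤ ν j := hν (by omega)
              rw [hi'] at h5
              exact absurd (hμ hi₀.1) (not_le.2 (h5.trans_lt hlt))
            · rw [← hνP, hi', hμP]
              exact hi₀.2
    rw [Set.encard_coe_eq_coe_finsetCard, Set.encard_coe_eq_coe_finsetCard] at h4
    exact_mod_cast h4
  have h6 := h1.le.trans (h3.trans h2)
  rw [Int.card_Icc, Int.card_Icc] at h6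
  omega

end Enumeration

/-! ### Lexicographic labelling of the spectrum and its uniqueness -/

noncomputable section Lexicographic

/-- `ℂ` as the lexicographic product of its real and imaginary axes. -/
def lexEquiv : ℂ ≃ ℝ ×ₗ ℝ := Complex.equivRealProd.trans toLex

theorem lexLE_iff {z w : ℂ} : LexLE z w ↔ lexEquiv z ≤ lexEquiv w := by
  rw [Prod.Lex.le_iff]
  rfl

/-- The lexicographic order on `ℂ`. -/
abbrev lexLinearOrder : LinearOrder ℂ := LinearOrder.lift' lexEquiv lexEquiv.injective

theorem LexLE.re_le {z w : ℂ} (h : LexLE z w) : z.re ≤ w.re := by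
  rcases h with h | h
  · exact h.le
  · exact h.1.le

theorem exists_lex_enumeration {S A B : ℕ → Multiset ℂ} {K : ℕ}
    (hS : (S 0).card = 2 * (2 * K + 1)) (hA : ∀ k, (A k).card = 2) (hB : ∀ k, (B k).card = 2)
    (hsucc : ∀ k, S (k + 1) = A k + S k + B k) (hAS : ∀ k, ∀ x ∈ A k, ∀ y ∈ S k, LexLE x y)
    (hSB : ∀ k, ∀ x ∈ S k, ∀ y ∈ B k, LexLE x y) :
    ∃ μ : ℤ → ℂ, (∀ i j, i ≤ j → LexLE (μ i) (μ j)) ∧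
      (∀ k : ℕ, Multiset.map μ (Finset.Icc (-2 * (K + k : ℤ)) (2 * (K + k) + 1)).val = S k) ∧
      (∀ k : ℕ, Multiset.map μ (Finset.Icc (-2 * (K + k + 1 : ℤ))
        (-2 * (K + k + 1 : ℤ) + 1)).val = A k) ∧
      ∀ k : ℕ, Multiset.map μ (Finset.Icc (2 * (K + k + 1 : ℤ))
        (2 * (K + k + 1 : ℤ) + 1)).val = B k := by
  simp only [lexLE_iff] at hAS hSB ⊢
  obtain ⟨μ, h1, h2⟩ := @exists_monotone_enumeration ℂ lexLinearOrder ⟨0⟩ S A B K hS hA hB hsucc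
    hAS hSB
  exact ⟨μ, fun i j hij => h1 hij, h2⟩

/-- Given j, take a cut k beyond both thresholds with j ≤ 2k + 1; comparing the two enumerations
below this common cut in both directions gives equality at j. -/
theorem eq_of_encard_fiber_eq {μ ν : ℤ → ℂ} (hμ : ∀ i j, i ≤ j → LexLE (μ i) (μ j))
    (hν : ∀ i j, i ≤ j → LexLE (ν i) (ν j))
    (h : ∀ z, {j | μ j = z}.encard = {j | ν j = z}.encard) {k₁ k₂ : ℕ}
    (hμc : ∀ k : ℕ, k₁ ≤ k → ∀ j, (μ j).re ≤ (k + 1 / 2) * Real.pi ↔ j ≤ 2 * k + 1)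
    (hνc : ∀ k : ℕ, k₂ ≤ k → ∀ j, (ν j).re ≤ (k + 1 / 2) * Real.pi ↔ j ≤ 2 * k + 1) : μ = ν := by
  simp only [lexLE_iff] at hμ hν
  funext j
  set k := k₁ + k₂ + j.natAbs
  have hj : j ≤ 2 * k + 1 := by omega
  have a1 := hμc k (by omega)
  have a2 := hνc k (by omega)
  have l1 : lexEquiv (μ j) ≤ lexEquiv (ν j) :=
    @le_of_encard_fiber_eq ℂ lexLinearOrder μ ν (fun i j => hμ i j) (fun i j => hν i j) h _
      (fun z => z.re ≤ (k + 1 / 2) * Real.pi) a1 a2 j hj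
  have l2 : lexEquiv (ν j) ≤ lexEquiv (μ j) :=
    @le_of_encard_fiber_eq ℂ lexLinearOrder ν μ (fun i j => hν i j) (fun i j => hμ i j)
      (fun z => (h z).symm) _ (fun z => z.re ≤ (k + 1 / 2) * Real.pi) a2 a1 j hj
  exact lexEquiv.injective (le_antisymm l1 l2)

theorem encard_even_add_encard_odd {X : Type*} (μ : ℤ → X) (x : X) :
    {n : ℤ | μ (2 * n) = x}.encard + {n : ℤ | μ (2 * n + 1) = x}.encard =
      {j : ℤ | μ j = x}.encard := by
  have i1 : Function.Injective fun n : ℤ => 2 * n := fun a b h => by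
    have : 2 * a = 2 * b := h
    omega
  have i2 : Function.Injective fun n : ℤ => 2 * n + 1 := fun a b h => by
    have : 2 * a + 1 = 2 * b + 1 := h
    omega
  rw [← i1.encard_image {n : ℤ | μ (2 * n) = x}, ← i2.encard_image {n : ℤ | μ (2 * n + 1) = x},
    ← Set.encard_union_eq]
  · congr 1
    ext j
    constructor
    · rintro (⟨n, hn, rfl⟩ | ⟨n, hn, rfl⟩) <;> exact hn
    · intro hj
      rcases Int.even_or_odd' j with ⟨n, rfl | rfl⟩
      · exact Or.inl ⟨n, hj, rfl⟩
      · exact Or.inr ⟨n, hj, rfl⟩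
  · rw [Set.disjoint_left]
    rintro _ ⟨n, -, rfl⟩ ⟨m, -, hm⟩
    have : 2 * m + 1 = 2 * n := hm
    omega

/-- The sequence `…, λₙ⁻, λₙ⁺, λₙ₊₁⁻, …`. -/
def flatten (lam : ℤ → ℂ × ℂ) (j : ℤ) : ℂ :=
  if Even j then (lam (j / 2)).1 else (lam (j / 2)).2

theorem flatten_even (lam : ℤ → ℂ × ℂ) (n : ℤ) : flatten lam (2 * n) = (lam n).1 := by
  rw [flatten, if_pos (even_two_mul n), show 2 * n / 2 = n by omega]

theorem flatten_odd (lam : ℤ → ℂ × ℂ) (n : ℤ) : flatten lam (2 * n + 1) = (lam n).2 := by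
  rw [flatten, if_neg (Int.not_even_two_mul_add_one n), show (2 * n + 1) / 2 = n by omega]

theorem flatten_injective : Function.Injective flatten := by
  intro lam lam' h
  funext n
  refine Prod.ext ?_ ?_
  · rw [← flatten_even, h, flatten_even]
  · rw [← flatten_odd, h, flatten_odd]

variable {φ : Potential} {lam : ℤ → ℂ × ℂ}

theorem IsPeriodicSpectrum.lexLE_flatten (h : IsPeriodicSpectrum φ lam) (i j : ℤ) (hij : i ≤ j) :
    LexLE (flatten lam i) (flatten lam j) := by
  have hm : Monotone fun j => lexEquiv (flatten lam j) := by
    refine monotone_int_of_le_succ fun j => ?_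
    rw [← lexLE_iff]
    rcases Int.even_or_odd' j with ⟨n, rfl | rfl⟩
    · rw [flatten_even, flatten_odd]
      exact h.lex_pair n
    · rw [show 2 * n + 1 + 1 = 2 * (n + 1) by ring, flatten_even, flatten_odd]
      exact h.lex_succ n
  exact lexLE_iff.2 (hm hij)

theorem IsPeriodicSpectrum.encard_flatten (h : IsPeriodicSpectrum φ lam) (z : ℂ) :
    {j | flatten lam j = z}.encard = algMult (zsOperator φ) z := by
  rw [← encard_even_add_encard_odd, ← h.multiplicity z]
  simp only [flatten_even, flatten_odd]

theorem eventually_abs_re_sub_lt {f : ℤ → ℂ}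
    (h : Summable fun n : ℤ => ‖f n - (n : ℂ) * Real.pi‖ ^ 2) :
    ∀ᶠ n : ℤ in Filter.atTop, |(f n).re - n * Real.pi| < 1 := by
  have h1 := h.tendsto_cofinite_zero.mono_left
    (Int.cofinite_eq ▸ le_sup_right : (Filter.atTop : Filter ℤ) ≤ Filter.cofinite)
  filter_upwards [h1.eventually_lt_const one_pos] with n hn
  have h2 := Complex.abs_re_le_norm (f n - n * Real.pi)
  simp only [Complex.sub_re, Complex.mul_re, Complex.intCast_re, Complex.ofReal_re,
    Complex.intCast_im, Complex.ofReal_im, mul_zero, sub_zero] at h2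
  exact h2.trans_lt ((sq_lt_one_iff₀ (norm_nonneg _)).1 hn)

/-- Square summability puts λ_k^± within real distance 1 of kπ for large k, so λ_k⁺ lies left and
λ_{k+1}⁻ right of (k + 1/2)π; the order settles the other indices. This is where the asymptotic
normalization pins the labels. -/
theorem IsPeriodicSpectrum.exists_cut (h : IsPeriodicSpectrum φ lam) : ∃ k₀ : ℕ, ∀ k : ℕ, k₀ ≤ k →
    ∀ j, (flatten lam j).re ≤ (k + 1 / 2) * Real.pi ↔ j ≤ 2 * k + 1 := by
  have h1 := (eventually_abs_re_sub_lt (f := fun n => (lam n).1) h.asymp_minus).and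
    (eventually_abs_re_sub_lt (f := fun n => (lam n).2) h.asymp_plus)
  obtain ⟨N, hN⟩ := Filter.eventually_atTop.1 h1
  refine ⟨N.toNat, fun k hk j => ?_⟩
  have hpi := Real.pi_gt_three
  constructor
  · intro hj
    by_contra! hlt
    have h2 := (h.lexLE_flatten (2 * (k + 1)) j (by omega)).re_le
    rw [flatten_even] at h2
    have h3 := abs_lt.1 (hN (k + 1) (by omega)).1
    push_cast at h3
    linarith [h3.1]
  · intro hj
    have h2 := (h.lexLE_flatten j (2 * k + 1) (by omega)).re_le
    rw [flatten_odd] at h2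
    have h3 := abs_lt.1 (hN k (by omega)).2
    push_cast at h3
    linarith [h3.2]

theorem IsPeriodicSpectrum.unique (h : IsPeriodicSpectrum φ lam) {lam' : ℤ → ℂ × ℂ}
    (h' : IsPeriodicSpectrum φ lam') : lam' = lam := by
  obtain ⟨k₁, c₁⟩ := h.exists_cut
  obtain ⟨k₂, c₂⟩ := h'.exists_cut
  exact flatten_injective (eq_of_encard_fiber_eq h'.lexLE_flatten h.lexLE_flatten
    (fun z => (h'.encard_flatten z).trans (h.encard_flatten z).symm) c₂ c₁)

variable {p q : ℤ → ℂ} {α β : ℝ}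

theorem bracket_intCast (n : ℤ) : bracket n = n.natAbs + 1 := by
  rw [bracket, ← Int.cast_abs, Int.abs_eq_natAbs, Int.cast_natCast, add_comm]

theorem abs_re_sub_le_norm (z : ℂ) (n : ℤ) : |z.re - n * Real.pi| ≤ ‖z - n * Real.pi‖ := by
  have h2 := Complex.abs_re_le_norm (z - n * Real.pi)
  simpa only [Complex.sub_re, Complex.mul_re, Complex.intCast_re, Complex.ofReal_re,
    Complex.intCast_im, Complex.ofReal_im, mul_zero, sub_zero] using h2

theorem cutRadius_mono {k l : ℕ} (h : k ≤ l) : cutRadius k ≤ cutRadius l := by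
  have h4 : (k : ℝ) ≤ l := by exact_mod_cast h
  unfold cutRadius
  nlinarith [Real.pi_pos]

/-- The eigenvalues between two consecutive cuts are those near `±(k + 1)π`. -/
theorem multiset_cut_succ (hp : WeightedBound p α) (hq : WeightedBound q β) {k : ℕ}
    (hk : 8 * (α ^ 2 + β ^ 2) ≤ k + 2) {S S' A B : Multiset ℂ}
    (hS : ∀ z ∈ S, ‖z‖ < cutRadius k) (mS : ∀ z : ℂ, ‖z‖ < cutRadius k → rootMult p q z = S.count z)
    (hS' : ∀ z ∈ S', ‖z‖ < cutRadius (k + 1))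
    (mS' : ∀ z : ℂ, ‖z‖ < cutRadius (k + 1) → rootMult p q z = S'.count z)
    (hA : ∀ z ∈ A, ‖z - (-(k + 1) : ℤ) * Real.pi‖ < 1)
    (mA : ∀ z : ℂ, ‖z - (-(k + 1) : ℤ) * Real.pi‖ < 1 → rootMult p q z = A.count z)
    (hB : ∀ z ∈ B, ‖z - ((k + 1 : ℤ)) * Real.pi‖ < 1)
    (mB : ∀ z : ℂ, ‖z - ((k + 1 : ℤ)) * Real.pi‖ < 1 → rootMult p q z = B.count z) :
    S' = A + S + B := by
  have far : ∀ {m : ℤ} {z : ℂ}, k + 1 ≤ m.natAbs → ‖z - m * Real.pi‖ < 1 → z ∉ S :=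
    fun hm hz hzS => absurd (hS _ hzS) (not_lt.2 (cutRadius_lt_norm hm hz).le)
  have near : ∀ {m : ℤ} {z : ℂ}, m.natAbs = k + 1 → ‖z - m * Real.pi‖ < 1 →
      ‖z‖ < cutRadius (k + 1) := fun hm hz => hm ▸ norm_lt_cutRadius hz
  have sep : ∀ z : ℂ, ‖z - (-(k + 1) : ℤ) * Real.pi‖ < 1 → ¬ ‖z - ((k + 1 : ℤ)) * Real.pi‖ < 1 := by
    intro z h1 h2
    have := eq_of_norm_sub_lt_one h1 h2
    omega
  ext z
  rw [Multiset.count_add, Multiset.count_add]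
  by_cases z1 : ‖z - (-(k + 1) : ℤ) * Real.pi‖ < 1
  · have h1 := mS' z (near (by omega) z1)
    rw [mA z z1, Nat.cast_inj] at h1
    rw [← h1, Multiset.count_eq_zero_of_notMem (far (by omega) z1),
      Multiset.count_eq_zero_of_notMem fun h => sep z z1 (hB z h), add_zero, add_zero]
  by_cases z2 : ‖z - ((k + 1 : ℤ)) * Real.pi‖ < 1
  · have h1 := mS' z (near (by omega) z2)
    rw [mB z z2, Nat.cast_inj] at h1
    rw [← h1, Multiset.count_eq_zero_of_notMem (far (by omega) z2),
      Multiset.count_eq_zero_of_notMem fun h => z1 (hA z h), zero_add, zero_add]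
  rw [Multiset.count_eq_zero_of_notMem fun h => z1 (hA z h),
    Multiset.count_eq_zero_of_notMem fun h => z2 (hB z h), zero_add, add_zero]
  by_cases z3 : ‖z‖ < cutRadius k
  · have h1 := mS' z (z3.trans_le (cutRadius_mono (Nat.le_succ k)))
    rw [mS z z3, Nat.cast_inj] at h1
    exact h1.symm
  · rw [Multiset.count_eq_zero_of_notMem fun h => z3 (hS z h), Multiset.count_eq_zero]
    intro hz
    have h1 := hS' z hz
    have h2 : rootMult p q z ≠ 0 := by
      rw [mS' z h1, Ne, Nat.cast_eq_zero, Multiset.count_eq_zero]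
      exact fun h => h hz
    -- An eigenvalue between the two circles is near some mπ with |m| ≥ k + 1; |m| = k + 1 is one of
    -- the two excluded discs, and a larger |m| would put it outside the outer circle.
    obtain ⟨m, hm, hzm⟩ := exists_near_of_cutRadius_le hp hq hk (not_lt.1 z3)
      (not_isUnit_of_rootMult_ne_zero h2)
    rcases eq_or_lt_of_le hm with h3 | h3
    · rcases Int.natAbs_eq m with h4 | h4
      · rw [← h3] at h4
        subst h4
        exact z2 (by exact_mod_cast hzm)
      · rw [← h3] at h4
        subst h4
        exact z1 (by exact_mod_cast hzm)
    · exact absurd (cutRadius_lt_norm (k := k + 1) h3 hzm) (not_lt.2 h1.le)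

/-- The discs of radius `cutRadius (K + k)` exhaust the plane, each step adding one pair near each
of ±(K + k + 1)π. The first such index has ⟨K + 1⟩ = K + 2, hence the form of `hK`. -/
theorem exists_enumeration (hp : WeightedBound p α) (hq : WeightedBound q β) {K : ℕ}
    (hK : 8 * (α ^ 2 + β ^ 2) ≤ K + 2) :
    ∃ μ : ℤ → ℂ, (∀ i j, i ≤ j → LexLE (μ i) (μ j)) ∧
      (∀ n : ℤ, K + 1 ≤ n.natAbs → ‖μ (2 * n) - n * Real.pi‖ < 1 ∧
        ‖μ (2 * n + 1) - n * Real.pi‖ < 1) ∧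
      (∀ j : ℤ, -2 * K ≤ j → j ≤ 2 * K + 1 → ‖μ j‖ < cutRadius K) ∧
      ∀ z, {j | μ j = z}.encard = rootMult p q z := by
  have hk : ∀ k : ℕ, 8 * (α ^ 2 + β ^ 2) ≤ ((K + k : ℕ) : ℝ) + 2 := by
    intro k
    push_cast
    linarith [Nat.cast_nonneg (α := ℝ) k]
  choose S cS hS mS using fun k : ℕ => exists_multiset_cut hp hq (hk k)
  choose A cA hA mA using fun k : ℕ => exists_multiset_near hp hq (n := -((K + k : ℕ) + 1 : ℤ)) (by
    rw [bracket_intCast, show (-((K + k : ℕ) + 1 : ℤ)).natAbs = K + k + 1 by omega]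
    have := hk k
    push_cast at this ⊢
    linarith)
  choose B cB hB mB using fun k : ℕ => exists_multiset_near hp hq (n := ((K + k : ℕ) + 1 : ℤ)) (by
    rw [bracket_intCast, show ((K + k : ℕ) + 1 : ℤ).natAbs = K + k + 1 by omega]
    have := hk k
    push_cast at this ⊢
    linarith)
  have hsucc : ∀ k, S (k + 1) = A k + S k + B k := fun k =>
    multiset_cut_succ hp hq (hk k) (hS k) (mS k) (hS (k + 1)) (mS (k + 1)) (hA k) (mA k) (hB k)
      (mB k)
  -- Real parts separate the central disc strictly from the new pairs, so imaginary parts never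
  -- matter when gluing.
  have hre : ∀ k : ℕ, ∀ z ∈ S k, |z.re| < ((K + k : ℕ) + 1) * Real.pi - 1 := by
    intro k z hz
    refine (Complex.abs_re_le_norm z).trans_lt ((hS k z hz).trans ?_)
    have := Real.pi_gt_three
    unfold cutRadius
    linarith
  have hAS : ∀ k, ∀ x ∈ A k, ∀ y ∈ S k, LexLE x y := by
    intro k x hx y hy
    left
    have e1 := abs_le.1 ((abs_re_sub_le_norm x _).trans (hA k x hx).le)
    have e2 := abs_lt.1 (hre k y hy)
    push_cast at e1 e2
    linarith [e1.2, e2.1]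
  have hSB : ∀ k, ∀ x ∈ S k, ∀ y ∈ B k, LexLE x y := by
    intro k x hx y hy
    left
    have e1 := abs_le.1 ((abs_re_sub_le_norm y _).trans (hB k y hy).le)
    have e2 := abs_lt.1 (hre k x hx)
    push_cast at e1 e2
    linarith [e1.1, e2.2]
  obtain ⟨μ, h1, h2, h3, h4⟩ :=
    exists_lex_enumeration (K := K) (cS 0) cA cB hsucc hAS hSB
  have near : ∀ n : ℤ, K + 1 ≤ n.natAbs → ‖μ (2 * n) - n * Real.pi‖ < 1 ∧
      ‖μ (2 * n + 1) - n * Real.pi‖ < 1 := by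
    intro n hn
    rcases le_total 0 n with hn0 | hn0
    · obtain ⟨k, hk⟩ : ∃ k : ℕ, n = ((K + k : ℕ) + 1 : ℤ) := ⟨(n - K - 1).toNat, by omega⟩
      have hmem : ∀ j : ℤ, 2 * n ≤ j → j ≤ 2 * n + 1 → μ j ∈ B k := by
        intro j j1 j2
        rw [← h4 k]
        have hj : j ∈ Finset.Icc (2 * (K + k + 1 : ℤ)) (2 * (K + k + 1 : ℤ) + 1) :=
          Finset.mem_Icc.2 ⟨by omega, by omega⟩
        exact Multiset.mem_map_of_mem μ hj
      have e1 := hB k _ (hmem (2 * n) le_rfl (by omega))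
      have e2 := hB k _ (hmem (2 * n + 1) (by omega) le_rfl)
      rw [← hk] at e1 e2
      exact ⟨e1, e2⟩
    · obtain ⟨k, hk⟩ : ∃ k : ℕ, n = -((K + k : ℕ) + 1 : ℤ) := ⟨(-n - K - 1).toNat, by omega⟩
      have hmem : ∀ j : ℤ, 2 * n ≤ j → j ≤ 2 * n + 1 → μ j ∈ A k := by
        intro j j1 j2
        rw [← h3 k]
        have hj : j ∈ Finset.Icc (-2 * (K + k + 1 : ℤ)) (-2 * (K + k + 1 : ℤ) + 1) :=
          Finset.mem_Icc.2 ⟨by omega, by omega⟩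
        exact Multiset.mem_map_of_mem μ hj
      have e1 := hA k _ (hmem (2 * n) le_rfl (by omega))
      have e2 := hA k _ (hmem (2 * n + 1) (by omega) le_rfl)
      rw [← hk] at e1 e2
      exact ⟨e1, e2⟩
  refine ⟨μ, h1, near, fun j j1 j2 => ?_, fun z => ?_⟩
  · refine hS 0 _ ?_
    rw [← h2 0]
    have hj : j ∈ Finset.Icc (-2 * (K + (0 : ℕ) : ℤ)) (2 * (K + (0 : ℕ)) + 1) :=
      Finset.mem_Icc.2 ⟨by omega, by omega⟩
    exact Multiset.mem_map_of_mem μ hj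
  · obtain ⟨k, hkz⟩ := exists_nat_gt ‖z‖
    have hz : ‖z‖ < cutRadius (K + k) := by
      have := Real.pi_gt_three
      have hk0 := Nat.cast_nonneg (α := ℝ) k
      have hK0 := Nat.cast_nonneg (α := ℝ) K
      unfold cutRadius
      push_cast
      nlinarith
    -- Once the disc contains z, all indices with value z lie in the central window: terms outside
    -- it are near mπ with |m| > K + k and so lie beyond the circle.
    have hset : {j | μ j = z} = (((Finset.Icc (-2 * (K + k : ℤ)) (2 * (K + k) + 1)).filter
        fun j => μ j = z : Finset ℤ) : Set ℤ) := by
      ext j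
      rw [Finset.mem_coe, Finset.mem_filter, Finset.mem_Icc]
      refine ⟨fun hj => ⟨?_, hj⟩, fun hj => hj.2⟩
      by_contra hout
      have hj' : μ j = z := hj
      have hn : K + k + 1 ≤ (j / 2).natAbs := by omega
      have hzn : ‖z - (j / 2 : ℤ) * Real.pi‖ < 1 := by
        have hnn := near (j / 2) (by omega)
        rcases Int.even_or_odd' j with ⟨n, hjn | hjn⟩
        · rw [show 2 * (j / 2) = j by omega, hj'] at hnn
          exact hnn.1
        · rw [show 2 * (j / 2) + 1 = j by omega, hj'] at hnn
          exact hnn.2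
      exact absurd (cutRadius_lt_norm hn hzn) (not_lt.2 hz.le)
    rw [hset, Set.encard_coe_eq_coe_finsetCard, mS k z hz, ← h2 k, Multiset.count_map,
      Finset.card_def, Finset.filter_val]
    simp only [eq_comm]

end Lexicographic

/-! ### Assembly of the localization theorem -/

noncomputable section Localization

theorem eight_mul_le_bracket_iff {s : ℝ} {n : ℤ} :
    8 * s ≤ bracket n ↔ ⌈8 * s - 1⌉₊ ≤ n.natAbs := by
  rw [bracket_intCast, Nat.ceil_le]
  constructor <;> intro h <;> linarith

theorem eight_mul_le_ceil {s : ℝ} : 8 * s ≤ ((⌈8 * s - 1⌉₊ - 1 : ℕ) : ℝ) + 2 := by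
  have h1 := Nat.le_ceil (8 * s - 1)
  have h2 : (⌈8 * s - 1⌉₊ : ℝ) ≤ ((⌈8 * s - 1⌉₊ - 1 : ℕ) : ℝ) + 1 := by
    have : ⌈8 * s - 1⌉₊ ≤ ⌈8 * s - 1⌉₊ - 1 + 1 := by omega
    exact_mod_cast this
  linarith

/-- Comparison with C²/n² away from the finitely many n with |n| ≤ K. -/
theorem summable_sq_of_le_div_bracket {f : ℤ → ℝ} {C : ℝ} {K : ℕ}
    (h : ∀ n : ℤ, K + 1 ≤ n.natAbs → |f n| ≤ C / bracket n) : Summable fun n => f n ^ 2 := by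
  have h1 : Summable fun n : ℤ => C ^ 2 * (1 / (n : ℝ) ^ 2) :=
    (Real.summable_one_div_int_pow.2 one_lt_two).mul_left _
  refine Summable.of_norm_bounded_eventually h1 ?_
  rw [Filter.eventually_cofinite]
  refine (Set.finite_Icc (-(K : ℤ)) K).subset fun n hn => ?_
  by_contra hout
  rw [Set.mem_Icc] at hout
  apply hn
  have h2 := h n (by omega)
  have h3 : 0 < |(n : ℝ)| := by
    rw [abs_pos, Int.cast_ne_zero]
    omega
  have h4 : 0 ≤ C := by
    by_contra! hC
    have := (abs_nonneg _).trans h2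
    exact absurd this (not_le.2 (div_neg_of_neg_of_pos hC (by unfold bracket; positivity)))
  have h5 : |f n| ≤ C / |(n : ℝ)| :=
    h2.trans (div_le_div_of_nonneg_left h4 h3 (by unfold bracket; linarith))
  rw [Real.norm_of_nonneg (sq_nonneg _), ← sq_abs, mul_one_div, ← sq_abs (n : ℝ), ← div_pow]
  exact pow_le_pow_left₀ (abs_nonneg _) h5 2

theorem localization_radius_le_div {s r : ℝ} (hr : 0 ≤ r) (n : ℤ) :
    s / bracket n + r / bracket (2 * n) ≤ (s + r) / bracket n := by
  have h1 : (0 : ℝ) < bracket n := by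
    unfold bracket
    positivity
  have h2 : bracket n ≤ bracket (2 * n) := by
    unfold bracket
    rw [abs_mul, abs_two]
    linarith [abs_nonneg (n : ℝ)]
  rw [add_div]
  exact add_le_add_right (div_le_div_of_nonneg_left hr h1 h2) _

/-- Existence, uniqueness and localization of the periodic spectrum. -/
theorem exists_unique_periodicSpectrum (φ : Potential) (hφ : MemH1 φ) :
    ∃ lam : ℤ → ℂ × ℂ,
      IsPeriodicSpectrum φ lam ∧
      (∀ lam' : ℤ → ℂ × ℂ, IsPeriodicSpectrum φ lam' → lam' = lam) ∧
      (∀ n : ℤ, 8 * h1Norm φ ^ 2 ≤ bracket n →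
        ∀ z : ℂ, z = (lam n).1 ∨ z = (lam n).2 →
          ‖z - (n : ℂ) * Real.pi‖ ≤
              h1Norm φ ^ 2 / bracket n +
                Real.sqrt 2 * h1Norm φ / bracket (2 * n) ∧
            h1Norm φ ^ 2 / bracket n +
                Real.sqrt 2 * h1Norm φ / bracket (2 * n) ≤
              Real.pi / 5) ∧
      (∀ n : ℤ, bracket n < 8 * h1Norm φ ^ 2 →
        ∀ z : ℂ, z = (lam n).1 ∨ z = (lam n).2 →
          |z.re| ≤ (8 * h1Norm φ ^ 2 - 1 / 2) * Real.pi ∧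
            |z.im| ≤ h1Norm φ) := by
  obtain ⟨α, β, hp, hq, hαβ⟩ := exists_weightedBound hφ
  have hnorm : Real.sqrt (α ^ 2 + β ^ 2) = h1Norm φ := by
    have h0 : 0 ≤ h1Norm φ := Real.sqrt_nonneg _
    rw [hαβ, Real.sqrt_sq h0]
  set s : ℝ := α ^ 2 + β ^ 2 with hs
  have hs0 : 0 ≤ s := by positivity
  -- N is the least |n| with 8s ≤ ⟨n⟩. The central window uses K = N - 1, truncated at 0 when N = 0.
  set N : ℕ := ⌈8 * s - 1⌉₊ with hN
  have hK : 8 * s ≤ ((N - 1 : ℕ) : ℝ) + 2 := eight_mul_le_ceil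
  obtain ⟨μ, hμ, hnear, hbox, hmult⟩ := exists_enumeration hp hq hK
  have hpi := Real.pi_gt_d2
  have hspec : ∀ j, ¬ IsUnit
      (pencil baseOp (potentialOp (minusSeq φ) (plusSeq φ)) (μ j)) := by
    intro j
    refine not_isUnit_of_rootMult_ne_zero ?_
    rw [← hmult, Set.encard_ne_zero]
    exact ⟨j, rfl⟩
  have hstrip : ∀ (n : ℤ) (j : ℤ), j = 2 * n ∨ j = 2 * n + 1 → 8 * s ≤ bracket n →
      |(μ j).re - n * Real.pi| ≤ Real.pi / 2 := by
    intro n j hj hn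
    rw [eight_mul_le_bracket_iff, ← hN] at hn
    by_cases h1 : N - 1 + 1 ≤ n.natAbs
    · have h2 := hnear n h1
      rcases hj with rfl | rfl
      · linarith [abs_re_sub_le_norm (μ (2 * n)) n, h2.1]
      · linarith [abs_re_sub_le_norm (μ (2 * n + 1)) n, h2.2]
    -- Here N = 0 was truncated, so n = 0 is localized although it lies in the central window. A
    -- real part beyond π/2 would place the eigenvalue near some mπ with m ≠ 0, outside the central
    -- disc.
    · have h0 : n = 0 := by omega
      have hN0 : N - 1 = 0 := by omega
      have h2 := hbox j (by omega) (by omega)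
      rw [h0, Int.cast_zero, zero_mul, sub_zero]
      by_contra! h3
      obtain ⟨m, hm, hzm⟩ := exists_near_of_lt_abs_re hp hq (k := N - 1) hK (z := μ j) (by
        rw [hN0]
        push_cast
        linarith) (hspec j)
      exact absurd (cutRadius_lt_norm hm hzm) (not_lt.2 h2.le)
  have hloc : ∀ (n : ℤ) (j : ℤ), j = 2 * n ∨ j = 2 * n + 1 → 8 * s ≤ bracket n →
      ‖μ j - n * Real.pi‖ ≤ s / bracket n + Real.sqrt 2 * h1Norm φ / bracket (2 * n) := by
    intro n j hj hn
    have := norm_sub_le_of_not_isUnit hp hq hn (hstrip n j hj hn) (hspec j)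
    rwa [← hs, hnorm] at this
  have hsum : ∀ i : ℤ, i = 0 ∨ i = 1 → Summable fun n : ℤ => ‖μ (2 * n + i) - n * Real.pi‖ ^ 2 := by
    intro i hi
    refine summable_sq_of_le_div_bracket (C := s + Real.sqrt 2 * h1Norm φ) (K := N) fun n hn => ?_
    rw [abs_norm]
    refine (hloc n _ (by omega) (eight_mul_le_bracket_iff.2 (by omega))).trans ?_
    exact localization_radius_le_div (mul_nonneg (Real.sqrt_nonneg _) (Real.sqrt_nonneg _)) n
  have hsumm : Summable fun j => ‖minusSeq φ j‖ := hp.summable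
  have hsump : Summable fun j => ‖plusSeq φ j‖ := hq.summable
  have hspectrum : IsPeriodicSpectrum φ fun n => (μ (2 * n), μ (2 * n + 1)) := by
    refine ⟨fun z => ?_, fun n => hμ _ _ (by omega), fun n => hμ _ _ (by omega), ?_, ?_⟩
    · rw [algMult_zsOperator hsumm hsump]
      exact (encard_even_add_encard_odd μ z).trans (hmult z)
    · simpa only [add_zero] using hsum 0 (Or.inl rfl)
    · exact hsum 1 (Or.inr rfl)
  have hindex : ∀ (n : ℤ) (z : ℂ), z = μ (2 * n) ∨ z = μ (2 * n + 1) →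
      ∃ j, (j = 2 * n ∨ j = 2 * n + 1) ∧ z = μ j := by
    rintro n z (h | h)
    · exact ⟨_, Or.inl rfl, h⟩
    · exact ⟨_, Or.inr rfl, h⟩
  refine ⟨_, hspectrum, fun lam' h' => hspectrum.unique h', fun n hn z hz => ?_,
    fun n hn z hz => ?_⟩
  · obtain ⟨j, hj, rfl⟩ := hindex n z hz
    rw [← hαβ] at hn ⊢
    refine ⟨hloc n j hj hn, ?_⟩
    rw [← hnorm]
    -- 5/8 = 0.625 < 3.14/5, so π > 3.14 is needed.
    exact (localization_radius_le hs0 hn).trans (by linarith)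
  · obtain ⟨j, hj, rfl⟩ := hindex n z hz
    rw [← hαβ] at hn ⊢
    have hn' : n.natAbs < N := by
      by_contra! h
      exact absurd (eight_mul_le_bracket_iff.2 h) (not_le.2 hn)
    refine ⟨?_, hnorm ▸ abs_im_le_of_not_isUnit hp hq (hspec j)⟩
    have h1 := hbox j (by omega) (by omega)
    -- The disc alone only gives a bound larger by 1/4; an eigenvalue beyond the vertical lines
    -- would be near an outer mπ and so outside the disc.
    have h2 : |(μ j).re| ≤ ((N - 1 : ℕ) + 1 / 2) * Real.pi := by
      by_contra! h3
      obtain ⟨m, hm, hzm⟩ := exists_near_of_lt_abs_re hp hq hK h3 (hspec j)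
      exact absurd (cutRadius_lt_norm hm hzm) (not_lt.2 h1.le)
    -- The ceiling of 8s - 1 is less than 8s, so (N - 1/2)π < (8s - 1/2)π. Here 8s - 1 ≥ 0 because
    -- some n has |n| < N.
    have h3 : (N : ℝ) < 8 * s := by
      have h4 : 0 ≤ 8 * s - 1 := by
        by_contra! h5
        rw [hN, Nat.ceil_eq_zero.2 h5.le] at hn'
        omega
      have := Nat.ceil_lt_add_one h4
      rw [← hN] at this
      linarith
    rw [Nat.cast_sub (by omega : 1 ≤ N), Nat.cast_one] at h2
    refine h2.trans (mul_le_mul_of_nonneg_right ?_ Real.pi_pos.le)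
    linarith

end Localization

end ZakharovShabat

theorem theorem4 (φ : ZakharovShabat.Potential) (hφ : ZakharovShabat.MemH1 φ) :
    ∃ lam : ℤ → ℂ × ℂ,
      ZakharovShabat.IsPeriodicSpectrum φ lam ∧
      (∀ lam' : ℤ → ℂ × ℂ, ZakharovShabat.IsPeriodicSpectrum φ lam' → lam' = lam) ∧
      (∀ n : ℤ, 8 * ZakharovShabat.h1Norm φ ^ 2 ≤ ZakharovShabat.bracket n →
        ∀ z : ℂ, z = (lam n).1 ∨ z = (lam n).2 →
          ‖z - (n : ℂ) * Real.pi‖ ≤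
              ZakharovShabat.h1Norm φ ^ 2 / ZakharovShabat.bracket n +
                Real.sqrt 2 * ZakharovShabat.h1Norm φ / ZakharovShabat.bracket (2 * n) ∧
            ZakharovShabat.h1Norm φ ^ 2 / ZakharovShabat.bracket n +
                Real.sqrt 2 * ZakharovShabat.h1Norm φ / ZakharovShabat.bracket (2 * n) ≤
              Real.pi / 5) ∧
      (∀ n : ℤ, ZakharovShabat.bracket n < 8 * ZakharovShabat.h1Norm φ ^ 2 →
        ∀ z : ℂ, z = (lam n).1 ∨ z = (lam n).2 →
          |z.re| ≤ (8 * ZakharovShabat.h1Norm φ ^ 2 - 1 / 2) * Real.pi ∧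
            |z.im| ≤ ZakharovShabat.h1Norm φ) := by
  exact ZakharovShabat.exists_unique_periodicSpectrum φ hφ
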